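/- **Setting.** Let $\mathcal T$ be a finite face-to-face mesh of nondegenerate closed tetrahedra in $\mathbb R^3$, $\mathcal P$ the set of their faces (panels), $h_t=\operatorname{diam} t$, and $h$ the mean of the $h_t$. For $t$ with vertices $a,b,c,d$ (in any order, except that the common vertices named below come first and in the same order in both elements) let $M_t=[b-a,\,c-b,\,d-b]$, $\chi_t(\tilde x)=M_t\tilde x+a$; for a panel $\tau$ with vertices $a,b,c$ let $M_\tau=[b-a,\,c-b]$, $\chi_\tau(\tilde y)=M_\tau\tilde y+a$, $|M_\tau|=|(b-a)\times(c-b)|$, and let $n$ be a unit normal of $\tau$. For a node $p$ let $\varphi_p$ be the piecewise linear nodal basis function; $\varphi_p^t$ is its restriction to $t$, extended affinely to $\mathbb R^3$. For nodes $p,q$ and $0<s<1$ put, with $x=\chi_{t_1}(\tilde x)$, $y=\chi_{t_2}(\tilde y)$, respectively $x=\chi_t(\tilde x)$, $y=\chi_\tau(\tilde y)$, $$\tilde k_1(\tilde x,\tilde y)=\frac{[\varphi_p^{t_1}(x)-\varphi_p^{t_2}(y)]\,[\varphi_q^{t_1}(x)-\varphi_q^{t_2}(y)]}{|x-y|^{3+2s}}\,|\det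 M_{t_1}|\,|\det M_{t_2}|,$$ $$\tilde k_2(\tilde x,\tilde y)=\varphi_p^t(x)\,\varphi_q^t(x)\,\frac{(y-x)^Tn}{|x-y|^{3+2s}}\,|\det M_t|\,|M_\tau| .$$ **Hypotheses on the mesh.** All interior angles (face angles and dihedral angles) of all $t\in\mathcal T$ are $>\theta$, where $\theta>0$, and $c_1h_{t_1}\le h_{t_2}\le c_2h_{t_1}$ for all $t_1,t_2\in\mathcal T$, where $c_1,c_2>0$. Two sets $A,B$ are called $c_A$-separated if for all $x\in A$, $y\in B$ there is $z\in A\cap B$ with $|x-y|\ge c_A(|x-z|+|z-y|)$. **Regularized integrands.** Each is a sum over sub-domains $m$ of $\tilde k_\bullet(\mathscr D_m(\eta))\,J_m(\eta)$, $\eta\in[0,1]^k$, where $\mathscr D_m(\eta)=(\tilde x;\tilde y)$ is given below. "And mirror images" means that for every listed pair $(\tilde x;\tilde y)$ also the pair $(\tilde y;\tilde x)$ occurs, with the same $J_m$. A product of indices is abbreviated $\eta_{12}=\eta_1\eta_2$, $\eta_{123}=\eta_1\eta_2\eta_3$, etc. * $\tilde k_{1,T}$ ($k=2$, $t_1=t_2=t$,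 kernel $\tilde k_1$), $J_m=\eta_1$ for $m\le 8$, $J_9=1$: $(0,\eta_1,-\eta_1;\,-\eta_{12},0,-1)$, $(0,1,0;\,-\eta_{12},0,\eta_1(1-\eta_2))$, $(0,\eta_1,-1;\,-\eta_{12},0,-\eta_{12})$, $(0,\eta_{12},-\eta_{12};\,-\eta_1,0,-1)$, $(0,\eta_{12},\eta_1(1-\eta_2);\,-1,0,0)$, $(0,\eta_{12},-1;\,-\eta_1,0,-\eta_1)$, $(0,0,0;\,-\eta_{12},\eta_1(1-\eta_2),-1)$, $(0,0,-1;\,-\eta_{12},\eta_1(1-\eta_2),-\eta_1)$, $(0,0,\eta_1;\,-\eta_2,1-\eta_2,0)$. * $\tilde k_{1,F}$ ($k=3$, $t_1,t_2$ with exactly one common face $abc$). With $J=\eta_1^2\eta_2$, and mirror images: $(0,\eta_1,1-\eta_1;\,-\eta_{123},0,\eta_{12}(1-\eta_3))$, $(0,\eta_{12},\eta_1(1-\eta_2);\,-\eta_{123},0,1-\eta_{123})$, $(0,\eta_{12},1-\eta_{12};\,-\eta_{123},0,\eta_1(1-\eta_{23}))$, $(0,\eta_{123},\eta_{12}(1-\eta_3);\,-\eta_1,0,1-\eta_1)$,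 $(0,\eta_{123},\eta_1(1-\eta_{23});\,-\eta_{12},0,1-\eta_{12})$, $(0,\eta_{123},1-\eta_{123};\,-\eta_{12},0,\eta_1(1-\eta_2))$, $(0,0,1;\,-\eta_{123},\eta_{12}(1-\eta_3),\eta_1(1-\eta_2))$. Without mirror images: $(-\eta_{123},\eta_{12}(1-\eta_3),1-\eta_{12};\,0,0,\eta_1)$ with $J=\eta_1^2\eta_2$, $(0,0,\eta_3;\,-\eta_{12},\eta_1(1-\eta_2),1-\eta_1)$ with $J=\eta_1$, $(-\eta_{12},\eta_1(1-\eta_2),1-\eta_1;\,0,0,\eta_{13})$ with $J=\eta_1^2$. * $\tilde k_{1,E}$ ($k=4$, exactly one common edge $ab$), and mirror images: $(0,\eta_1,1-\eta_1;\,-\eta_{234},\eta_{23}(1-\eta_4),\eta_2(1-\eta_3))$ with $J=\eta_2^2\eta_3$, $(0,\eta_{34},\eta_3(1-\eta_4);\,-\eta_{12},\eta_1(1-\eta_2),1-\eta_1)$ with $J=\eta_1\eta_3$. * $\tilde k_{1,V}$ ($k=5$, exactly one common vertex $a$), and mirror image: $(1,\eta_{12},\eta_1(1-\eta_2);\,\eta_3,\eta_{345},\eta_{34}(1-\eta_5))$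 with $J=\eta_1\eta_3^2\eta_4$. * $\tilde k_{1,D}$ ($k=6$, positive distance): with $x=\chi_{t_1}(\eta_1,\eta_{123},\eta_{12}(1-\eta_3))$ and $y=\chi_{t_2}(\eta_4,\eta_{456},\eta_{45}(1-\eta_6))$, $\tilde k_{1,D}=\beta_{pq}\,|x-y|^{-3-2s}\,|\det M_{t_1}|\,|\det M_{t_2}|\;\eta_1^2\eta_2\eta_4^2\eta_5$, where $\beta_{pq}=-\varphi_p(x)\varphi_q(y)$ if $t_1\subset\operatorname{supp}\varphi_p$, $t_2\subset\operatorname{supp}\varphi_q$; $\beta_{pq}=-\varphi_q(x)\varphi_p(y)$ if $t_2\subset\operatorname{supp}\varphi_p$, $t_1\subset\operatorname{supp}\varphi_q$; and $\beta_{pq}=[\varphi_p(x)-\varphi_p(y)][\varphi_q(x)-\varphi_q(y)]$ otherwise. * $\tilde k_{2,F}$ ($k=2$, $\tau$ the face $abc$ of $t$, kernel $\tilde k_2$), $J_m=\eta_1$ for $m\le8$, $J_9=1$: $(0,\eta_1,1-\eta_1;\,-\eta_{12},0)$, $(0,\eta_{12},\eta_1(1-\eta_2);\,-1,0)$, $(0,\eta_{12},1-\eta_{12};\,-\eta_1,0)$,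 $(0,0,1;\,-\eta_{12},\eta_1(1-\eta_2))$, $(-\eta_{12},\eta_1(1-\eta_2),1-\eta_1;\,0,0)$, $(-\eta_1,0,1-\eta_1;\,0,\eta_{12})$, $(-\eta_{12},0,\eta_1(1-\eta_2);\,0,1)$, $(-\eta_{12},0,1-\eta_{12};\,0,\eta_1)$, $(0,0,\eta_2;\,-\eta_1,1-\eta_1)$. * $\tilde k_{2,E}$ ($k=3$, $t,\tau$ with exactly one common edge $ab$): $(0,\eta_1,1-\eta_1;\,-\eta_{23},\eta_2(1-\eta_3))$, $(0,\eta_{23},\eta_2(1-\eta_3);\,-\eta_1,1-\eta_1)$, $(-\eta_{23},\eta_2(1-\eta_3),1-\eta_2;\,0,\eta_1)$, each with $J=\eta_2$, and $(-\eta_{123},\eta_{12}(1-\eta_3),\eta_1(1-\eta_2);\,0,1)$ with $J=\eta_1^2\eta_2$. * $\tilde k_{2,V}$ ($k=4$, exactly one common vertex $a$): $(1,\eta_{12},\eta_1(1-\eta_2);\,\eta_3,\eta_{34})$ with $J=\eta_1\eta_3$, $(\eta_2,\eta_{234},\eta_{23}(1-\eta_4);\,1,\eta_1)$ with $J=\eta_2^2\eta_3$.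 * $\tilde k_{2,D}$ ($k=5$, positive distance): $(\eta_1,\eta_{123},\eta_{12}(1-\eta_3);\,\eta_4,\eta_{45})$ with $J=\eta_1^2\eta_2\eta_4$. **Claim.** For $\rho>\frac12$ let $\mathcal E_\rho\subset\mathbb C$ be the closed ellipse with foci $0,1$ whose semi-axes have the sum $\rho$, and $\mathcal E_\rho^{(i)}=[0,1]^{i-1}\times\mathcal E_\rho\times[0,1]^{k-i}\subset\mathbb C^k$. In each case there are $\rho>\frac12$ and $C$, not depending on the mesh (in particular not on $h$), such that for all nodes $p,q$ and all $t_1,t_2,t\in\mathcal T$, $\tau\in\mathcal P$ in the relative position of that case the integrand $\tilde k_\star$ extends from $[0,1]^k$ to a function that is (jointly) analytic in a neighbourhood of $\bigcup_{i=1}^k\mathcal E_\rho^{(i)}$ and satisfies $$\sup_{\eta\in\mathcal E_\rho^{(i)}}|\tilde k_\star(\eta)|\le C\,h^{3-2s},\qquad i=1,\dots,k .$$ Here * for $\tilde k_{1,T},\tilde k_{1,F},\tilde k_{2,F}$ the number $\rho$ depends only on $\theta$, and $C$ only on $\theta,c_1,c_2,s$; * for $\tilde k_{1,E},\tilde k_{2,E}$,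 if the two elements are $c_A$-separated with $c_A>0$, $\rho$ depends only on $\theta,c_A$, and $C$ only on $\theta,c_A,c_1,c_2,s$; * for $\tilde k_{1,V},\tilde k_{2,V}$, if the two elements are $c_A$-separated with $c_A>0$, $\rho$ depends only on $\theta,c_A,c_1,c_2$, and $C$ only on these and $s$; * for $\tilde k_{1,D},\tilde k_{2,D}$, if the distance of the two elements is at least $\delta h$ with $\delta>0$, $\rho$ depends only on $\theta,\delta,c_1,c_2$, and $C$ only on these and $s$. -/

import Mathlib

open Set

noncomputable section

namespace FracDuffy

/-- Physical space with the Euclidean norm. -/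
abbrev E3 := EuclideanSpace ℝ (Fin 3)

/-! ### Tetrahedra and panels -/

/-- A nondegenerate tetrahedron with an ordering `a, b, c, d = v 0, v 1, v 2, v 3` of its vertices. -/
structure Tet where
  v : Fin 4 → E3
  indep : AffineIndependent ℝ v

/-- A nondegenerate panel (triangle) with an ordering `a, b, c = v 0, v 1, v 2` of its vertices. -/
structure Panel where
  v : Fin 3 → E3
  indep : AffineIndependent ℝ v

/-- The component of `w` orthogonal to `u`. -/
def perp (u w : E3) : E3 := w - (inner ℝ u w / inner ℝ u u) • u

/-- The dihedral angle at the edge `[p, q]` between the half planes through `r` and through `s`. -/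
def dihedral (p q r s : E3) : ℝ :=
  InnerProductGeometry.angle (perp (q - p) (r - p)) (perp (q - p) (s - p))

namespace Tet

variable (K : Tet)

def vertexSet : Set E3 := Set.range K.v

/-- The closed tetrahedron. -/
def body : Set E3 := convexHull ℝ K.vertexSet

/-- The diameter `h_t`. -/
def diam : ℝ := Metric.diam K.body

/-- All interior angles: the angles of the four faces and the six dihedral angles. -/
def interiorAngles : Set ℝ :=
  {α | (∃ i j k : Fin 4, i ≠ j ∧ i ≠ k ∧ j ≠ k ∧
          α = EuclideanGeometry.angle (K.v j) (K.v i) (K.v k)) ∨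
       (∃ i j k l : Fin 4, i ≠ j ∧ i ≠ k ∧ i ≠ l ∧ j ≠ k ∧ j ≠ l ∧ k ≠ l ∧
          α = dihedral (K.v i) (K.v j) (K.v k) (K.v l))}

/-- The columns `b - a`, `c - b`, `d - b` of `M_t`. -/
def edge : Fin 3 → E3 := ![K.v 1 - K.v 0, K.v 2 - K.v 1, K.v 3 - K.v 1]

/-- The matrix `M_t`. -/
def M : Matrix (Fin 3) (Fin 3) ℝ := Matrix.of fun r l => K.edge l r

/-- The affine map `χ_t(x) = M_t x + a_t`, on all of `ℝ³`; it maps the reference tetrahedron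
`{0 ≤ x₁ ≤ 1, 0 ≤ x₂ ≤ x₁, 0 ≤ x₃ ≤ x₁ - x₂}` onto `t`. -/
def chi (x : Fin 3 → ℝ) : E3 := ∑ l, x l • K.edge l + K.v 0

/-- The vertices as an affine basis of space; its coordinates are the barycentric coordinates. -/
def basis : AffineBasis (Fin 4) ℝ E3 where
  toFun := K.v
  ind' := K.indep
  tot' := by
    rw [K.indep.affineSpan_eq_top_iff_card_eq_finrank_add_one]
    simp

open Classical in
/-- The nodal basis function of the node `p` on the element `K` (value `1` at `p`, value `0` at all
other vertices), as an affine function extended to all of space; it is zero if `p ∉ K.vertexSet`,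
that is, if the element is not contained in the support of the basis function. -/
def hat (p x : E3) : ℝ := ∑ l, if K.v l = p then K.basis.coord l x else 0

end Tet

namespace Panel

variable (P : Panel)

def vertexSet : Set E3 := Set.range P.v

/-- The closed panel. -/
def body : Set E3 := convexHull ℝ P.vertexSet

/-- The columns `b - a`, `c - b` of `M_τ`. -/
def edge : Fin 2 → E3 := ![P.v 1 - P.v 0, P.v 2 - P.v 1]

/-- The affine map `χ_τ(y) = M_τ y + a_τ`. -/
def chi (y : Fin 2 → ℝ) : E3 := ∑ l, y l • P.edge l + P.v 0

/-- The surface element `|(b - a) × (c - b)|`. -/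
def area : ℝ := ‖(WithLp.toLp 2 (crossProduct (P.edge 0).ofLp (P.edge 1).ofLp) : E3)‖

/-- `n` is one of the two unit normal vectors of the panel. -/
def IsUnitNormal (n : E3) : Prop := ‖n‖ = 1 ∧ ∀ l, inner ℝ (P.edge l) n = 0

end Panel

/-! ### Meshes -/

/-- A regular (face-to-face) mesh: finitely many tetrahedra, given by their sets of vertices, any two
of which are disjoint or meet exactly in a common vertex, edge or face (or are identical). -/
structure Mesh where
  tets : Finset (Finset E3)
  isTet : ∀ t ∈ tets, ∃ K : Tet, K.vertexSet = (t : Set E3)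
  conforming : ∀ t₁ ∈ tets, ∀ t₂ ∈ tets,
    convexHull ℝ (t₁ : Set E3) ∩ convexHull ℝ (t₂ : Set E3)
      = convexHull ℝ ((t₁ : Set E3) ∩ (t₂ : Set E3))

namespace Mesh

variable (T : Mesh)

/-- `K` is an element of the mesh, with some ordering of its vertices. -/
def HasTet (K : Tet) : Prop := ∃ t ∈ T.tets, K.vertexSet = (t : Set E3)

/-- `P` is a face of an element of the mesh, with some ordering of its vertices. -/
def HasPanel (P : Panel) : Prop := ∃ t ∈ T.tets, P.vertexSet ⊆ (t : Set E3)

/-- The nodes of the mesh. -/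
def nodes : Set E3 := {p | ∃ t ∈ T.tets, p ∈ t}

/-- All interior angles of all elements are larger than `θ`. -/
def ShapeRegular (θ : ℝ) : Prop := ∀ K, T.HasTet K → ∀ α ∈ K.interiorAngles, θ < α

/-- Quasi-uniformity of the diameters of the elements. -/
def QuasiUniform (c₁ c₂ : ℝ) : Prop :=
  ∀ K₁ K₂, T.HasTet K₁ → T.HasTet K₂ → c₁ * K₁.diam ≤ K₂.diam ∧ K₂.diam ≤ c₂ * K₁.diam

/-- The mesh size `h`: the mean of the diameters of the elements. -/
def h : ℝ := (∑ t ∈ T.tets, Metric.diam (convexHull ℝ (t : Set E3))) / T.tets.card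

end Mesh

/-! ### Relative position of two elements -/

/-- `|x - y| ≥ c_A (|x - p| + |p - y|)` for all `x ∈ A`, `y ∈ B`, with a point `p` of the common
vertex, edge or face `A ∩ B`. -/
def Separated (cA : ℝ) (A B : Set E3) : Prop :=
  ∀ x ∈ A, ∀ y ∈ B, ∃ p ∈ A ∩ B, cA * (‖x - p‖ + ‖p - y‖) ≤ ‖x - y‖

/-- The distance `inf {|x - y| : x ∈ A, y ∈ B}` of two sets. -/
def setDist (A B : Set E3) : ℝ := sInf (Set.image2 (fun x y => ‖x - y‖) A B)

/-- Two tetrahedra with exactly one common face `abc`. -/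
def TetTetFace (K₁ K₂ : Tet) : Prop :=
  K₁.v 0 = K₂.v 0 ∧ K₁.v 1 = K₂.v 1 ∧ K₁.v 2 = K₂.v 2 ∧
    K₁.vertexSet ∩ K₂.vertexSet = {K₁.v 0, K₁.v 1, K₁.v 2}

/-- Two tetrahedra with exactly one common edge `ab`. -/
def TetTetEdge (K₁ K₂ : Tet) : Prop :=
  K₁.v 0 = K₂.v 0 ∧ K₁.v 1 = K₂.v 1 ∧ K₁.vertexSet ∩ K₂.vertexSet = {K₁.v 0, K₁.v 1}

/-- Two tetrahedra with exactly one common vertex `a`. -/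
def TetTetVertex (K₁ K₂ : Tet) : Prop :=
  K₁.v 0 = K₂.v 0 ∧ K₁.vertexSet ∩ K₂.vertexSet = {K₁.v 0}

/-- The panel is the face `abc` of the tetrahedron. -/
def TetPanelFace (K : Tet) (P : Panel) : Prop :=
  K.v 0 = P.v 0 ∧ K.v 1 = P.v 1 ∧ K.v 2 = P.v 2

/-- A tetrahedron and a panel with exactly one common edge `ab`. -/
def TetPanelEdge (K : Tet) (P : Panel) : Prop :=
  K.v 0 = P.v 0 ∧ K.v 1 = P.v 1 ∧ K.vertexSet ∩ P.vertexSet = {K.v 0, K.v 1}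

/-- A tetrahedron and a panel with exactly one common vertex `a`. -/
def TetPanelVertex (K : Tet) (P : Panel) : Prop :=
  K.v 0 = P.v 0 ∧ K.vertexSet ∩ P.vertexSet = {K.v 0}

/-! ### The transformed kernels -/

/-- The kernel `k̃₁`: the function
`[φ_p(x) - φ_p(y)] [φ_q(x) - φ_q(y)] / |x - y|^(3 + 2s)` at `x = χ_{t₁}(x̃)`, `y = χ_{t₂}(ỹ)`, times
`|det M_{t₁}| |det M_{t₂}|`, for `z = (x̃, ỹ)`; the basis functions are the affine functions of the
two elements, so that the formula also makes sense outside of the reference tetrahedron. -/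
def ker₁ (K₁ K₂ : Tet) (s : ℝ) (p q : E3) (z : (Fin 3 → ℝ) × (Fin 3 → ℝ)) : ℝ :=
  (K₁.hat p (K₁.chi z.1) - K₂.hat p (K₂.chi z.2)) *
    (K₁.hat q (K₁.chi z.1) - K₂.hat q (K₂.chi z.2)) /
    ‖K₁.chi z.1 - K₂.chi z.2‖ ^ (3 + 2 * s) * |K₁.M.det| * |K₂.M.det|

/-- The kernel `k̃₂`: the function `φ_p(x) φ_q(x) (y - x)ᵀ n / |x - y|^(3 + 2s)` at `x = χ_t(x̃)`,
`y = χ_τ(ỹ)`, times `|det M_t| |(b_τ - a_τ) × (c_τ - b_τ)|`, for `z = (x̃, ỹ)`. -/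
def ker₂ (K : Tet) (P : Panel) (n : E3) (s : ℝ) (p q : E3)
    (z : (Fin 3 → ℝ) × (Fin 2 → ℝ)) : ℝ :=
  K.hat p (K.chi z.1) * K.hat q (K.chi z.1) *
    (inner ℝ (P.chi z.2 - K.chi z.1) n / ‖K.chi z.1 - P.chi z.2‖ ^ (3 + 2 * s)) *
    |K.M.det| * P.area

/-! ### Two tetrahedra: the regularized integrands

The variables `η₁, η₂, …` are `η 0, η 1, …`. -/

/-- Identical tetrahedra: the Duffy transformations of the nine sub-domains. -/
def duffyT (η : Fin 2 → ℝ) : Fin 9 → (Fin 3 → ℝ) × (Fin 3 → ℝ) :=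
  ![(![0, η 0, -η 0], ![-(η 0 * η 1), 0, -1]),
    (![0, 1, 0], ![-(η 0 * η 1), 0, η 0 * (1 - η 1)]),
    (![0, η 0, -1], ![-(η 0 * η 1), 0, -(η 0 * η 1)]),
    (![0, η 0 * η 1, -(η 0 * η 1)], ![-η 0, 0, -1]),
    (![0, η 0 * η 1, η 0 * (1 - η 1)], ![-1, 0, 0]),
    (![0, η 0 * η 1, -1], ![-η 0, 0, -η 0]),
    (![0, 0, 0], ![-(η 0 * η 1), η 0 * (1 - η 1), -1]),
    (![0, 0, -1], ![-(η 0 * η 1), η 0 * (1 - η 1), -η 0]),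
    (![0, 0, η 0], ![-η 1, 1 - η 1, 0])]

/-- Identical tetrahedra: the Jacobi determinants. -/
def jacT (η : Fin 2 → ℝ) : Fin 9 → ℝ :=
  ![η 0, η 0, η 0, η 0, η 0, η 0, η 0, η 0, 1]

/-- Identical tetrahedra: the integrand `k̃_{1,T}`. -/
def k1T (K : Tet) (s : ℝ) (p q : E3) (η : Fin 2 → ℝ) : ℝ :=
  ∑ m, ker₁ K K s p q (duffyT η m) * jacT η m

/-- Common face: the first seven Duffy transformations. -/
def duffyF₀ (η : Fin 3 → ℝ) : Fin 7 → (Fin 3 → ℝ) × (Fin 3 → ℝ) :=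
  ![(![0, η 0, 1 - η 0], ![-(η 0 * η 1 * η 2), 0, η 0 * η 1 * (1 - η 2)]),
    (![0, η 0 * η 1, η 0 * (1 - η 1)], ![-(η 0 * η 1 * η 2), 0, 1 - η 0 * η 1 * η 2]),
    (![0, η 0 * η 1, 1 - η 0 * η 1], ![-(η 0 * η 1 * η 2), 0, η 0 * (1 - η 1 * η 2)]),
    (![0, η 0 * η 1 * η 2, η 0 * η 1 * (1 - η 2)], ![-η 0, 0, 1 - η 0]),
    (![0, η 0 * η 1 * η 2, η 0 * (1 - η 1 * η 2)], ![-(η 0 * η 1), 0, 1 - η 0 * η 1]),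
    (![0, η 0 * η 1 * η 2, 1 - η 0 * η 1 * η 2], ![-(η 0 * η 1), 0, η 0 * (1 - η 1)]),
    (![0, 0, 1], ![-(η 0 * η 1 * η 2), η 0 * η 1 * (1 - η 2), η 0 * (1 - η 1)])]

/-- Common face: the last three Duffy transformations. -/
def duffyF₁ (η : Fin 3 → ℝ) : Fin 3 → (Fin 3 → ℝ) × (Fin 3 → ℝ) :=
  ![(![-(η 0 * η 1 * η 2), η 0 * η 1 * (1 - η 2), 1 - η 0 * η 1], ![0, 0, η 0]),
    (![0, 0, η 2], ![-(η 0 * η 1), η 0 * (1 - η 1), 1 - η 0]),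
    (![-(η 0 * η 1), η 0 * (1 - η 1), 1 - η 0], ![0, 0, η 0 * η 2])]

/-- Common face: the Jacobi determinants of the last three transformations. -/
def jacF₁ (η : Fin 3 → ℝ) : Fin 3 → ℝ := ![η 0 ^ 2 * η 1, η 0, η 0 ^ 2]

/-- Common face: the integrand `k̃_{1,F}`. The seventeen sub-domains are the first seven, their seven
mirror images under `(x̃, ỹ) ↦ (ỹ, x̃)`, and the last three. -/
def k1F (K₁ K₂ : Tet) (s : ℝ) (p q : E3) (η : Fin 3 → ℝ) : ℝ :=
  ∑ m, ker₁ K₁ K₂ s p q (duffyF₀ η m) * (η 0 ^ 2 * η 1) +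
    ∑ m, ker₁ K₁ K₂ s p q (duffyF₀ η m).swap * (η 0 ^ 2 * η 1) +
    ∑ m, ker₁ K₁ K₂ s p q (duffyF₁ η m) * jacF₁ η m

/-- Common edge: the first two Duffy transformations. -/
def duffyE (η : Fin 4 → ℝ) : Fin 2 → (Fin 3 → ℝ) × (Fin 3 → ℝ) :=
  ![(![0, η 0, 1 - η 0],
      ![-(η 1 * η 2 * η 3), η 1 * η 2 * (1 - η 3), η 1 * (1 - η 2)]),
    (![0, η 2 * η 3, η 2 * (1 - η 3)], ![-(η 0 * η 1), η 0 * (1 - η 1), 1 - η 0])]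

/-- Common edge: the Jacobi determinants. -/
def jacE (η : Fin 4 → ℝ) : Fin 2 → ℝ := ![η 1 ^ 2 * η 2, η 0 * η 2]

/-- Common edge: the integrand `k̃_{1,E}`; the four sub-domains are the two above and their mirror
images. -/
def k1E (K₁ K₂ : Tet) (s : ℝ) (p q : E3) (η : Fin 4 → ℝ) : ℝ :=
  ∑ m, ker₁ K₁ K₂ s p q (duffyE η m) * jacE η m +
    ∑ m, ker₁ K₁ K₂ s p q (duffyE η m).swap * jacE η m

/-- Common vertex: the first Duffy transformation. -/
def duffyV (η : Fin 5 → ℝ) : (Fin 3 → ℝ) × (Fin 3 → ℝ) :=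
  (![1, η 0 * η 1, η 0 * (1 - η 1)], ![η 2, η 2 * η 3 * η 4, η 2 * η 3 * (1 - η 4)])

/-- Common vertex: the integrand `k̃_{1,V}`. -/
def k1V (K₁ K₂ : Tet) (s : ℝ) (p q : E3) (η : Fin 5 → ℝ) : ℝ :=
  (ker₁ K₁ K₂ s p q (duffyV η) + ker₁ K₁ K₂ s p q (duffyV η).swap) * (η 0 * η 2 ^ 2 * η 3)

/-- The parametrization of the reference tetrahedron by the unit cube, with Jacobi determinant
`u² v`. -/
def refTet (u v w : ℝ) : Fin 3 → ℝ := ![u, u * v * w, u * v * (1 - w)]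

open Classical in
/-- The numerator `β_{pq}` for two tetrahedra with positive distance. The first two cases are those
in which the two elements belong to the supports of different basis functions, the last one is the
product of the differences, unchanged. -/
def beta (K₁ K₂ : Tet) (p q x y : E3) : ℝ :=
  if p ∈ K₁.vertexSet ∧ q ∈ K₂.vertexSet then -(K₁.hat p x * K₂.hat q y)
  else if p ∈ K₂.vertexSet ∧ q ∈ K₁.vertexSet then -(K₁.hat q x * K₂.hat p y)
  else (K₁.hat p x - K₂.hat p y) * (K₁.hat q x - K₂.hat q y)

/-- Positive distance: the integrand `k̃_{1,D}`. -/
def k1D (K₁ K₂ : Tet) (s : ℝ) (p q : E3) (η : Fin 6 → ℝ) : ℝ :=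
  let x := K₁.chi (refTet (η 0) (η 1) (η 2))
  let y := K₂.chi (refTet (η 3) (η 4) (η 5))
  beta K₁ K₂ p q x y / ‖y - x‖ ^ (3 + 2 * s) * |K₁.M.det| * |K₂.M.det| *
    (η 0 ^ 2 * η 1 * η 3 ^ 2 * η 4)

/-! ### Tetrahedron and panel: the regularized integrands -/

/-- The panel is a face: the Duffy transformations of the nine sub-domains. -/
def duffyPF (η : Fin 2 → ℝ) : Fin 9 → (Fin 3 → ℝ) × (Fin 2 → ℝ) :=
  ![(![0, η 0, 1 - η 0], ![-(η 0 * η 1), 0]),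
    (![0, η 0 * η 1, η 0 * (1 - η 1)], ![-1, 0]),
    (![0, η 0 * η 1, 1 - η 0 * η 1], ![-η 0, 0]),
    (![0, 0, 1], ![-(η 0 * η 1), η 0 * (1 - η 1)]),
    (![-(η 0 * η 1), η 0 * (1 - η 1), 1 - η 0], ![0, 0]),
    (![-η 0, 0, 1 - η 0], ![0, η 0 * η 1]),
    (![-(η 0 * η 1), 0, η 0 * (1 - η 1)], ![0, 1]),
    (![-(η 0 * η 1), 0, 1 - η 0 * η 1], ![0, η 0]),
    (![0, 0, η 1], ![-η 0, 1 - η 0])]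

/-- The panel is a face: the Jacobi determinants. -/
def jacPF (η : Fin 2 → ℝ) : Fin 9 → ℝ :=
  ![η 0, η 0, η 0, η 0, η 0, η 0, η 0, η 0, 1]

/-- The panel is a face: the integrand `k̃_{2,F}`. -/
def k2F (K : Tet) (P : Panel) (n : E3) (s : ℝ) (p q : E3) (η : Fin 2 → ℝ) : ℝ :=
  ∑ m, ker₂ K P n s p q (duffyPF η m) * jacPF η m

/-- Common edge: the Duffy transformations of the four sub-domains. -/
def duffyPE (η : Fin 3 → ℝ) : Fin 4 → (Fin 3 → ℝ) × (Fin 2 → ℝ) :=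
  ![(![0, η 0, 1 - η 0], ![-(η 1 * η 2), η 1 * (1 - η 2)]),
    (![0, η 1 * η 2, η 1 * (1 - η 2)], ![-η 0, 1 - η 0]),
    (![-(η 1 * η 2), η 1 * (1 - η 2), 1 - η 1], ![0, η 0]),
    (![-(η 0 * η 1 * η 2), η 0 * η 1 * (1 - η 2), η 0 * (1 - η 1)], ![0, 1])]

/-- Common edge: the Jacobi determinants. -/
def jacPE (η : Fin 3 → ℝ) : Fin 4 → ℝ := ![η 1, η 1, η 1, η 0 ^ 2 * η 1]

/-- Common edge: the integrand `k̃_{2,E}`. -/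
def k2E (K : Tet) (P : Panel) (n : E3) (s : ℝ) (p q : E3) (η : Fin 3 → ℝ) : ℝ :=
  ∑ m, ker₂ K P n s p q (duffyPE η m) * jacPE η m

/-- Common vertex: the Duffy transformations of the two sub-domains. -/
def duffyPV (η : Fin 4 → ℝ) : Fin 2 → (Fin 3 → ℝ) × (Fin 2 → ℝ) :=
  ![(![1, η 0 * η 1, η 0 * (1 - η 1)], ![η 2, η 2 * η 3]),
    (![η 1, η 1 * η 2 * η 3, η 1 * η 2 * (1 - η 3)], ![1, η 0])]

/-- Common vertex: the Jacobi determinants. -/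
def jacPV (η : Fin 4 → ℝ) : Fin 2 → ℝ := ![η 0 * η 2, η 1 ^ 2 * η 2]

/-- Common vertex: the integrand `k̃_{2,V}`. -/
def k2V (K : Tet) (P : Panel) (n : E3) (s : ℝ) (p q : E3) (η : Fin 4 → ℝ) : ℝ :=
  ∑ m, ker₂ K P n s p q (duffyPV η m) * jacPV η m

/-- Positive distance: the integrand `k̃_{2,D}`. -/
def k2D (K : Tet) (P : Panel) (n : E3) (s : ℝ) (p q : E3) (η : Fin 5 → ℝ) : ℝ :=
  ker₂ K P n s p q (refTet (η 0) (η 1) (η 2), ![η 3, η 3 * η 4]) * (η 0 ^ 2 * η 1 * η 3)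

/-! ### Analytic extension -/

/-- The closed ellipse with foci `0` and `1` whose semi-axes `a ≥ b` have the sum `ρ`: since
`a² - b² = 1/4`, its major axis is `2 a = ρ + 1 / (4 ρ)`. -/
def ellipse (ρ : ℝ) : Set ℂ := {z | ‖z‖ + ‖z - 1‖ ≤ ρ + 1 / (4 * ρ)}

/-- The set `[0,1]^(i-1) × ellipse × [0,1]^(k-i)`, as a subset of `ℂ^k`. -/
def ellipseBox {k : ℕ} (ρ : ℝ) (i : Fin k) : Set (Fin k → ℂ) :=
  {z | z i ∈ ellipse ρ ∧ ∀ j, j ≠ i → ∃ t ∈ Icc (0 : ℝ) 1, z j = (t : ℂ)}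

/-- The function `f` on `[0,1]^k` extends to a function `F` that is analytic (jointly in all variables)
in a neighbourhood of the union of the sets `ellipseBox ρ i`, and `|F| ≤ B` on each of these sets. -/
def ExtendsBounded {k : ℕ} (f : (Fin k → ℝ) → ℝ) (ρ B : ℝ) : Prop :=
  ∃ F : (Fin k → ℂ) → ℂ,
    AnalyticOnNhd ℂ F (⋃ i, ellipseBox ρ i) ∧
    (∀ η : Fin k → ℝ, (∀ j, η j ∈ Icc (0 : ℝ) 1) → F (fun j => (η j : ℂ)) = (f η : ℂ)) ∧
    ∀ i, ∀ z ∈ ellipseBox ρ i, ‖F z‖ ≤ B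

end FracDuffy

end

/-! Every integrand is a finite sum of terms in which a volume factor multiplies two linear forms in
barycentric coordinates, a negative power of the distance `|x - y|` (for the panel kernel also the
component of `x - y` along `n`) and a Jacobian, all evaluated at points depending polynomially on
`η`. Only the power of the distance can fail to be analytic. The theorem therefore rests on one
fact: at the transformed points the distance is at least `c₀ H` for all real `η` in the cube, where
`H` is the element size. No cancellation in the numerator is needed.

Given this bound, the squared distance extends to a polynomial in complex `η`. An `η` close to the
cube moves each component of the difference by at most a small multiple of `H`. The complex squared
distance then stays within half of a real value `d ^ 2` with `d ≥ c₀ H`, hence in the open right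
half plane, where the principal power is analytic and bounded by a multiple of `d ^ (-(3 + 2s))`.
How close `η` must be depends only on `c₀`, on the bound `C₀ H` for the edges and on the finitely
many polynomials. It depends neither on `s` nor on the individual elements, so no compactness over
shapes is used. As `ρ` decreases to `1/2` the ellipse shrinks to `[0,1]`, so every `ρ > 1/2` near
`1/2` works, and finitely many such conditions can be met at once. The volume factors contribute `H
^ 6`, or `H ^ 5` together with one power of the distance; either way the scaling is `H ^ (3 - 2s)`.
This is `eventually_extendsBounded`.

The lower bound is geometric. Angles bounded below make all heights of a tetrahedron comparable to
its diameter, so `M_t` is bounded below (`exists_coerciveWith`). For identical elements this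
suffices. Across a common face the fourth vertices lie on opposite sides, which controls the normal
components first and the tangential ones afterwards (`face_lower`). For a common edge or vertex,
separation bounds the distance of each point to the common set (`edge_lower`, `vertex_lower`). A
panel is completed to a mesh tetrahedron of which it is a face, so its points are tetrahedron points
with vanishing third coordinate. Elementary inequalities on the cube show that the transformations
keep these lower bounds away from zero. -/

noncomputable section

namespace FracDuffy
open Filter Topology

/-! ### Real functions with an entire extension -/

/-- `f` is the restriction to `ℝ^k` of an entire function on `ℂ^k`. -/
def EntireExt {k : ℕ} (f : (Fin k → ℝ) → ℝ) : Prop :=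
  ∃ F : (Fin k → ℂ) → ℂ, (∀ z, AnalyticAt ℂ F z) ∧
    ∀ η : Fin k → ℝ, F (fun j => (η j : ℂ)) = (f η : ℂ)

namespace EntireExt

variable {k : ℕ} {f g : (Fin k → ℝ) → ℝ}

theorem const (c : ℝ) : EntireExt (fun _ : Fin k → ℝ => c) :=
  ⟨fun _ => c, fun _ => analyticAt_const, fun _ => rfl⟩

theorem coord (j : Fin k) : EntireExt (fun η : Fin k → ℝ => η j) :=
  ⟨fun z => z j, fun z => (ContinuousLinearMap.proj (R := ℂ) (φ := fun _ : Fin k => ℂ) j).analyticAt z,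
    fun _ => rfl⟩

theorem sub (hf : EntireExt f) (hg : EntireExt g) : EntireExt (fun η => f η - g η) := by
  obtain ⟨F, hF, hF'⟩ := hf
  obtain ⟨G, hG, hG'⟩ := hg
  exact ⟨fun z => F z - G z, fun z => (hF z).sub (hG z), fun η => by simp [hF', hG']⟩

theorem mul (hf : EntireExt f) (hg : EntireExt g) : EntireExt (fun η => f η * g η) := by
  obtain ⟨F, hF, hF'⟩ := hf
  obtain ⟨G, hG, hG'⟩ := hg
  exact ⟨fun z => F z * G z, fun z => (hF z).mul (hG z), fun η => by simp [hF', hG']⟩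

theorem neg (hf : EntireExt f) : EntireExt (fun η => -f η) := by
  obtain ⟨F, hF, hF'⟩ := hf
  exact ⟨fun z => -F z, fun z => (hF z).neg, fun η => by simp [hF']⟩

theorem pow (hf : EntireExt f) (n : ℕ) : EntireExt (fun η => f η ^ n) := by
  obtain ⟨F, hF, hF'⟩ := hf
  exact ⟨fun z => F z ^ n, fun z => (hF z).pow n, fun η => by simp [hF']⟩

end EntireExt

/-! ### The ellipse is close to the unit interval -/

/-- If the real part leaves `[0,1]`, one focal distance already exceeds `1`, and the other is at
most `ε ^ 2 / 4`. Otherwise an imaginary part above `ε` lengthens each focal distance by at least `ε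
^ 2 / 4` beyond its horizontal part, and the sum becomes too large. -/
theorem exists_mem_Icc_norm_sub_le {ε : ℝ} (hε : 0 < ε) (hε' : ε ≤ 1) {z : ℂ}
    (hz : ‖z‖ + ‖z - 1‖ ≤ 1 + ε ^ 2 / 4) : ∃ t ∈ Icc (0 : ℝ) 1, ‖z - (t : ℂ)‖ ≤ ε := by
  have h0 : |z.re| ≤ ‖z‖ := Complex.abs_re_le_norm z
  have h1 : |(z - 1).re| ≤ ‖z - 1‖ := Complex.abs_re_le_norm (z - 1)
  simp only [Complex.sub_re, Complex.one_re] at h1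
  have hεε : ε ^ 2 / 4 ≤ ε := by nlinarith
  by_cases hx0 : z.re < 0
  · refine ⟨0, by simp, ?_⟩
    have := neg_abs_le (z.re - 1)
    simp only [Complex.ofReal_zero, sub_zero]
    linarith
  by_cases hx1 : 1 < z.re
  · refine ⟨1, by simp, ?_⟩
    have := le_abs_self z.re
    simp only [Complex.ofReal_one]
    linarith
  push Not at hx0 hx1
  refine ⟨z.re, ⟨hx0, hx1⟩, ?_⟩
  have him : ‖z - (z.re : ℂ)‖ = |z.im| := by
    have : z - (z.re : ℂ) = z.im * Complex.I := by
      apply Complex.ext <;> simp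
    rw [this, norm_mul, Complex.norm_I, mul_one, Complex.norm_real, Real.norm_eq_abs]
  rw [him]
  by_contra hlt
  push Not at hlt
  have hsq : ε ^ 2 < z.im ^ 2 := by
    rw [← sq_abs z.im]
    exact pow_lt_pow_left₀ hlt hε.le two_ne_zero
  have key : ∀ x : ℝ, 0 ≤ x → x ≤ 1 → ∀ w : ℂ, w.re ^ 2 = x ^ 2 → w.im = z.im →
      x + ε ^ 2 / 4 ≤ ‖w‖ := by
    intro x hx hx' w hw hwi
    refine (pow_le_pow_iff_left₀ (by positivity) (norm_nonneg w) two_ne_zero).1 ?_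
    rw [← Complex.normSq_eq_norm_sq, Complex.normSq_apply, hwi]
    nlinarith [sq_nonneg ε, mul_nonneg hx (sq_nonneg ε), mul_nonneg (sub_nonneg.2 hx') (sq_nonneg ε),
      mul_nonneg (sub_nonneg.2 (pow_le_one₀ hε.le hε' : ε ^ 2 ≤ 1)) (sq_nonneg ε)]
  have e1 := key z.re hx0 hx1 z rfl rfl
  have e2 := key (1 - z.re) (by linarith) (by linarith) (z - 1) (by simp; ring) (by simp)
  nlinarith [pow_pos hε 2]

/-- At `ρ = 1/2` the major axis `ρ + 1 / (4ρ)` equals the focal distance `1`, so the ellipse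
degenerates to the segment; continuity in `ρ` does the rest. -/
theorem eventually_ellipse_near {ε : ℝ} (hε : 0 < ε) :
    ∀ᶠ ρ in 𝓝[>] (1 / 2 : ℝ), ∀ z ∈ ellipse ρ, ∃ t ∈ Icc (0 : ℝ) 1, ‖z - (t : ℂ)‖ ≤ ε := by
  have hm : 0 < min ε 1 := lt_min hε one_pos
  have hc : ContinuousAt (fun ρ : ℝ => ρ + 1 / (4 * ρ)) (1 / 2) := by
    refine continuousAt_id.add (continuousAt_const.div (continuousAt_const.mul continuousAt_id) ?_)
    norm_num
  have hlt : (1 / 2 : ℝ) + 1 / (4 * (1 / 2)) < 1 + min ε 1 ^ 2 / 4 := by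
    have : 0 < min ε 1 ^ 2 := pow_pos hm 2
    norm_num
    linarith
  filter_upwards [nhdsWithin_le_nhds (hc.eventually_lt continuousAt_const hlt)] with ρ hρ z hz
  obtain ⟨t, ht, h⟩ := exists_mem_Icc_norm_sub_le hm (min_le_right _ _)
    (le_trans (show ‖z‖ + ‖z - 1‖ ≤ _ from hz) hρ.le)
  exact ⟨t, ht, h.trans (min_le_left _ _)⟩

theorem eventually_ellipseBox_near (k : ℕ) {ε : ℝ} (hε : 0 < ε) :
    ∀ᶠ ρ in 𝓝[>] (1 / 2 : ℝ), ∀ i : Fin k, ∀ z ∈ ellipseBox ρ i,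
      ∃ η : Fin k → ℝ, (∀ j, η j ∈ Icc (0 : ℝ) 1) ∧ ∀ j, ‖z j - (η j : ℂ)‖ ≤ ε := by
  filter_upwards [eventually_ellipse_near hε] with ρ hρ i z hz
  have : ∀ j, ∃ t ∈ Icc (0 : ℝ) 1, ‖z j - (t : ℂ)‖ ≤ ε := by
    intro j
    by_cases hj : j = i
    · subst hj; exact hρ _ hz.1
    · obtain ⟨t, ht, h⟩ := hz.2 j hj
      exact ⟨t, ht, by rw [h, sub_self, norm_zero]; exact hε.le⟩
  choose η h1 h2 using this
  exact ⟨η, h1, h2⟩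

theorem isCompact_realCube (k : ℕ) :
    IsCompact ((fun η : Fin k → ℝ => fun j => (η j : ℂ)) '' Set.pi univ fun _ => Icc (0 : ℝ) 1) := by
  refine (isCompact_univ_pi fun _ => isCompact_Icc).image ?_
  fun_prop

/-- Continuity is uniform at the points of the compact real cube, even against arguments outside the
cube. One real `η` serves all functions `F l` simultaneously. -/
theorem eventually_ellipseBox_image_near {k : ℕ} {ι : Type*} [Fintype ι]
    {F : ι → (Fin k → ℂ) → ℂ} (hF : ∀ l, Continuous (F l)) {ε : ℝ} (hε : 0 < ε) :
    ∀ᶠ ρ in 𝓝[>] (1 / 2 : ℝ), ∀ i : Fin k, ∀ z ∈ ellipseBox ρ i,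
      ∃ η : Fin k → ℝ, (∀ j, η j ∈ Icc (0 : ℝ) 1) ∧
        ∀ l, ‖F l z - F l (fun j => (η j : ℂ))‖ ≤ ε := by
  have hc : Continuous fun z l => F l z := continuous_pi hF
  have hu := (isCompact_realCube k).uniformContinuousAt_of_continuousAt _
    (fun a _ => hc.continuousAt) (Metric.dist_mem_uniformity hε)
  obtain ⟨δ, hδ, h⟩ := Metric.mem_uniformity_dist.1 hu
  filter_upwards [eventually_ellipseBox_near k (half_pos hδ)] with ρ hρ i z hz
  obtain ⟨η, hη, hzη⟩ := hρ i z hz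
  refine ⟨η, hη, fun l => ?_⟩
  have hd : dist (fun j => (η j : ℂ)) z < δ := by
    refine lt_of_le_of_lt ((dist_pi_le_iff (half_pos hδ).le).2 fun j => ?_) (half_lt_self hδ)
    rw [dist_comm, dist_eq_norm]
    exact hzη j
  have := h hd ⟨η, fun j _ => hη j, rfl⟩
  rw [Set.mem_ofPred_eq] at this
  rw [← dist_eq_norm, dist_comm]
  exact (dist_le_pi_dist _ _ l).trans this.le

theorem exists_bound_realCube {k : ℕ} {ι : Type*} [Fintype ι]
    {F : ι → (Fin k → ℂ) → ℂ} (hF : ∀ l, Continuous (F l)) :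
    ∃ R : ℝ, 0 ≤ R ∧ ∀ η : Fin k → ℝ, (∀ j, η j ∈ Icc (0 : ℝ) 1) → ∀ l,
      ‖F l (fun j => (η j : ℂ))‖ ≤ R := by
  have hc : Continuous fun z l => F l z := continuous_pi hF
  obtain ⟨R, hR⟩ := (isCompact_realCube k).exists_bound_of_continuousOn hc.continuousOn
  refine ⟨max R 0, le_max_right _ _, fun η hη l => ?_⟩
  exact (norm_le_pi_norm (fun l => F l _) l).trans
    ((hR _ ⟨η, fun j _ => hη j, rfl⟩).trans (le_max_left _ _))

/-! ### Operations on `ExtendsBounded` -/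

namespace ExtendsBounded

variable {k : ℕ} {f g : (Fin k → ℝ) → ℝ} {ρ A B : ℝ}

theorem mono (hf : ExtendsBounded f ρ A) (h : A ≤ B) : ExtendsBounded f ρ B := by
  obtain ⟨F, h1, h2, h3⟩ := hf
  exact ⟨F, h1, h2, fun i z hz => (h3 i z hz).trans h⟩

theorem congr (hf : ExtendsBounded f ρ A) (h : ∀ η, f η = g η) : ExtendsBounded g ρ A :=
  (funext h : f = g) ▸ hf

theorem add (hf : ExtendsBounded f ρ A) (hg : ExtendsBounded g ρ B) :
    ExtendsBounded (fun η => f η + g η) ρ (A + B) := by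
  obtain ⟨F, h1, h2, h3⟩ := hf
  obtain ⟨G, g1, g2, g3⟩ := hg
  refine ⟨fun z => F z + G z, fun z hz => (h1 z hz).add (g1 z hz), fun η hη => ?_, fun i z hz => ?_⟩
  · simp [h2 η hη, g2 η hη]
  · exact (norm_add_le _ _).trans (add_le_add (h3 i z hz) (g3 i z hz))

theorem sum {ι : Type*} (S : Finset ι) {f : ι → (Fin k → ℝ) → ℝ} {A : ι → ℝ}
    (h : ∀ m ∈ S, ExtendsBounded (f m) ρ (A m)) :
    ExtendsBounded (fun η => ∑ m ∈ S, f m η) ρ (∑ m ∈ S, A m) := by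
  classical
  induction S using Finset.induction_on with
  | empty => exact ⟨fun _ => 0, fun z _ => analyticAt_const, fun η _ => by simp, fun i z _ => by simp⟩
  | insert a S ha ih =>
    have := (h a (Finset.mem_insert_self a S)).add (ih fun m hm => h m (Finset.mem_insert_of_mem hm))
    simpa only [Finset.sum_insert ha] using this

end ExtendsBounded


/-! ### Complexified coordinates -/

/-- The barycentric coordinates of the point with reference coordinates `x`. -/
def weights {R : Type*} [Ring R] (x : Fin 3 → R) : Fin 4 → R :=
  ![1 - x 0, x 0 - x 1 - x 2, x 1, x 2]

/-- The complexification of `χ_{K₁}(x) - χ_{K₂}(y)`. -/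
def chiDiff (K₁ K₂ : Tet) (x y : Fin 3 → ℂ) (r : Fin 3) : ℂ :=
  (∑ l, x l * (K₁.edge l r : ℂ) + (K₁.v 0 r : ℂ)) - (∑ l, y l * (K₂.edge l r : ℂ) + (K₂.v 0 r : ℂ))

theorem chiDiff_ofReal (K₁ K₂ : Tet) (x y : Fin 3 → ℝ) (r : Fin 3) :
    chiDiff K₁ K₂ (fun l => (x l : ℂ)) (fun l => (y l : ℂ)) r
      = (((K₁.chi x - K₂.chi y) r : ℝ) : ℂ) := by
  simp [chiDiff, Tet.chi]

theorem norm_chiDiff_sub_le {K₁ K₂ : Tet} {A ε : ℝ}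
    (h₁ : ∀ l, ‖K₁.edge l‖ ≤ A) (h₂ : ∀ l, ‖K₂.edge l‖ ≤ A) {x y x' y' : Fin 3 → ℂ}
    (hx : ∀ l, ‖x l - x' l‖ ≤ ε) (hy : ∀ l, ‖y l - y' l‖ ≤ ε) (r : Fin 3) :
    ‖chiDiff K₁ K₂ x y r - chiDiff K₁ K₂ x' y' r‖ ≤ 6 * (ε * A) := by
  have hε : 0 ≤ ε := (norm_nonneg _).trans (hx 0)
  have e : chiDiff K₁ K₂ x y r - chiDiff K₁ K₂ x' y' r
      = ∑ l, (x l - x' l) * (K₁.edge l r : ℂ) - ∑ l, (y l - y' l) * (K₂.edge l r : ℂ) := by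
    simp only [chiDiff, sub_mul, Finset.sum_sub_distrib]
    ring
  have key : ∀ (K : Tet), (∀ l, ‖K.edge l‖ ≤ A) → ∀ u u' : Fin 3 → ℂ, (∀ l, ‖u l - u' l‖ ≤ ε) →
      ‖∑ l, (u l - u' l) * (K.edge l r : ℂ)‖ ≤ 3 * (ε * A) := by
    intro K hK u u' hu
    refine (norm_sum_le _ _).trans ?_
    refine (Finset.sum_le_card_nsmul _ _ (ε * A) fun l _ => ?_).trans (by simp)
    rw [norm_mul, Complex.norm_real]
    exact mul_le_mul (hu l) ((PiLp.norm_apply_le _ _).trans (hK l)) (norm_nonneg _) hε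
  rw [e]
  refine (norm_sub_le _ _).trans ?_
  linarith [key K₁ h₁ x x' hx, key K₂ h₂ y y' hy]

/-- Factoring each difference of squares gives at most `‖d‖/16 * (‖d‖/16 + 2‖d‖)` per component;
three of these make `99/256 < 1/2` times `‖d‖ ^ 2`. -/
theorem norm_sum_sq_sub_le {d : E3} {w : Fin 3 → ℂ} (h : ∀ r, ‖w r - (d r : ℂ)‖ ≤ ‖d‖ / 16) :
    ‖∑ r, w r ^ 2 - (‖d‖ : ℂ) ^ 2‖ ≤ ‖d‖ ^ 2 / 2 := by
  have e : ∑ r, w r ^ 2 - (‖d‖ : ℂ) ^ 2 = ∑ r, (w r - d r) * ((w r - d r) + 2 * d r) := by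
    have : (‖d‖ : ℂ) ^ 2 = ∑ r, (d r : ℂ) ^ 2 := by
      rw [← Complex.ofReal_pow, EuclideanSpace.norm_sq_eq]
      simp
    rw [this, ← Finset.sum_sub_distrib]
    exact Finset.sum_congr rfl fun r _ => by ring
  rw [e]
  refine (norm_sum_le _ _).trans ?_
  refine (Finset.sum_le_card_nsmul _ _ (‖d‖ / 16 * (‖d‖ / 16 + 2 * ‖d‖)) fun r _ => ?_).trans ?_
  · rw [norm_mul]
    refine mul_le_mul (h r) ((norm_add_le _ _).trans (add_le_add (h r) ?_)) (norm_nonneg _)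
      (by positivity)
    rw [norm_mul, Complex.norm_real]
    simpa using PiLp.norm_apply_le d r
  · simp only [Finset.card_univ, Fintype.card_fin, nsmul_eq_mul, Nat.cast_ofNat]
    nlinarith [sq_nonneg ‖d‖]

/-- Near the cube, the complexified squared distance stays close to a real squared distance that is
bounded from below. -/
theorem eventually_ellipseBox_chiDiff {k : ℕ} {X Y : Fin 3 → (Fin k → ℂ) → ℂ} {J : (Fin k → ℂ) → ℂ}
    (hX : ∀ l, Continuous (X l)) (hY : ∀ l, Continuous (Y l)) (hJ : Continuous J)
    {D : (Fin k → ℝ) → (Fin 3 → ℝ) × (Fin 3 → ℝ)}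
    (hXD : ∀ l (η : Fin k → ℝ), X l (fun j => (η j : ℂ)) = ((D η).1 l : ℂ))
    (hYD : ∀ l (η : Fin k → ℝ), Y l (fun j => (η j : ℂ)) = ((D η).2 l : ℂ))
    {c₀ C₀ : ℝ} (hc₀ : 0 < c₀) (hC₀ : 0 ≤ C₀) :
    ∃ R : ℝ, 0 ≤ R ∧ ∀ᶠ ρ in 𝓝[>] (1 / 2 : ℝ), ∀ i : Fin k, ∀ z ∈ ellipseBox ρ i,
      (∀ l, ‖X l z‖ ≤ R) ∧ (∀ l, ‖Y l z‖ ≤ R) ∧ ‖J z‖ ≤ R ∧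
      ∀ (K₁ K₂ : Tet) (H : ℝ), 0 < H → (∀ l, ‖K₁.edge l‖ ≤ C₀ * H) → (∀ l, ‖K₂.edge l‖ ≤ C₀ * H) →
        (∀ η : Fin k → ℝ, (∀ j, η j ∈ Icc (0 : ℝ) 1) →
          c₀ * H ≤ ‖K₁.chi (D η).1 - K₂.chi (D η).2‖) →
        ∃ d : ℝ, c₀ * H ≤ d ∧
          ‖∑ r, chiDiff K₁ K₂ (fun l => X l z) (fun l => Y l z) r ^ 2 - (d : ℂ) ^ 2‖ ≤ d ^ 2 / 2 ∧
          ∀ r, ‖chiDiff K₁ K₂ (fun l => X l z) (fun l => Y l z) r‖ ≤ 2 * d := by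
  set F : Fin 3 ⊕ Fin 3 ⊕ Unit → (Fin k → ℂ) → ℂ := Sum.elim X (Sum.elim Y fun _ => J) with hFdef
  have hF : ∀ l, Continuous (F l) := by
    rintro (l | l | l)
    exacts [hX l, hY l, hJ]
  obtain ⟨R, hR, hRb⟩ := exists_bound_realCube hF
  -- Here `96 = 6 * 16`: perturbing the six coordinates by `ε` moves a component of the difference
  -- by at most `6 ε C₀ H`, which must not exceed a sixteenth of the distance `≥ c₀ H`. The summand
  -- `1` in `C₀ + 1` allows `C₀ = 0`, and `ε ≤ 1` turns the bound `R` on the cube into `R + 1`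
  -- nearby.
  have hε : 0 < min 1 (c₀ / (96 * (C₀ + 1))) := lt_min one_pos (by positivity)
  set ε := min 1 (c₀ / (96 * (C₀ + 1))) with hεdef
  refine ⟨R + 1, by linarith, ?_⟩
  filter_upwards [eventually_ellipseBox_image_near hF hε] with ρ hρ i z hz
  obtain ⟨η, hη, hn⟩ := hρ i z hz
  have hb : ∀ l, ‖F l z‖ ≤ R + 1 := by
    intro l
    have h1 := hn l
    have h2 := hRb η hη l
    have h3 : ε ≤ 1 := min_le_left _ _
    have h4 := norm_le_norm_add_norm_sub (F l fun j => (η j : ℂ)) (F l z)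
    rw [norm_sub_rev] at h4
    linarith
  refine ⟨fun l => hb (.inl l), fun l => hb (.inr (.inl l)), hb (.inr (.inr ())), ?_⟩
  intro K₁ K₂ H hH h₁ h₂ hlow
  set d := K₁.chi (D η).1 - K₂.chi (D η).2 with hd
  have hdl := hlow η hη
  have hεC : 6 * (ε * (C₀ * H)) ≤ ‖d‖ / 16 := by
    have h1 : ε * (96 * (C₀ + 1)) ≤ c₀ := by
      rw [← le_div_iff₀ (by positivity)]
      exact min_le_right _ _
    have h2 : ε * (96 * (C₀ + 1)) * H ≤ c₀ * H := mul_le_mul_of_nonneg_right h1 hH.le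
    nlinarith [mul_pos hε hH]
  have hw : ∀ r, ‖chiDiff K₁ K₂ (fun l => X l z) (fun l => Y l z) r - (d r : ℂ)‖ ≤ ‖d‖ / 16 := by
    intro r
    rw [hd, ← chiDiff_ofReal]
    refine (norm_chiDiff_sub_le (ε := ε) h₁ h₂ ?_ ?_ r).trans hεC
    · intro l; rw [← hXD]; exact hn (.inl l)
    · intro l; rw [← hYD]; exact hn (.inr (.inl l))
  refine ⟨‖d‖, hdl, norm_sum_sq_sub_le hw, fun r => ?_⟩
  have h1 := hw r
  have h2 : ‖(d r : ℂ)‖ ≤ ‖d‖ := by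
    rw [Complex.norm_real]; exact PiLp.norm_apply_le d r
  have h4 := norm_le_norm_add_norm_sub (d r : ℂ) (chiDiff K₁ K₂ (fun l => X l z) (fun l => Y l z) r)
  rw [norm_sub_rev] at h4
  linarith [norm_nonneg d]

/-! ### The complexified kernel -/

theorem mem_slitPlane_of_norm_sub_sq_le {g : ℂ} {d : ℝ} (hd : 0 < d)
    (h : ‖g - (d : ℂ) ^ 2‖ ≤ d ^ 2 / 2) : g ∈ Complex.slitPlane := by
  left
  have h1 := (Complex.abs_re_le_norm _).trans h
  rw [← Complex.ofReal_pow, Complex.sub_re, Complex.ofReal_re] at h1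
  have := neg_abs_le (g.re - d ^ 2)
  nlinarith [pow_pos hd 2]

/-- The hypothesis keeps `‖g‖ ≥ d ^ 2 / 2`, and a real exponent makes the modulus of the power a
power of the modulus. -/
theorem norm_cpow_le_of_norm_sub_sq_le {g : ℂ} {d a : ℝ} (hd : 0 < d) (ha : 0 ≤ a)
    (h : ‖g - (d : ℂ) ^ 2‖ ≤ d ^ 2 / 2) :
    ‖g ^ ((-(a / 2) : ℝ) : ℂ)‖ ≤ 2 ^ (a / 2) * d ^ (-a) := by
  have h1 : d ^ 2 / 2 ≤ ‖g‖ := by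
    have h4 := norm_le_norm_add_norm_sub g ((d : ℂ) ^ 2)
    rw [norm_pow, Complex.norm_real, Real.norm_eq_abs, sq_abs] at h4
    linarith
  rw [Complex.norm_cpow_real]
  refine (Real.rpow_le_rpow_of_nonpos (by positivity) h1 (by linarith)).trans (le_of_eq ?_)
  rw [Real.div_rpow (by positivity) (by norm_num), Real.rpow_neg (by norm_num : (0 : ℝ) ≤ 2),
    ← Real.rpow_natCast d 2, ← Real.rpow_mul hd.le, div_inv_eq_mul, mul_comm]
  congr 2
  push_cast
  ring

theorem ofReal_cpow_norm_sq {d : E3} {a : ℝ} :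
    (∑ r, ((d r : ℝ) : ℂ) ^ 2) ^ ((-(a / 2) : ℝ) : ℂ) = (((‖d‖ ^ a)⁻¹ : ℝ) : ℂ) := by
  have : ∑ r, ((d r : ℝ) : ℂ) ^ 2 = ((‖d‖ ^ 2 : ℝ) : ℂ) := by
    rw [EuclideanSpace.norm_sq_eq]
    simp
  rw [this, ← Complex.ofReal_cpow (by positivity)]
  congr 1
  rw [← Real.rpow_natCast, ← Real.rpow_mul (norm_nonneg d), ← Real.rpow_neg (norm_nonneg d)]
  congr 1
  push_cast
  ring

/-- A linear form in the barycentric coordinates of two points. -/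
def bary {R : Type*} [Ring R] (α β : Fin 4 → R) (x y : Fin 3 → R) : R :=
  ∑ l, α l * weights x l + ∑ l, β l * weights y l

theorem norm_bary_le {α β : Fin 4 → ℝ} (hα : ∀ l, |α l| ≤ 1) (hβ : ∀ l, |β l| ≤ 1)
    {x y : Fin 3 → ℂ} {R : ℝ} (hx : ∀ l, ‖x l‖ ≤ R) (hy : ∀ l, ‖y l‖ ≤ R) :
    ‖bary (fun l => (α l : ℂ)) (fun l => (β l : ℂ)) x y‖ ≤ 8 * (1 + 3 * R) := by
  have hR : 0 ≤ R := (norm_nonneg _).trans (hx 0)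
  have key : ∀ u : Fin 3 → ℂ, (∀ l, ‖u l‖ ≤ R) → ∀ l, ‖weights u l‖ ≤ 1 + 3 * R := by
    intro u hu l
    have h0 := hu 0
    have h1 := hu 1
    have h2 := hu 2
    fin_cases l
    · have := norm_sub_le (1 : ℂ) (u 0)
      simp only [weights, norm_one] at this ⊢
      simp
      linarith
    · have := norm_sub_le (u 0 - u 1) (u 2)
      have := norm_sub_le (u 0) (u 1)
      simp [weights]
      linarith
    · simp [weights]; linarith
    · simp [weights]; linarith
  have key2 : ∀ (γ : Fin 4 → ℝ), (∀ l, |γ l| ≤ 1) → ∀ u : Fin 3 → ℂ, (∀ l, ‖u l‖ ≤ R) →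
      ‖∑ l, (γ l : ℂ) * weights u l‖ ≤ 4 * (1 + 3 * R) := by
    intro γ hγ u hu
    refine (norm_sum_le _ _).trans ?_
    refine (Finset.sum_le_card_nsmul _ _ (1 + 3 * R) fun l _ => ?_).trans (by simp; linarith)
    rw [norm_mul, Complex.norm_real]
    have := mul_le_mul (hγ l) (key u hu l) (norm_nonneg _) zero_le_one
    rwa [one_mul] at this
  refine (norm_add_le _ _).trans ?_
  linarith [key2 α hα x hx, key2 β hβ y hy]

theorem bary_ofReal (α β : Fin 4 → ℝ) (x y : Fin 3 → ℝ) :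
    bary (fun l => (α l : ℂ)) (fun l => (β l : ℂ)) (fun l => (x l : ℂ)) (fun l => (y l : ℂ))
      = ((bary α β x y : ℝ) : ℂ) := by
  simp [bary, weights, Fin.sum_univ_four]

theorem analyticAt_bary {k : ℕ} {X Y : Fin 3 → (Fin k → ℂ) → ℂ} {z : Fin k → ℂ}
    (hX : ∀ l, AnalyticAt ℂ (X l) z) (hY : ∀ l, AnalyticAt ℂ (Y l) z) (α β : Fin 4 → ℂ) :
    AnalyticAt ℂ (fun z => bary α β (fun l => X l z) (fun l => Y l z)) z := by
  simp only [bary, weights, Fin.sum_univ_four, Matrix.cons_val_zero, Matrix.cons_val_one,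
    Matrix.cons_val]
  have := hX 0
  have := hX 1
  have := hX 2
  have := hY 0
  have := hY 1
  have := hY 2
  fun_prop

theorem analyticAt_chiDiff {k : ℕ} {X Y : Fin 3 → (Fin k → ℂ) → ℂ} {z : Fin k → ℂ}
    (hX : ∀ l, AnalyticAt ℂ (X l) z) (hY : ∀ l, AnalyticAt ℂ (Y l) z) (K₁ K₂ : Tet) (r : Fin 3) :
    AnalyticAt ℂ (fun z => chiDiff K₁ K₂ (fun l => X l z) (fun l => Y l z) r) z := by
  simp only [chiDiff, Fin.sum_univ_three]
  have := hX 0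
  have := hX 1
  have := hX 2
  have := hY 0
  have := hY 1
  have := hY 2
  fun_prop


theorem pow_mul_mul_rpow_neg {c H a : ℝ} (hc : 0 < c) (hH : 0 < H) (n : ℕ) :
    H ^ n * (c * H) ^ (-a) = c ^ (-a) * H ^ (n - a) := by
  rw [Real.mul_rpow hc.le hH.le, sub_eq_add_neg, Real.rpow_add hH, Real.rpow_natCast]
  ring

/-- A regularized kernel, whose distance function is bounded from below on the cube, extends
analytically, with the scaling of the bound in the element size `H`. -/
theorem eventually_extendsBounded {k : ℕ} {D : (Fin k → ℝ) → (Fin 3 → ℝ) × (Fin 3 → ℝ)}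
    {J : (Fin k → ℝ) → ℝ} (hD₁ : ∀ l, EntireExt fun η => (D η).1 l)
    (hD₂ : ∀ l, EntireExt fun η => (D η).2 l) (hJ : EntireExt J)
    {c₀ C₀ : ℝ} (hc₀ : 0 < c₀) (hC₀ : 0 ≤ C₀) :
    ∀ᶠ ρ in 𝓝[>] (1 / 2 : ℝ), ∀ s A : ℝ, 0 < s → 0 ≤ A → ∃ C : ℝ, 0 ≤ C ∧
      ∀ (K₁ K₂ : Tet) (H : ℝ), 0 < H → (∀ l, ‖K₁.edge l‖ ≤ C₀ * H) → (∀ l, ‖K₂.edge l‖ ≤ C₀ * H) →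
        (∀ η : Fin k → ℝ, (∀ j, η j ∈ Icc (0 : ℝ) 1) →
          c₀ * H ≤ ‖K₁.chi (D η).1 - K₂.chi (D η).2‖) →
        ∀ α β α' β' : Fin 4 → ℝ, (∀ l, |α l| ≤ 1) → (∀ l, |β l| ≤ 1) → (∀ l, |α' l| ≤ 1) →
          (∀ l, |β' l| ≤ 1) →
        (∀ W : ℝ, |W| ≤ A * H ^ 6 → ExtendsBounded (fun η => W *
          (bary α β (D η).1 (D η).2 * bary α' β' (D η).1 (D η).2 *
            (‖K₁.chi (D η).1 - K₂.chi (D η).2‖ ^ (3 + 2 * s))⁻¹ * J η)) ρ (C * H ^ (3 - 2 * s))) ∧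
        (∀ (W : ℝ) (n : E3), ‖n‖ = 1 → |W| ≤ A * H ^ 5 → ExtendsBounded (fun η => W *
          (bary α β (D η).1 (D η).2 * bary α' β' (D η).1 (D η).2 *
            (inner ℝ (K₁.chi (D η).1 - K₂.chi (D η).2) n *
            (‖K₁.chi (D η).1 - K₂.chi (D η).2‖ ^ (3 + 2 * s))⁻¹) * J η)) ρ
            (C * H ^ (3 - 2 * s))) := by
  choose X hXa hXD using hD₁
  choose Y hYa hYD using hD₂
  obtain ⟨Jc, hJa, hJD⟩ := hJ
  have cont : ∀ {F : (Fin k → ℂ) → ℂ}, (∀ z, AnalyticAt ℂ F z) → Continuous F := fun h =>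
    continuous_iff_continuousAt.2 fun z => (h z).continuousAt
  obtain ⟨R, hR, hev⟩ := eventually_ellipseBox_chiDiff (D := D) (fun l => cont (hXa l))
    (fun l => cont (hYa l)) (cont hJa) hXD hYD hc₀ hC₀
  filter_upwards [hev] with ρ hρ s A hs hA
  set a := 3 + 2 * s with ha
  have ha0 : 0 ≤ a := by linarith
  -- The last of the three claims pairs a component of the difference with the singular power. Both
  -- are compared with the same `d`, so one power of the distance is gained; this makes up for the
  -- volume factor `H ^ 5` of the panel kernel in place of `H ^ 6`.
  have hkey : ∀ (K₁ K₂ : Tet) (H : ℝ), 0 < H → (∀ l, ‖K₁.edge l‖ ≤ C₀ * H) →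
      (∀ l, ‖K₂.edge l‖ ≤ C₀ * H) →
      (∀ η : Fin k → ℝ, (∀ j, η j ∈ Icc (0 : ℝ) 1) →
        c₀ * H ≤ ‖K₁.chi (D η).1 - K₂.chi (D η).2‖) →
      ∀ i, ∀ z ∈ ellipseBox ρ i,
        AnalyticAt ℂ (fun z => (∑ r, chiDiff K₁ K₂ (fun l => X l z) (fun l => Y l z) r ^ 2) ^
          ((-(a / 2) : ℝ) : ℂ)) z ∧
        ‖(∑ r, chiDiff K₁ K₂ (fun l => X l z) (fun l => Y l z) r ^ 2) ^ ((-(a / 2) : ℝ) : ℂ)‖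
          ≤ 2 ^ (a / 2) * (c₀ * H) ^ (-a) ∧
        ∀ r, ‖chiDiff K₁ K₂ (fun l => X l z) (fun l => Y l z) r‖ *
          ‖(∑ r, chiDiff K₁ K₂ (fun l => X l z) (fun l => Y l z) r ^ 2) ^ ((-(a / 2) : ℝ) : ℂ)‖
          ≤ 2 * (2 ^ (a / 2) * (c₀ * H) ^ (-(a - 1))) := by
    intro K₁ K₂ H hH h₁ h₂ hlow i z hz
    obtain ⟨d, hd, hg, hr⟩ := (hρ i z hz).2.2.2 K₁ K₂ H hH h₁ h₂ hlow
    have hcH : 0 < c₀ * H := mul_pos hc₀ hH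
    have hd0 : 0 < d := hcH.trans_le hd
    have hE := norm_cpow_le_of_norm_sub_sq_le hd0 ha0 hg
    refine ⟨AnalyticAt.cpow ?_ analyticAt_const (mem_slitPlane_of_norm_sub_sq_le hd0 hg),
      hE.trans ?_, fun r => (mul_le_mul (hr r) hE (norm_nonneg _) (by positivity)).trans ?_⟩
    · exact Finset.analyticAt_fun_sum _ fun r _ =>
        (analyticAt_chiDiff (fun l => hXa l z) (fun l => hYa l z) K₁ K₂ r).pow 2
    · exact mul_le_mul_of_nonneg_left (Real.rpow_le_rpow_of_nonpos hcH hd (by linarith))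
        (by positivity)
    · have e : d * d ^ (-a) = d ^ (-(a - 1)) := by
        rw [show -(a - 1) = 1 + -a by ring, Real.rpow_add hd0, Real.rpow_one]
      rw [show 2 * d * (2 ^ (a / 2) * d ^ (-a)) = 2 * (2 ^ (a / 2) * (d * d ^ (-a))) by ring, e]
      have := Real.rpow_le_rpow_of_nonpos hcH hd (by linarith : -(a - 1) ≤ 0)
      gcongr
  set B := 8 * (1 + 3 * R) with hB
  have hB0 : 0 ≤ B := by positivity
  -- The two summands in the last factor belong to the two kernels; `6` is three components of the
  -- difference, each at most `2 d`.
  refine ⟨A * (B * B) * R * 2 ^ (a / 2) * (c₀ ^ (-a) + 6 * c₀ ^ (-(a - 1))), by positivity, ?_⟩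
  intro K₁ K₂ H hH h₁ h₂ hlow α β α' β' hα hβ hα' hβ'
  have hk := hkey K₁ K₂ H hH h₁ h₂ hlow
  have hbary : ∀ {α β : Fin 4 → ℝ}, (∀ l, |α l| ≤ 1) → (∀ l, |β l| ≤ 1) → ∀ i, ∀ z ∈ ellipseBox ρ i,
      ‖bary (fun l => (α l : ℂ)) (fun l => (β l : ℂ)) (fun l => X l z) (fun l => Y l z)‖ ≤ B :=
    fun hα hβ i z hz => norm_bary_le hα hβ (hρ i z hz).1 (hρ i z hz).2.1
  have hban : ∀ (α β : Fin 4 → ℝ) z, AnalyticAt ℂ (fun z => bary (fun l => (α l : ℂ))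
      (fun l => (β l : ℂ)) (fun l => X l z) (fun l => Y l z)) z := fun α β z =>
    analyticAt_bary (fun l => hXa l z) (fun l => hYa l z) _ _
  have hreal : ∀ (α β : Fin 4 → ℝ) (η : Fin k → ℝ), bary (fun l => (α l : ℂ)) (fun l => (β l : ℂ))
      (fun l => X l fun j => (η j : ℂ)) (fun l => Y l fun j => (η j : ℂ))
      = ((bary α β (D η).1 (D η).2 : ℝ) : ℂ) := by
    intro α β η
    simp only [hXD, hYD, bary_ofReal]
  constructor
  · intro W hW
    refine ⟨fun z => (W : ℂ) * (bary (fun l => (α l : ℂ)) (fun l => (β l : ℂ)) (fun l => X l z)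
      (fun l => Y l z) * bary (fun l => (α' l : ℂ)) (fun l => (β' l : ℂ)) (fun l => X l z)
      (fun l => Y l z) * (∑ r, chiDiff K₁ K₂ (fun l => X l z) (fun l => Y l z) r ^ 2) ^
        ((-(a / 2) : ℝ) : ℂ) * Jc z), ?_, ?_, ?_⟩
    · intro z hz
      obtain ⟨i, hz⟩ := Set.mem_iUnion.1 hz
      exact analyticAt_const.mul ((((hban α β z).mul (hban α' β' z)).mul (hk i z hz).1).mul (hJa z))
    · intro η hη
      simp only [hreal, hJD]
      simp only [hXD, hYD, chiDiff_ofReal, ofReal_cpow_norm_sq]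
      push_cast
      ring
    · intro i z hz
      simp only [norm_mul, Complex.norm_real, Real.norm_eq_abs]
      calc _ ≤ A * H ^ 6 * (B * B * (2 ^ (a / 2) * (c₀ * H) ^ (-a)) * R) := by
            refine mul_le_mul hW ?_ (by positivity) (by positivity)
            refine mul_le_mul ?_ (hρ i z hz).2.2.1 (by positivity) (by positivity)
            refine mul_le_mul ?_ (hk i z hz).2.1 (by positivity) (by positivity)
            exact mul_le_mul (hbary hα hβ i z hz) (hbary hα' hβ' i z hz) (norm_nonneg _) hB0
        _ = A * (B * B) * R * 2 ^ (a / 2) * (H ^ 6 * (c₀ * H) ^ (-a)) := by ring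
        _ ≤ _ := by
            rw [pow_mul_mul_rpow_neg hc₀ hH,
              show ((6 : ℕ) : ℝ) - a = 3 - 2 * s by rw [ha]; push_cast; ring]
            have : 0 ≤ A * (B * B) * R * 2 ^ (a / 2) * (6 * c₀ ^ (-(a - 1))) * H ^ (3 - 2 * s) := by
              positivity
            linarith
  · intro W n hn hW
    refine ⟨fun z => (W : ℂ) * (bary (fun l => (α l : ℂ)) (fun l => (β l : ℂ)) (fun l => X l z)
      (fun l => Y l z) * bary (fun l => (α' l : ℂ)) (fun l => (β' l : ℂ)) (fun l => X l z)
      (fun l => Y l z) * ((∑ r, chiDiff K₁ K₂ (fun l => X l z) (fun l => Y l z) r * (n r : ℂ)) *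
        (∑ r, chiDiff K₁ K₂ (fun l => X l z) (fun l => Y l z) r ^ 2) ^
        ((-(a / 2) : ℝ) : ℂ)) * Jc z), ?_, ?_, ?_⟩
    · intro z hz
      obtain ⟨i, hz⟩ := Set.mem_iUnion.1 hz
      refine analyticAt_const.mul ((((hban α β z).mul (hban α' β' z)).mul
        (AnalyticAt.mul ?_ (hk i z hz).1)).mul (hJa z))
      exact Finset.analyticAt_fun_sum _ fun r _ =>
        (analyticAt_chiDiff (fun l => hXa l z) (fun l => hYa l z) K₁ K₂ r).mul analyticAt_const
    · intro η hη
      have hin : ∀ d : E3, ∑ r, ((d r : ℝ) : ℂ) * (n r : ℂ) = ((inner ℝ d n : ℝ) : ℂ) := by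
        intro d
        rw [PiLp.inner_apply]
        push_cast
        exact Finset.sum_congr rfl fun r _ => by simp [mul_comm]
      simp only [hreal, hJD]
      simp only [hXD, hYD, chiDiff_ofReal, ofReal_cpow_norm_sq, hin]
      push_cast
      ring
    · intro i z hz
      have hT : ‖∑ r, chiDiff K₁ K₂ (fun l => X l z) (fun l => Y l z) r * (n r : ℂ)‖ *
          ‖(∑ r, chiDiff K₁ K₂ (fun l => X l z) (fun l => Y l z) r ^ 2) ^ ((-(a / 2) : ℝ) : ℂ)‖
          ≤ 6 * (2 ^ (a / 2) * (c₀ * H) ^ (-(a - 1))) := by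
        refine (mul_le_mul_of_nonneg_right (norm_sum_le _ _) (norm_nonneg _)).trans ?_
        rw [Finset.sum_mul]
        refine (Finset.sum_le_card_nsmul _ _ _ fun r _ => ?_).trans_eq
          (b := 3 • (2 * (2 ^ (a / 2) * (c₀ * H) ^ (-(a - 1))))) (by simp; ring)
        refine le_trans ?_ ((hk i z hz).2.2 r)
        refine mul_le_mul_of_nonneg_right ?_ (norm_nonneg _)
        rw [norm_mul, Complex.norm_real]
        exact mul_le_of_le_one_right (norm_nonneg _) (hn ▸ PiLp.norm_apply_le n r)
      rw [norm_mul, norm_mul, norm_mul, norm_mul, norm_mul]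
      rw [Complex.norm_real, Real.norm_eq_abs]
      calc _ ≤ A * H ^ 5 * (B * B * (6 * (2 ^ (a / 2) * (c₀ * H) ^ (-(a - 1)))) * R) := by
            refine mul_le_mul hW ?_ (by positivity) (by positivity)
            refine mul_le_mul ?_ (hρ i z hz).2.2.1 (by positivity) (by positivity)
            refine mul_le_mul ?_ hT (by positivity) (by positivity)
            exact mul_le_mul (hbary hα hβ i z hz) (hbary hα' hβ' i z hz) (norm_nonneg _) hB0
        _ = A * (B * B) * R * 2 ^ (a / 2) * (6 * (H ^ 5 * (c₀ * H) ^ (-(a - 1)))) := by ring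
        _ ≤ _ := by
            rw [pow_mul_mul_rpow_neg hc₀ hH,
              show ((5 : ℕ) : ℝ) - (a - 1) = 3 - 2 * s by rw [ha]; push_cast; ring]
            have : 0 ≤ A * (B * B) * R * 2 ^ (a / 2) * c₀ ^ (-a) * H ^ (3 - 2 * s) := by positivity
            linarith


/-! ### Barycentric coordinates and volume factors -/

namespace Tet

theorem chi_eq_sum_weights (K : Tet) (x : Fin 3 → ℝ) : K.chi x = ∑ l, weights x l • K.v l := by
  simp only [chi, edge, weights, Fin.sum_univ_three, Fin.sum_univ_four, Matrix.cons_val_zero,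
    Matrix.cons_val_one, Matrix.cons_val]
  module

theorem sum_weights (x : Fin 3 → ℝ) : ∑ l, weights x l = 1 := by
  simp [weights, Fin.sum_univ_four]
  ring

theorem coord_chi (K : Tet) (x : Fin 3 → ℝ) (l : Fin 4) :
    K.basis.coord l (K.chi x) = weights x l := by
  have := K.basis.coord_apply_combination_of_mem (Finset.mem_univ l) (sum_weights x)
  rw [Finset.affineCombination_eq_linear_combination _ _ _ (sum_weights x)] at this
  rw [chi_eq_sum_weights]
  exact this

open Classical in
/-- The vertex indicator of the node `p`. -/
def ind (K : Tet) (p : E3) (l : Fin 4) : ℝ := if K.v l = p then 1 else 0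

theorem abs_ind_le (K : Tet) (p : E3) (l : Fin 4) : |K.ind p l| ≤ 1 := by
  unfold ind
  split_ifs <;> simp

theorem hat_chi (K : Tet) (p : E3) (x : Fin 3 → ℝ) :
    K.hat p (K.chi x) = ∑ l, K.ind p l * weights x l := by
  refine Finset.sum_congr rfl fun l _ => ?_
  rw [coord_chi, ind]
  split_ifs <;> simp

/-- The Leibniz expansion has `3! = 6` terms, each a product of three entries of modulus at most
`A`. -/
theorem abs_det_le (K : Tet) {A : ℝ} (h : ∀ l, ‖K.edge l‖ ≤ A) : |K.M.det| ≤ 6 * A ^ 3 := by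
  have := Matrix.det_le (A := K.M) (abv := IsAbsoluteValue.toAbsoluteValue (abs : ℝ → ℝ)) (x := A)
    fun i j => (PiLp.norm_apply_le (K.edge j) i).trans (h j)
  simpa [Nat.factorial] using this

end Tet

theorem Panel.area_le (P : Panel) {A : ℝ} (h : ∀ l, ‖P.edge l‖ ≤ A) : P.area ≤ A ^ 2 := by
  unfold area
  rw [InnerProductGeometry.norm_ofLp_crossProduct]
  have hA : 0 ≤ A := (norm_nonneg _).trans (h 0)
  calc _ ≤ ‖P.edge 0‖ * ‖P.edge 1‖ * 1 :=
        mul_le_mul_of_nonneg_left (Real.sin_le_one _) (by positivity)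
    _ ≤ A * A * 1 := by
        have := mul_le_mul (h 0) (h 1) (norm_nonneg _) hA
        linarith
    _ = A ^ 2 := by ring

theorem abs_det_mul_det_le {K₁ K₂ : Tet} {C₀ H : ℝ} (h₁ : ∀ l, ‖K₁.edge l‖ ≤ C₀ * H)
    (h₂ : ∀ l, ‖K₂.edge l‖ ≤ C₀ * H) :
    |(|K₁.M.det| * |K₂.M.det|)| ≤ 36 * C₀ ^ 6 * H ^ 6 := by
  rw [abs_mul, abs_abs, abs_abs]
  calc _ ≤ 6 * (C₀ * H) ^ 3 * (6 * (C₀ * H) ^ 3) :=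
        mul_le_mul (K₁.abs_det_le h₁) (K₂.abs_det_le h₂) (abs_nonneg _)
          ((abs_nonneg _).trans (K₁.abs_det_le h₁))
    _ = _ := by ring

/-! ### The two kernels as products of barycentric forms -/

section

variable {k : ℕ} {J : (Fin k → ℝ) → ℝ} {c₀ C₀ : ℝ}

/-- The difference of a basis function at `x` and `y` is a single barycentric form: its coefficients
are the vertex indicator on `K₁` and minus the vertex indicator on `K₂`. -/
theorem eventually_extendsBounded_ker₁ {D : (Fin k → ℝ) → (Fin 3 → ℝ) × (Fin 3 → ℝ)}
    (hD₁ : ∀ l, EntireExt fun η => (D η).1 l)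
    (hD₂ : ∀ l, EntireExt fun η => (D η).2 l) (hJ : EntireExt J) (hc₀ : 0 < c₀) (hC₀ : 0 ≤ C₀) :
    ∀ᶠ ρ in 𝓝[>] (1 / 2 : ℝ), ∀ s : ℝ, 0 < s → ∃ C : ℝ, 0 ≤ C ∧
      ∀ (K₁ K₂ : Tet) (p q : E3) (H : ℝ), 0 < H →
        (∀ l, ‖K₁.edge l‖ ≤ C₀ * H) → (∀ l, ‖K₂.edge l‖ ≤ C₀ * H) →
        (∀ η : Fin k → ℝ, (∀ j, η j ∈ Icc (0 : ℝ) 1) →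
          c₀ * H ≤ ‖K₁.chi (D η).1 - K₂.chi (D η).2‖) →
        ExtendsBounded (fun η => ker₁ K₁ K₂ s p q (D η) * J η) ρ (C * H ^ (3 - 2 * s)) := by
  filter_upwards [eventually_extendsBounded hD₁ hD₂ hJ hc₀ hC₀] with ρ hρ s hs
  obtain ⟨C, hC, h⟩ := hρ s (36 * C₀ ^ 6) hs (by positivity)
  refine ⟨C, hC, fun K₁ K₂ p q H hH h₁ h₂ hlow => ?_⟩
  have hneg : ∀ (K : Tet) p l, |(-K.ind p l)| ≤ 1 := fun K p l => by
    rw [abs_neg]; exact K.abs_ind_le p l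
  refine ((h K₁ K₂ H hH h₁ h₂ hlow (K₁.ind p) (fun l => -K₂.ind p l) (K₁.ind q)
    (fun l => -K₂.ind q l) (K₁.abs_ind_le p) (hneg K₂ p) (K₁.abs_ind_le q) (hneg K₂ q)).1
    (|K₁.M.det| * |K₂.M.det|) (abs_det_mul_det_le h₁ h₂)).congr fun η => ?_
  simp only [ker₁, bary, Tet.hat_chi, neg_mul, Finset.sum_neg_distrib]
  ring

-- In each case of the numerator both factors are barycentric forms. In the first two the minus sign
-- is absorbed into the coefficients of one factor, and each factor involves one element only.
open Classical in
theorem eventually_extendsBounded_beta {D : (Fin k → ℝ) → (Fin 3 → ℝ) × (Fin 3 → ℝ)}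
    (hD₁ : ∀ l, EntireExt fun η => (D η).1 l)
    (hD₂ : ∀ l, EntireExt fun η => (D η).2 l) (hJ : EntireExt J) (hc₀ : 0 < c₀) (hC₀ : 0 ≤ C₀) :
    ∀ᶠ ρ in 𝓝[>] (1 / 2 : ℝ), ∀ s : ℝ, 0 < s → ∃ C : ℝ, 0 ≤ C ∧
      ∀ (K₁ K₂ : Tet) (p q : E3) (H : ℝ), 0 < H →
        (∀ l, ‖K₁.edge l‖ ≤ C₀ * H) → (∀ l, ‖K₂.edge l‖ ≤ C₀ * H) →
        (∀ η : Fin k → ℝ, (∀ j, η j ∈ Icc (0 : ℝ) 1) →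
          c₀ * H ≤ ‖K₁.chi (D η).1 - K₂.chi (D η).2‖) →
        ExtendsBounded (fun η => beta K₁ K₂ p q (K₁.chi (D η).1) (K₂.chi (D η).2) /
          ‖K₂.chi (D η).2 - K₁.chi (D η).1‖ ^ (3 + 2 * s) * |K₁.M.det| * |K₂.M.det| * J η) ρ
          (C * H ^ (3 - 2 * s)) := by
  filter_upwards [eventually_extendsBounded hD₁ hD₂ hJ hc₀ hC₀] with ρ hρ s hs
  obtain ⟨C, hC, h⟩ := hρ s (36 * C₀ ^ 6) hs (by positivity)
  refine ⟨C, hC, fun K₁ K₂ p q H hH h₁ h₂ hlow => ?_⟩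
  have hneg : ∀ (K : Tet) p l, |(-K.ind p l)| ≤ 1 := fun K p l => by
    rw [abs_neg]; exact K.abs_ind_le p l
  have hzero : ∀ l : Fin 4, |(fun _ => (0 : ℝ)) l| ≤ 1 := fun l => by simp
  have hW := abs_det_mul_det_le h₁ h₂
  simp only [norm_sub_rev (K₂.chi _)]
  by_cases hpq : p ∈ K₁.vertexSet ∧ q ∈ K₂.vertexSet
  · refine ((h K₁ K₂ H hH h₁ h₂ hlow (fun l => -K₁.ind p l) _ _ (K₂.ind q)
      (hneg K₁ p) hzero hzero (K₂.abs_ind_le q)).1 _ hW).congr fun η => ?_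
    simp only [beta, if_pos hpq, bary, Tet.hat_chi, neg_mul, Finset.sum_neg_distrib, zero_mul,
      Finset.sum_const_zero]
    ring
  by_cases hqp : p ∈ K₂.vertexSet ∧ q ∈ K₁.vertexSet
  · refine ((h K₁ K₂ H hH h₁ h₂ hlow (fun l => -K₁.ind q l) _ _ (K₂.ind p)
      (hneg K₁ q) hzero hzero (K₂.abs_ind_le p)).1 _ hW).congr fun η => ?_
    simp only [beta, if_neg hpq, if_pos hqp, bary, Tet.hat_chi, neg_mul, Finset.sum_neg_distrib,
      zero_mul, Finset.sum_const_zero]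
    ring
  · refine ((h K₁ K₂ H hH h₁ h₂ hlow (K₁.ind p) (fun l => -K₂.ind p l) (K₁.ind q)
      (fun l => -K₂.ind q l) (K₁.abs_ind_le p) (hneg K₂ p) (K₁.abs_ind_le q) (hneg K₂ q)).1
      _ hW).congr fun η => ?_
    simp only [beta, if_neg hpq, if_neg hqp, bary, Tet.hat_chi, neg_mul, Finset.sum_neg_distrib]
    ring

namespace TetPanelFace

variable {P : Panel} {K : Tet}

theorem edge_zero (h : TetPanelFace K P) : K.edge 0 = P.edge 0 := by
  simp [Tet.edge, Panel.edge, h.1, h.2.1]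

theorem edge_one (h : TetPanelFace K P) : K.edge 1 = P.edge 1 := by
  simp [Tet.edge, Panel.edge, h.2.1, h.2.2]

theorem chi_eq (h : TetPanelFace K P) (y : Fin 2 → ℝ) : P.chi y = K.chi ![y 0, y 1, 0] := by
  simp [Tet.chi, Panel.chi, Fin.sum_univ_three, h.edge_zero, h.edge_one, h.1]

end TetPanelFace

/-- Since the panel is the face `abc` of `K'`, its points are points of `K'` with third reference
coordinate `0`, and the estimate for two tetrahedra applies. The inner product there is that of `x -
y`, so the volume factor enters with a minus sign. -/
theorem eventually_extendsBounded_ker₂ {D : (Fin k → ℝ) → (Fin 3 → ℝ) × (Fin 2 → ℝ)}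
    (hD₁ : ∀ l, EntireExt fun η => (D η).1 l)
    (hD₂ : ∀ l, EntireExt fun η => (D η).2 l) (hJ : EntireExt J) (hc₀ : 0 < c₀) (hC₀ : 0 ≤ C₀) :
    ∀ᶠ ρ in 𝓝[>] (1 / 2 : ℝ), ∀ s : ℝ, 0 < s → ∃ C : ℝ, 0 ≤ C ∧
      ∀ (K K' : Tet) (P : Panel) (n p q : E3) (H : ℝ), 0 < H → TetPanelFace K' P → ‖n‖ = 1 →
        (∀ l, ‖K.edge l‖ ≤ C₀ * H) → (∀ l, ‖K'.edge l‖ ≤ C₀ * H) →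
        (∀ η : Fin k → ℝ, (∀ j, η j ∈ Icc (0 : ℝ) 1) →
          c₀ * H ≤ ‖K.chi (D η).1 - P.chi (D η).2‖) →
        ExtendsBounded (fun η => ker₂ K P n s p q (D η) * J η) ρ (C * H ^ (3 - 2 * s)) := by
  set D' : (Fin k → ℝ) → (Fin 3 → ℝ) × (Fin 3 → ℝ) :=
    fun η => ((D η).1, ![(D η).2 0, (D η).2 1, 0]) with hD'
  have hD₂' : ∀ l, EntireExt fun η => (D' η).2 l := by
    intro l
    fin_cases l
    exacts [hD₂ 0, hD₂ 1, EntireExt.const 0]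
  filter_upwards [eventually_extendsBounded (D := D') hD₁ hD₂' hJ hc₀ hC₀] with ρ hρ s hs
  obtain ⟨C, hC, h⟩ := hρ s (6 * C₀ ^ 5) hs (by positivity)
  refine ⟨C, hC, fun K K' P n p q H hH hP hn h₁ h₂ hlow => ?_⟩
  have hzero : ∀ l : Fin 4, |(fun _ => (0 : ℝ)) l| ≤ 1 := fun l => by simp
  have hchi : ∀ η, P.chi (D η).2 = K'.chi (D' η).2 := fun η => hP.chi_eq _
  have hPe : ∀ l, ‖P.edge l‖ ≤ C₀ * H := by
    intro l
    fin_cases l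
    · exact hP.edge_zero ▸ h₂ 0
    · exact hP.edge_one ▸ h₂ 1
  have hW : |-(|K.M.det| * P.area)| ≤ 6 * C₀ ^ 5 * H ^ 5 := by
    have h0 : 0 ≤ P.area := norm_nonneg _
    rw [abs_neg, abs_of_nonneg (by positivity)]
    calc _ ≤ 6 * (C₀ * H) ^ 3 * (C₀ * H) ^ 2 :=
          mul_le_mul (K.abs_det_le h₁) (P.area_le hPe) h0
            ((abs_nonneg _).trans (K.abs_det_le h₁))
      _ = _ := by ring
  refine ((h K K' H hH h₁ h₂ (fun η hη => (hlow η hη).trans_eq (by rw [hchi])) (K.ind p)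
    _ (K.ind q) _ (K.abs_ind_le p) hzero (K.abs_ind_le q) hzero).2 _ n hn hW).congr fun η => ?_
  have hinner : inner ℝ (P.chi (D η).2 - K.chi (D η).1) n
      = -inner ℝ (K.chi (D' η).1 - K'.chi (D' η).2) n := by
    rw [← inner_neg_left, neg_sub, hchi]
  simp only [ker₂, hinner]
  rw [hchi]
  simp only [bary, Tet.hat_chi, zero_mul, Finset.sum_const_zero, hD']
  ring

end

open InnerProductGeometry EuclideanGeometry

/-! ### Orthogonal components and heights -/

theorem inner_perp (u w : E3) : inner ℝ u (perp u w) = 0 := by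
  by_cases hu : u = 0
  · simp [hu]
  · have : inner ℝ u u ≠ 0 := by simpa using hu
    rw [perp, inner_sub_right, inner_smul_right]
    field_simp
    ring

theorem perp_add (u w w' : E3) : perp u (w + w') = perp u w + perp u w' := by
  simp only [perp, inner_add_right, add_div]
  module

theorem perp_smul (u w : E3) (t : ℝ) : perp u (t • w) = t • perp u w := by
  simp only [perp, inner_smul_right, mul_div_assoc, mul_smul, smul_sub]

theorem perp_self (u : E3) : perp u u = 0 := by
  by_cases hu : u = 0
  · simp [perp, hu]
  · rw [perp, div_self (by simpa using hu), one_smul, sub_self]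

theorem perp_of_inner_eq_zero {u w : E3} (h : inner ℝ u w = 0) : perp u w = w := by
  simp [perp, h]

theorem norm_perp_sq {u : E3} (hu : u ≠ 0) (w : E3) :
    ‖perp u w‖ ^ 2 = (‖w‖ * Real.sin (angle u w)) ^ 2 := by
  have hu' : ‖u‖ ≠ 0 := norm_ne_zero_iff.2 hu
  rw [mul_pow, Real.sin_sq, ← real_inner_self_eq_norm_sq (perp u w)]
  have h1 : inner ℝ (perp u w) (perp u w) = inner ℝ w (perp u w) := by
    have e : w - perp u w = (inner ℝ u w / inner ℝ u u) • u := by simp [perp]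
    have h0 : inner ℝ (w - perp u w) (perp u w) = 0 := by
      rw [e, inner_smul_left, inner_perp, mul_zero]
    rw [inner_sub_left] at h0
    linarith
  have h2 : Real.cos (angle u w) * (‖u‖ * ‖w‖) = inner ℝ u w := cos_angle_mul_norm_mul_norm u w
  rw [h1, perp, inner_sub_right, inner_smul_right, real_inner_comm u w, ← h2,
    real_inner_self_eq_norm_sq, real_inner_self_eq_norm_sq]
  field_simp

theorem norm_perp {u : E3} (hu : u ≠ 0) (w : E3) :
    ‖perp u w‖ = ‖w‖ * Real.sin (angle u w) :=
  (pow_left_inj₀ (norm_nonneg _) (mul_nonneg (norm_nonneg _) (sin_angle_nonneg u w)) two_ne_zero).1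
    (norm_perp_sq hu w)

/-- A lower bound of the height `y` of the apex `d` over the plane through `p, q, r`, if the foot
lies on the same side of the line `p q` as `r`. -/
theorem mul_sin_le_norm_of_le_dihedral {p q r d y : E3} {β γ θ : ℝ} (hθ : 0 ≤ θ) (hγ : 0 ≤ γ)
    (hd : d - p = β • (q - p) + γ • (r - p) + y) (hq : inner ℝ (q - p) y = 0)
    (hr : inner ℝ (r - p) y = 0) (hang : θ ≤ dihedral p q r d) :
    γ * ‖perp (q - p) (r - p)‖ * Real.sin θ ≤ ‖y‖ := by
  set c := perp (q - p) (r - p) with hc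
  have hD : perp (q - p) (d - p) = γ • c + y := by
    rw [hd, perp_add, perp_add, perp_smul, perp_smul, perp_self, perp_of_inner_eq_zero hq]
    simp [hc]
  have hcy : inner ℝ c y = 0 := by
    rw [hc, perp, inner_sub_left, inner_smul_left, hq, hr]
    simp
  have hπ : dihedral p q r d ≤ Real.pi := angle_le_pi _ _
  have hcos := Real.cos_le_cos_of_nonneg_of_le_pi hθ hπ hang
  have hin : Real.cos (dihedral p q r d) * (‖c‖ * ‖γ • c + y‖) = γ * ‖c‖ ^ 2 := by
    rw [dihedral, ← hc, hD, cos_angle_mul_norm_mul_norm, inner_add_right, inner_smul_right, hcy,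
      real_inner_self_eq_norm_sq, add_zero]
  have hDn : ‖γ • c + y‖ ^ 2 = (γ * ‖c‖) ^ 2 + ‖y‖ ^ 2 := by
    rw [norm_add_sq_real, inner_smul_left, hcy, norm_smul, Real.norm_eq_abs, abs_of_nonneg hγ]
    simp
  have hsin : 0 ≤ Real.sin θ := Real.sin_nonneg_of_nonneg_of_le_pi hθ (hang.trans hπ)
  rcases (norm_nonneg c).eq_or_lt with h0 | h0
  · rw [← h0]; simp
  -- The vectors `c` and `γ • c + y` enclose the dihedral angle, and `γ ‖c‖` is the projection of
  -- the second onto the first. Squaring and using `y ⊥ c` gives `sin² θ (γ ‖c‖)² ≤ cos² θ ‖y‖² ≤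
  -- ‖y‖²`.
  have h1 : γ * ‖c‖ ≤ Real.cos θ * ‖γ • c + y‖ := by
    have : γ * ‖c‖ ^ 2 ≤ Real.cos θ * (‖c‖ * ‖γ • c + y‖) := by
      rw [← hin]; exact mul_le_mul_of_nonneg_right hcos (by positivity)
    refine le_of_mul_le_mul_right ?_ h0
    linarith
  have h2 : (γ * ‖c‖) ^ 2 ≤ Real.cos θ ^ 2 * ((γ * ‖c‖) ^ 2 + ‖y‖ ^ 2) := by
    rw [← hDn, ← mul_pow]
    exact pow_le_pow_left₀ (by positivity) h1 2
  refine (pow_le_pow_iff_left₀ (by positivity) (norm_nonneg y) two_ne_zero).1 ?_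
  have h3 := Real.sin_sq_add_cos_sq θ
  have h4 : Real.cos θ ^ 2 ≤ 1 := by nlinarith [sq_nonneg (Real.sin θ)]
  rw [mul_pow]
  have h5 : Real.sin θ ^ 2 = 1 - Real.cos θ ^ 2 := by linarith
  rw [h5]
  nlinarith [mul_nonneg (sub_nonneg.2 h4) (sq_nonneg ‖y‖)]

/-! ### Interior angles, edges and heights of a tetrahedron -/

namespace Tet

variable {K : Tet} {θ : ℝ}

theorem v_injective (K : Tet) : Function.Injective K.v := K.indep.injective

theorem dist_le_diam (K : Tet) (i j : Fin 4) : dist (K.v i) (K.v j) ≤ K.diam := by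
  rw [diam, body, convexHull_diam]
  exact Metric.dist_le_diam_of_mem (Set.finite_range K.v).isBounded ⟨i, rfl⟩ ⟨j, rfl⟩

theorem diam_pos (K : Tet) : 0 < K.diam :=
  (dist_pos.2 (K.v_injective.ne (by decide : (0 : Fin 4) ≠ 1))).trans_le (K.dist_le_diam 0 1)

theorem norm_edge_le (K : Tet) (l : Fin 3) : ‖K.edge l‖ ≤ K.diam := by
  fin_cases l
  · exact (dist_eq_norm _ _).symm.trans_le (K.dist_le_diam 1 0)
  · exact (dist_eq_norm _ _).symm.trans_le (K.dist_le_diam 2 1)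
  · exact (dist_eq_norm _ _).symm.trans_le (K.dist_le_diam 3 1)

theorem lt_faceAngle (h : ∀ α ∈ K.interiorAngles, θ < α) {i j k : Fin 4} (hij : i ≠ j) (hik : i ≠ k)
    (hjk : j ≠ k) : θ < ∠ (K.v j) (K.v i) (K.v k) :=
  h _ (.inl ⟨i, j, k, hij, hik, hjk, rfl⟩)

/-- The angle sum of the face is `π`, and the other two angles exceed `θ`. Lower bounds on angles
thus also keep them away from `π`. -/
theorem faceAngle_lt (h : ∀ α ∈ K.interiorAngles, θ < α) {i j k : Fin 4} (hij : i ≠ j) (hik : i ≠ k)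
    (hjk : j ≠ k) : ∠ (K.v j) (K.v i) (K.v k) < Real.pi - 2 * θ := by
  have := angle_add_angle_add_angle_eq_pi (K.v k) (K.v_injective.ne hij)
  have := lt_faceAngle h hik.symm hjk.symm hij
  have := lt_faceAngle h hjk hij.symm hik.symm
  linarith

theorem theta_lt_pi_div_two (h : ∀ α ∈ K.interiorAngles, θ < α) : θ < Real.pi / 2 := by
  have h1 := lt_faceAngle h (i := 0) (j := 1) (k := 2) (by decide) (by decide) (by decide)
  have h2 := faceAngle_lt h (i := 0) (j := 1) (k := 2) (by decide) (by decide) (by decide)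
  have := Real.pi_pos
  linarith

theorem sin_le_sin_faceAngle (hθ : 0 < θ) (h : ∀ α ∈ K.interiorAngles, θ < α) {i j k : Fin 4}
    (hij : i ≠ j) (hik : i ≠ k) (hjk : j ≠ k) :
    Real.sin θ ≤ Real.sin (∠ (K.v j) (K.v i) (K.v k)) := by
  have h1 := lt_faceAngle h hij hik hjk
  have h2 := faceAngle_lt h hij hik hjk
  have h3 := theta_lt_pi_div_two h
  rcases le_total (∠ (K.v j) (K.v i) (K.v k)) (Real.pi / 2) with h4 | h4
  · exact Real.sin_le_sin_of_le_of_le_pi_div_two (by linarith) h4 h1.le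
  · rw [← Real.sin_pi_sub (∠ (K.v j) (K.v i) (K.v k))]
    exact Real.sin_le_sin_of_le_of_le_pi_div_two (by linarith) (by linarith) (by linarith)

theorem sin_pos_of_interiorAngles (hθ : 0 < θ) (h : ∀ α ∈ K.interiorAngles, θ < α) :
    0 < Real.sin θ :=
  Real.sin_pos_of_pos_of_lt_pi hθ (by linarith [theta_lt_pi_div_two h, Real.pi_pos])

/-- The law of sines in the face `i j k`: two edges with a common vertex have comparable lengths. -/
theorem sin_mul_dist_le_dist (hθ : 0 < θ) (h : ∀ α ∈ K.interiorAngles, θ < α) {i j : Fin 4}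
    (hij : i ≠ j) (k : Fin 4) :
    Real.sin θ * dist (K.v i) (K.v k) ≤ dist (K.v i) (K.v j) := by
  by_cases hik : i = k
  · subst hik; simp
  by_cases hjk : j = k
  · subst hjk
    exact mul_le_of_le_one_left dist_nonneg (Real.sin_le_one θ)
  have h1 := law_sin (K.v j) (K.v k) (K.v i)
  have h2 := sin_le_sin_faceAngle hθ h (Ne.symm hjk) (Ne.symm hik) hij.symm
  rw [dist_comm (K.v i) (K.v k)]
  calc _ ≤ Real.sin (∠ (K.v j) (K.v k) (K.v i)) * dist (K.v k) (K.v i) :=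
        mul_le_mul_of_nonneg_right h2 dist_nonneg
    _ = _ := h1
    _ ≤ _ := mul_le_of_le_one_left dist_nonneg (Real.sin_le_one _)

/-- The diameter is the length of some edge `k l`, and the chain `k l`, `i k`, `i j` consists of
consecutively adjacent edges. Each of the two transitions costs a factor `sin θ`. -/
theorem sin_sq_mul_diam_le_dist (hθ : 0 < θ) (h : ∀ α ∈ K.interiorAngles, θ < α) {i j : Fin 4}
    (hij : i ≠ j) : Real.sin θ ^ 2 * K.diam ≤ dist (K.v i) (K.v j) := by
  have hs := sin_pos_of_interiorAngles hθ h
  rw [mul_comm, ← le_div_iff₀ (by positivity)]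
  rw [diam, body, convexHull_diam]
  refine Metric.diam_le_of_forall_dist_le (by positivity) ?_
  rintro _ ⟨k, rfl⟩ _ ⟨l, rfl⟩
  rw [le_div_iff₀ (by positivity)]
  by_cases hki : k = i
  · subst hki
    have h1 := sin_mul_dist_le_dist hθ h hij l
    have : Real.sin θ ^ 2 ≤ Real.sin θ := by nlinarith [Real.sin_le_one θ]
    nlinarith [dist_nonneg (x := K.v k) (y := K.v l)]
  · have h1 := sin_mul_dist_le_dist hθ h hij k
    have h2 := sin_mul_dist_le_dist hθ h hki l
    rw [dist_comm (K.v k) (K.v i)] at h2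
    nlinarith

theorem sin_mul_norm_le_norm_perp (hθ : 0 < θ) (h : ∀ α ∈ K.interiorAngles, θ < α) {i j k : Fin 4}
    (hij : i ≠ j) (hik : i ≠ k) (hjk : j ≠ k) :
    Real.sin θ ^ 3 * K.diam ≤ ‖perp (K.v j - K.v i) (K.v k - K.v i)‖ := by
  have hs := sin_pos_of_interiorAngles hθ h
  rw [norm_perp (sub_ne_zero.2 (K.v_injective.ne hij.symm))]
  have h1 := sin_sq_mul_diam_le_dist hθ h hik.symm
  rw [dist_eq_norm] at h1
  have h2 := sin_le_sin_faceAngle hθ h hij hik hjk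
  have h3 := mul_le_mul h1 h2 hs.le (norm_nonneg _)
  rw [EuclideanGeometry.angle, vsub_eq_sub, vsub_eq_sub] at h3
  linarith

theorem exists_foot (u w x : E3) : ∃ β γ : ℝ, ∃ y, x = β • u + γ • w + y ∧ inner ℝ u y = 0 ∧
    inner ℝ w y = 0 := by
  set S := Submodule.span ℝ {u, w} with hS
  obtain ⟨z, hz, y, hy, rfl⟩ := S.exists_add_mem_mem_orthogonal x
  obtain ⟨β, γ, rfl⟩ := Submodule.mem_span_pair.1 hz
  exact ⟨β, γ, y, rfl, hy u (Submodule.subset_span (by simp)),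
    hy w (Submodule.subset_span (by simp))⟩

/-- Let `y` be the height vector of vertex `l` over the plane through the other three. Its foot has
barycentric coordinates `1 - β - γ`, `β`, `γ`, one of which is at least `1/3`. The dihedral angle at
the edge opposite to that vertex bounds `‖y‖` from below by `1/3 * sin θ` times the corresponding
height of the face `i j k`, which is at least `sin³ θ` times the diameter. The vector in the claim
has orthogonal component `t • y`, so its norm is at least `|t| ‖y‖`. -/
theorem height_le_norm (hθ : 0 < θ) (h : ∀ α ∈ K.interiorAngles, θ < α) {i j k l : Fin 4}
    (hij : i ≠ j) (hik : i ≠ k) (hil : i ≠ l) (hjk : j ≠ k) (hjl : j ≠ l) (hkl : k ≠ l)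
    (t β' γ' : ℝ) :
    Real.sin θ ^ 4 / 3 * K.diam * |t| ≤
      ‖t • (K.v l - K.v i) + β' • (K.v j - K.v i) + γ' • (K.v k - K.v i)‖ := by
  have hs := sin_pos_of_interiorAngles hθ h
  obtain ⟨β, γ, y, hd, hj, hk⟩ := exists_foot (K.v j - K.v i) (K.v k - K.v i) (K.v l - K.v i)
  have hy : Real.sin θ ^ 4 / 3 * K.diam ≤ ‖y‖ := by
    have key : ∀ {μ : ℝ} {c : E3}, 1 / 3 ≤ μ → Real.sin θ ^ 3 * K.diam ≤ ‖c‖ →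
        μ * ‖c‖ * Real.sin θ ≤ ‖y‖ → Real.sin θ ^ 4 / 3 * K.diam ≤ ‖y‖ := by
      intro μ c h1 h2 h3
      have h4 := mul_le_mul h1 h2 (mul_nonneg (by positivity) K.diam_pos.le) (by linarith)
      have := mul_le_mul_of_nonneg_right h4 hs.le
      linarith
    have hdih : ∀ {i j k l : Fin 4}, i ≠ j → i ≠ k → i ≠ l → j ≠ k → j ≠ l → k ≠ l →
        θ ≤ dihedral (K.v i) (K.v j) (K.v k) (K.v l) := fun h1 h2 h3 h4 h5 h6 =>
      (h _ (.inr ⟨_, _, _, _, h1, h2, h3, h4, h5, h6, rfl⟩)).le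
    by_cases hγ : 1 / 3 ≤ γ
    · exact key hγ (sin_mul_norm_le_norm_perp hθ h hij hik hjk)
        (mul_sin_le_norm_of_le_dihedral hθ.le (by linarith) hd hj hk
          (hdih hij hik hil hjk hjl hkl))
    by_cases hβ : 1 / 3 ≤ β
    · refine key hβ (sin_mul_norm_le_norm_perp hθ h hik hij hjk.symm)
        (mul_sin_le_norm_of_le_dihedral (β := γ) hθ.le (by linarith) ?_ hk hj
          (hdih hik hij hil hjk.symm hkl hjl))
      rw [hd]; abel
    · refine key (μ := 1 - β - γ) (by linarith)
        (sin_mul_norm_le_norm_perp hθ h hjk hij.symm hik.symm)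
        (mul_sin_le_norm_of_le_dihedral (β := γ) hθ.le (by linarith) ?_ ?_ ?_
          (hdih hjk hij.symm hjl hik.symm hkl hil))
      · rw [show K.v l - K.v j = (K.v l - K.v i) - (K.v j - K.v i) by abel, hd]
        module
      · rw [show K.v k - K.v j = (K.v k - K.v i) - (K.v j - K.v i) by abel, inner_sub_left, hj, hk,
          sub_self]
      · rw [← neg_sub, inner_neg_left, hj, neg_zero]
  have hle : |t| * ‖y‖ ≤ ‖t • (K.v l - K.v i) + β' • (K.v j - K.v i) + γ' • (K.v k - K.v i)‖ := by
    have e : t • (K.v l - K.v i) + β' • (K.v j - K.v i) + γ' • (K.v k - K.v i)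
        = t • y + ((t * β + β') • (K.v j - K.v i) + (t * γ + γ') • (K.v k - K.v i)) := by
      rw [hd]; module
    have ho : inner ℝ (t • y)
        ((t * β + β') • (K.v j - K.v i) + (t * γ + γ') • (K.v k - K.v i)) = 0 := by
      rw [inner_smul_left, inner_add_right, inner_smul_right, inner_smul_right, real_inner_comm,
        hj, real_inner_comm, hk]
      simp
    rw [e, ← Real.norm_eq_abs, ← norm_smul]
    refine (pow_le_pow_iff_left₀ (norm_nonneg _) (norm_nonneg _) two_ne_zero).1 ?_
    rw [norm_add_sq_real, ho]
    nlinarith [sq_nonneg ‖(t * β + β') • (K.v j - K.v i) + (t * γ + γ') • (K.v k - K.v i)‖]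
  refine le_trans ?_ hle
  rw [mul_comm]
  exact mul_le_mul_of_nonneg_left hy (abs_nonneg t)

/-- The linear map `M_K` is bounded from below by `c` times the diameter. -/
def CoerciveWith (K : Tet) (c : ℝ) : Prop :=
  ∀ (ξ : Fin 3 → ℝ) (l : Fin 3), c * K.diam * |ξ l| ≤ ‖∑ l, ξ l • K.edge l‖

end Tet

/-- All three columns of `M_t` are, up to sign, edges issuing from the vertex `b`. The coefficient
of each is therefore controlled by the height of its other endpoint `a`, `c` or `d`. -/
theorem exists_coerciveWith {θ : ℝ} (hθ : 0 < θ) : ∃ c : ℝ, 0 < c ∧ c ≤ 1 ∧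
    ∀ K : Tet, (∀ α ∈ K.interiorAngles, θ < α) → K.CoerciveWith c := by
  -- For `θ ≥ π / 2` no tetrahedron satisfies the angle condition, while `sin θ` need not be
  -- positive; any constant will do.
  by_cases hθ' : θ < Real.pi / 2
  swap
  · exact ⟨1, one_pos, le_rfl, fun K h => absurd (Tet.theta_lt_pi_div_two h) hθ'⟩
  have hs : 0 < Real.sin θ := Real.sin_pos_of_pos_of_lt_pi hθ (by linarith [Real.pi_pos])
  refine ⟨Real.sin θ ^ 4 / 3, by positivity, ?_, fun K h ξ l => ?_⟩
  · have := pow_le_one₀ (n := 4) hs.le (Real.sin_le_one θ)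
    linarith
  have e : ∑ l, ξ l • K.edge l
      = ξ 0 • (K.v 1 - K.v 0) + ξ 1 • (K.v 2 - K.v 1) + ξ 2 • (K.v 3 - K.v 1) := by
    simp [Fin.sum_univ_three, Tet.edge]
  fin_cases l
  · refine (Tet.height_le_norm hθ h (i := 1) (j := 2) (k := 3) (l := 0) (by decide) (by decide)
      (by decide) (by decide) (by decide) (by decide) (-ξ 0) (ξ 1) (ξ 2)).trans_eq' ?_ |>.trans_eq ?_
    · simp
    · rw [e]; congr 1; module
  · refine (Tet.height_le_norm hθ h (i := 1) (j := 0) (k := 3) (l := 2) (by decide) (by decide)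
      (by decide) (by decide) (by decide) (by decide) (ξ 1) (-ξ 0) (ξ 2)).trans_eq ?_
    rw [e]; congr 1; module
  · refine (Tet.height_le_norm hθ h (i := 1) (j := 0) (k := 2) (l := 3) (by decide) (by decide)
      (by decide) (by decide) (by decide) (by decide) (ξ 2) (-ξ 0) (ξ 1)).trans_eq ?_
    rw [e]; congr 1; module


/-! ### Elements of the mesh -/

namespace Tet

theorem mem_body_iff (K : Tet) (x : E3) : x ∈ K.body ↔ ∀ l, 0 ≤ K.basis.coord l x := by
  have : K.body = convexHull ℝ (Set.range K.basis) := rfl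
  rw [this, AffineBasis.convexHull_eq_nonneg_coord]
  rfl

theorem chi_mem_body (K : Tet) {x : Fin 3 → ℝ} (h0 : x 0 ≤ 1) (h : x 1 + x 2 ≤ x 0) (h1 : 0 ≤ x 1)
    (h2 : 0 ≤ x 2) : K.chi x ∈ K.body := by
  rw [mem_body_iff]
  intro l
  rw [coord_chi]
  fin_cases l
  · exact sub_nonneg.2 h0
  · change 0 ≤ x 0 - x 1 - x 2
    linarith
  · exact h1
  · exact h2

theorem chi_surjective (K : Tet) : Function.Surjective K.chi := by
  intro p
  refine ⟨![1 - K.basis.coord 0 p, K.basis.coord 2 p, K.basis.coord 3 p], ?_⟩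
  have h := K.basis.sum_coord_apply_eq_one p
  rw [Fin.sum_univ_four] at h
  rw [chi_eq_sum_weights]
  conv_rhs => rw [← K.basis.linear_combination_coord_eq_self p]
  refine Finset.sum_congr rfl fun l _ => ?_
  have : weights ![1 - K.basis.coord 0 p, K.basis.coord 2 p, K.basis.coord 3 p] l
      = K.basis.coord l p := by
    fin_cases l <;> simp [weights]
    linarith
  rw [this]
  rfl

theorem chi_sub_chi (K : Tet) (x y : Fin 3 → ℝ) :
    K.chi x - K.chi y = ∑ l, (x l - y l) • K.edge l := by
  simp only [chi, Fin.sum_univ_three]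
  module

theorem CoerciveWith.le_norm_chi_sub {K : Tet} {c : ℝ} (h : K.CoerciveWith c) (x y : Fin 3 → ℝ)
    (l : Fin 3) : c * K.diam * |x l - y l| ≤ ‖K.chi x - K.chi y‖ := by
  rw [chi_sub_chi]
  exact h (fun l => x l - y l) l

theorem CoerciveWith.le_norm_edge {K : Tet} {c : ℝ} (h : K.CoerciveWith c) (l : Fin 3) :
    c * K.diam ≤ ‖K.edge l‖ := by
  simpa [Pi.single_apply] using h (Pi.single l 1) l

/-- Two tetrahedra with a common edge `a b` have comparable diameters. -/
theorem CoerciveWith.diam_le {K₁ K₂ : Tet} {c : ℝ} (h : K₁.CoerciveWith c) (h0 : K₁.v 0 = K₂.v 0)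
    (h1 : K₁.v 1 = K₂.v 1) : c * K₁.diam ≤ K₂.diam := by
  have e : K₁.edge 0 = K₂.edge 0 := by simp [edge, h0, h1]
  exact (h.le_norm_edge 0).trans (e ▸ K₂.norm_edge_le 0)

end Tet

theorem Panel.chi_mem_body (P : Panel) {y : Fin 2 → ℝ} (h0 : y 0 ≤ 1) (h : y 1 ≤ y 0)
    (h1 : 0 ≤ y 1) : P.chi y ∈ P.body := by
  have e : P.chi y = ∑ l, (![1 - y 0, y 0 - y 1, y 1] : Fin 3 → ℝ) l • P.v l := by
    simp only [chi, edge, Fin.sum_univ_three, Fin.sum_univ_two, Matrix.cons_val_zero,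
      Matrix.cons_val_one, Matrix.cons_val]
    module
  rw [e]
  refine (convex_convexHull ℝ P.vertexSet).sum_mem (fun l _ => ?_) ?_
    fun l _ => subset_convexHull ℝ _ ⟨l, rfl⟩
  · fin_cases l
    · exact sub_nonneg.2 h0
    · exact sub_nonneg.2 h
    · exact h1
  · simp [Fin.sum_univ_three]

/-! ### Mesh size, panels and intersections of elements -/

namespace Mesh

variable {T : Mesh}

theorem diam_eq {K : Tet} {t : Finset E3} (h : K.vertexSet = (t : Set E3)) :
    Metric.diam (convexHull ℝ (t : Set E3)) = K.diam := by
  rw [← h]; rfl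

theorem h_bounds {c₁ c₂ : ℝ} (hq : T.QuasiUniform c₁ c₂) {K : Tet} (hK : T.HasTet K) :
    c₁ * K.diam ≤ T.h ∧ T.h ≤ c₂ * K.diam := by
  obtain ⟨t₀, ht₀, _⟩ := id hK
  have hcard : (0 : ℝ) < T.tets.card := by
    exact_mod_cast Finset.card_pos.2 ⟨t₀, ht₀⟩
  have key : ∀ t ∈ T.tets, c₁ * K.diam ≤ Metric.diam (convexHull ℝ (t : Set E3)) ∧
      Metric.diam (convexHull ℝ (t : Set E3)) ≤ c₂ * K.diam := by
    intro t ht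
    obtain ⟨K', hK'⟩ := T.isTet t ht
    rw [diam_eq hK']
    exact hq K K' hK ⟨t, ht, hK'⟩
  unfold h
  rw [le_div_iff₀ hcard, div_le_iff₀ hcard, mul_comm _ (T.tets.card : ℝ),
    mul_comm _ (T.tets.card : ℝ), ← nsmul_eq_mul, ← nsmul_eq_mul]
  exact ⟨Finset.card_nsmul_le_sum _ _ _ fun t ht => (key t ht).1,
    Finset.sum_le_card_nsmul _ _ _ fun t ht => (key t ht).2⟩

theorem h_pos {c₁ c₂ : ℝ} (hc₁ : 0 < c₁) (hq : T.QuasiUniform c₁ c₂) {K : Tet} (hK : T.HasTet K) :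
    0 < T.h :=
  (mul_pos hc₁ K.diam_pos).trans_le (h_bounds hq hK).1

/-- The vertices of the panel embed into those of a mesh element. Extending this injection to a
permutation of the four indices reorders the element so that the panel is its face `abc`; the mesh
admits every ordering of an element. -/
theorem HasPanel.exists_tet {P : Panel} (hP : T.HasPanel P) :
    ∃ K, T.HasTet K ∧ TetPanelFace K P := by
  obtain ⟨t, ht, hPt⟩ := hP
  obtain ⟨K, hK⟩ := T.isTet t ht
  have : ∀ i, ∃ j, K.v j = P.v i := by
    intro i
    have : P.v i ∈ K.vertexSet := hK ▸ hPt ⟨i, rfl⟩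
    exact this
  choose f hf using this
  have hfi : Function.Injective f := by
    intro i j hij
    exact P.indep.injective (by rw [← hf, ← hf, hij])
  obtain ⟨g, hg⟩ := Finset.exists_equiv_extend_of_card_eq (α := Fin 4) (t := (Finset.univ : Finset (Fin 4)))
    (by simp) (s := Finset.univ.image (Fin.castSucc : Fin 3 → Fin 4))
    (f := fun i => if h : (i : ℕ) < 3 then f ⟨i, h⟩ else 0) (Finset.subset_univ _) (by
      intro i hi j hj hij
      simp only [Finset.coe_image, Finset.coe_univ, Set.image_univ, Set.mem_range] at hi hj
      obtain ⟨i, rfl⟩ := hi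
      obtain ⟨j, rfl⟩ := hj
      simpa using hfi (by simpa using hij))
  let e : Equiv.Perm (Fin 4) := g.trans (Equiv.subtypeUnivEquiv fun x => Finset.mem_univ x)
  have he : ∀ i : Fin 3, e i.castSucc = f i := by
    intro i
    have := hg i.castSucc (Finset.mem_image_of_mem _ (Finset.mem_univ i))
    exact this.trans (by simp)
  refine ⟨⟨K.v ∘ e, K.indep.comp_embedding e.toEmbedding⟩, ⟨t, ht, ?_⟩, ?_, ?_, ?_⟩
  · rw [← hK]
    exact e.surjective.range_comp K.v
  · exact (congrArg K.v (he 0)).trans (hf 0)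
  · exact (congrArg K.v (he 1)).trans (hf 1)
  · exact (congrArg K.v (he 2)).trans (hf 2)

/-- Conformity only concerns whole elements and places the intersection in the hull of `t₁ ∩ t`.
Since the vertices of `t` are affinely independent, hulls of subsets of them intersect in the hull
of the common vertices, and this cuts down further from `t` to `V`. -/
theorem body_inter_convexHull_subset {K : Tet} (hK : T.HasTet K) {t : Finset E3} (ht : t ∈ T.tets)
    {V : Set E3} (hV : V ⊆ t) : K.body ∩ convexHull ℝ V ⊆ convexHull ℝ (K.vertexSet ∩ V) := by
  classical
  obtain ⟨t₁, ht₁, hK₁⟩ := hK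
  obtain ⟨K₂, hK₂⟩ := T.isTet t ht
  have hind : AffineIndependent ℝ (Subtype.val : t → E3) := by
    have h := K₂.indep.range
    have e : Set.range K₂.v = (t : Set E3) := hK₂
    rw [e] at h
    exact h
  have hVf : V.Finite := t.finite_toSet.subset hV
  have hinter := hind.convexHull_inter (t₁ := t₁ ∩ t) (t₂ := hVf.toFinset) Finset.inter_subset_right
    (by intro x hx; exact hV (by simpa using hx))
  rintro x ⟨hx₁, hx₂⟩
  have hx : x ∈ convexHull ℝ ((t₁ : Set E3) ∩ (t : Set E3)) := by
    rw [← T.conforming t₁ ht₁ t ht]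
    exact ⟨by rw [← hK₁]; exact hx₁, convexHull_mono hV hx₂⟩
  have : x ∈ convexHull ℝ (((t₁ ∩ t : Finset E3) : Set E3) ∩ (hVf.toFinset : Set E3)) := by
    rw [hinter]
    exact ⟨by simpa using hx, by simpa using hx₂⟩
  refine convexHull_mono ?_ this
  rw [hK₁]
  simp only [Finset.coe_inter, Set.Finite.coe_toFinset]
  exact fun y hy => ⟨hy.1.1, hy.2⟩

theorem body_inter_body_subset {K₁ K₂ : Tet} (h₁ : T.HasTet K₁) (h₂ : T.HasTet K₂) :
    K₁.body ∩ K₂.body ⊆ convexHull ℝ (K₁.vertexSet ∩ K₂.vertexSet) := by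
  obtain ⟨t, ht, hK⟩ := h₂
  exact body_inter_convexHull_subset h₁ ht hK.subset

theorem body_inter_panel_subset {K : Tet} {P : Panel} (h₁ : T.HasTet K) (h₂ : T.HasPanel P) :
    K.body ∩ P.body ⊆ convexHull ℝ (K.vertexSet ∩ P.vertexSet) := by
  obtain ⟨t, ht, hP⟩ := h₂
  exact body_inter_convexHull_subset h₁ ht hP

end Mesh

/-! ### Lower bounds of the distance -/

section

variable {K₁ K₂ : Tet} {c : ℝ}

/-- The fourth vertices of two elements with a common face lie on different sides of it. -/
theorem coord_three_nonpos (hface : K₁.v 0 = K₂.v 0 ∧ K₁.v 1 = K₂.v 1 ∧ K₁.v 2 = K₂.v 2)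
    (hint : K₁.body ∩ K₂.body ⊆ convexHull ℝ {K₁.v 0, K₁.v 1, K₁.v 2}) :
    K₁.basis.coord 3 (K₂.v 3) ≤ 0 := by
  by_contra! hr
  -- `m` is the centroid of the common face. If the fourth vertex of `K₂` were on the inner side, a
  -- short move from `m` towards it would stay in both elements yet leave the face.
  obtain ⟨m, hm⟩ : ∃ m, m = K₁.chi ![2 / 3, 1 / 3, 0] := ⟨_, rfl⟩
  have hm2 : m = K₂.chi ![2 / 3, 1 / 3, 0] := by
    simp [hm, Tet.chi, Tet.edge, Fin.sum_univ_three, hface.1, hface.2.1, hface.2.2]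
  obtain ⟨S, hS0, hpw⟩ : ∃ S : ℝ, 0 ≤ S ∧ ∀ l, -S ≤ K₁.basis.coord l (K₂.v 3) :=
    ⟨∑ l, |K₁.basis.coord l (K₂.v 3)|, Finset.sum_nonneg fun _ _ => abs_nonneg _, fun l =>
      (neg_le_neg (Finset.single_le_sum (f := fun l => |K₁.basis.coord l (K₂.v 3)|)
        (fun _ _ => abs_nonneg _) (Finset.mem_univ l))).trans (neg_abs_le _)⟩
  -- With this `ε` the first three coordinates after the move are at least `(1 - ε) / 3 - ε S = 0`.
  obtain ⟨ε, hε0, hε1, hεS⟩ : ∃ ε : ℝ, 0 < ε ∧ ε ≤ 1 ∧ ε * (1 + 3 * S) = 1 := by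
    refine ⟨1 / (1 + 3 * S), by positivity, ?_, ?_⟩
    · rw [div_le_one (by positivity)]; linarith
    · field_simp
  obtain ⟨w, hw⟩ : ∃ w, w = AffineMap.lineMap m (K₂.v 3) ε := ⟨_, rfl⟩
  have hcoord : ∀ l, K₁.basis.coord l w
      = (1 - ε) * K₁.basis.coord l m + ε * K₁.basis.coord l (K₂.v 3) := by
    intro l
    rw [hw, AffineMap.apply_lineMap, AffineMap.lineMap_apply_ring]
  have hcm : ∀ l, K₁.basis.coord l m = (![1 / 3, 1 / 3, 1 / 3, 0] : Fin 4 → ℝ) l := by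
    intro l
    rw [hm, Tet.coord_chi]
    fin_cases l <;> norm_num [weights] <;> rfl
  have hw3 : K₁.basis.coord 3 w = ε * K₁.basis.coord 3 (K₂.v 3) := by
    rw [hcoord, hcm]; simp
  have hw1 : w ∈ K₁.body := by
    rw [Tet.mem_body_iff]
    intro l
    by_cases hl : l = 3
    · subst hl; rw [hw3]; positivity
    · have : K₁.basis.coord l m = 1 / 3 := by
        rw [hcm]; fin_cases l <;> simp at hl ⊢
      rw [hcoord, this]
      nlinarith [hpw l]
  have hw2 : w ∈ K₂.body := by
    rw [hw]
    refine (convex_convexHull ℝ _).lineMap_mem ?_ ?_ ⟨hε0.le, hε1⟩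
    · rw [hm2]
      exact K₂.chi_mem_body (by simp; norm_num) (by simp; norm_num) (by simp) (by simp)
    · exact subset_convexHull ℝ _ ⟨3, rfl⟩
  have hle : convexHull ℝ {K₁.v 0, K₁.v 1, K₁.v 2} ⊆ {x | K₁.basis.coord 3 x = 0} := by
    refine convexHull_min ?_ ?_
    · have : ∀ l, l ≠ 3 → K₁.basis.coord 3 (K₁.v l) = 0 := fun l hl =>
        K₁.basis.coord_apply_ne hl.symm
      rintro x (rfl | rfl | rfl)
      · exact this 0 (by decide)
      · exact this 1 (by decide)
      · exact this 2 (by decide)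
    · exact (convex_singleton (0 : ℝ)).affine_preimage (K₁.basis.coord 3)
  have h0 : K₁.basis.coord 3 w = 0 := hle (hint ⟨hw1, hw2⟩)
  rw [hw3] at h0
  exact absurd h0 (mul_pos hε0 hr).ne'

/-- In the coordinates of `K₁` the point of `K₂` has third component `y 2 * ξ 2 ≤ 0`, so the third
components differ by at least `x 2`. -/
theorem face_normal_le (hc : K₁.CoerciveWith c)
    (hface : K₁.v 0 = K₂.v 0 ∧ K₁.v 1 = K₂.v 1 ∧ K₁.v 2 = K₂.v 2)
    (hr : K₁.basis.coord 3 (K₂.v 3) ≤ 0) (hc0 : 0 ≤ c) {x y : Fin 3 → ℝ}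
    (hy : 0 ≤ y 2) : c * K₁.diam * x 2 ≤ ‖K₁.chi x - K₂.chi y‖ := by
  obtain ⟨ξ, hξ⟩ := K₁.chi_surjective (K₂.v 3)
  have hξ2 : ξ 2 ≤ 0 := by
    rw [← hξ, Tet.coord_chi] at hr
    exact hr
  have e : K₂.chi y = K₁.chi ![y 0 + y 2 * (ξ 0 - 1), y 1 + y 2 * ξ 1, y 2 * ξ 2] := by
    have h3 : K₂.edge 2 = K₁.chi ξ - K₁.v 1 := by simp [hξ, Tet.edge, hface.2.1]
    have h0 : K₂.edge 0 = K₁.edge 0 := by simp [Tet.edge, hface.1, hface.2.1]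
    have h1 : K₂.edge 1 = K₁.edge 1 := by simp [Tet.edge, hface.2.1, hface.2.2]
    have h4 : K₁.v 1 = K₁.v 0 + K₁.edge 0 := by simp [Tet.edge]
    simp only [Tet.chi, Fin.sum_univ_three] at h3 ⊢
    rw [h3, h0, h1, h4, ← hface.1]
    simp only [Matrix.cons_val_zero, Matrix.cons_val_one, Matrix.cons_val]
    module
  rw [e]
  refine le_trans ?_ (hc.le_norm_chi_sub _ _ 2)
  refine mul_le_mul_of_nonneg_left ?_ (mul_nonneg hc0 K₁.diam_pos.le)
  refine le_trans ?_ (le_abs_self _)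
  simp only [Matrix.cons_val]
  nlinarith

/-- The two normal components are bounded by the distance because they lie on opposite sides of the
face. Subtracting the normal parts leaves a difference within the common face, to which coercivity
of `K₁` applies. The first two coordinates need no sign condition, which matters because the
transformed points may lie outside the elements. -/
theorem face_lower (hc₁ : K₁.CoerciveWith c) (hc₂ : K₂.CoerciveWith c) (hc0 : 0 < c) (hc1 : c ≤ 1)
    (hface : K₁.v 0 = K₂.v 0 ∧ K₁.v 1 = K₂.v 1 ∧ K₁.v 2 = K₂.v 2)
    (hint : K₁.body ∩ K₂.body ⊆ convexHull ℝ {K₁.v 0, K₁.v 1, K₁.v 2})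
    {x y : Fin 3 → ℝ} (hx : 0 ≤ x 2) (hy : 0 ≤ y 2) :
    c ^ 2 * (K₁.diam * (|x 0 - y 0| + |x 1 - y 1| + x 2 + y 2)) ≤ 8 * ‖K₁.chi x - K₂.chi y‖ := by
  have hface' : K₂.v 0 = K₁.v 0 ∧ K₂.v 1 = K₁.v 1 ∧ K₂.v 2 = K₁.v 2 :=
    ⟨hface.1.symm, hface.2.1.symm, hface.2.2.symm⟩
  have hint' : K₂.body ∩ K₁.body ⊆ convexHull ℝ {K₂.v 0, K₂.v 1, K₂.v 2} := by
    rw [Set.inter_comm, ← hface.1, ← hface.2.1, ← hface.2.2]; exact hint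
  set d := ‖K₁.chi x - K₂.chi y‖ with hd
  have h1 : c * K₁.diam * x 2 ≤ d :=
    face_normal_le hc₁ hface (coord_three_nonpos hface hint) hc0.le hy
  have h2 : c * K₂.diam * y 2 ≤ d := by
    rw [hd, norm_sub_rev]
    exact face_normal_le hc₂ hface' (coord_three_nonpos hface' hint') hc0.le hx
  have h3 := hc₁.diam_le hface.1 hface.2.1
  have hdec : ∀ l : Fin 3, l ≠ 2 → c * K₁.diam * |x l - y l| ≤ d + x 2 * K₁.diam + y 2 * K₂.diam := by
    intro l hl
    have e : K₁.chi ![x 0, x 1, 0] - K₁.chi ![y 0, y 1, 0]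
        = (K₁.chi x - K₂.chi y) - x 2 • K₁.edge 2 + y 2 • K₂.edge 2 := by
      have e0 : K₂.edge 0 = K₁.edge 0 := by simp [Tet.edge, hface.1, hface.2.1]
      have e1 : K₂.edge 1 = K₁.edge 1 := by simp [Tet.edge, hface.2.1, hface.2.2]
      simp only [Tet.chi, Fin.sum_univ_three, e0, e1, hface.1, Matrix.cons_val_zero,
        Matrix.cons_val_one, Matrix.cons_val]
      module
    have h := hc₁.le_norm_chi_sub ![x 0, x 1, 0] ![y 0, y 1, 0] l
    rw [e] at h
    have hl' : |(![x 0, x 1, 0] : Fin 3 → ℝ) l - (![y 0, y 1, 0] : Fin 3 → ℝ) l| = |x l - y l| := by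
      fin_cases l <;> simp at hl ⊢
    rw [hl'] at h
    refine h.trans ((norm_add_le _ _).trans (add_le_add ((norm_sub_le _ _).trans
      (add_le_add le_rfl ?_)) ?_))
    · rw [norm_smul, Real.norm_eq_abs, abs_of_nonneg hx]
      exact mul_le_mul_of_nonneg_left (K₁.norm_edge_le 2) hx
    · rw [norm_smul, Real.norm_eq_abs, abs_of_nonneg hy]
      exact mul_le_mul_of_nonneg_left (K₂.norm_edge_le 2) hy
  have hd0 : 0 ≤ d := norm_nonneg _
  have hcd : c * d ≤ d := by nlinarith
  -- After multiplication by `c`, each of the two tangential differences costs at most `3 d` and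
  -- each normal component at most `d`, in total `8 d`. The comparison `c * K₁.diam ≤ K₂.diam`
  -- handles `y 2`.
  have g0 := mul_le_mul_of_nonneg_left (hdec 0 (by decide)) hc0.le
  have g1 := mul_le_mul_of_nonneg_left (hdec 1 (by decide)) hc0.le
  have g2 := mul_le_mul_of_nonneg_left h1 hc0.le
  have g3 := mul_le_mul_of_nonneg_left (mul_le_mul_of_nonneg_right h3 hy) hc0.le
  nlinarith

/-- Lower bound for two elements with the common edge `a b`; the sets `A`, `B` are the two
elements or their faces. -/
theorem edge_lower (hc₁ : K₁.CoerciveWith c) (hc₂ : K₂.CoerciveWith c) (hc0 : 0 < c)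
    (h0 : K₁.v 0 = K₂.v 0) (h1 : K₁.v 1 = K₂.v 1) {A B : Set E3} {cA : ℝ} (hcA : 0 < cA)
    (hsep : Separated cA A B) (hint : A ∩ B ⊆ convexHull ℝ {K₁.v 0, K₁.v 1})
    {x y : Fin 3 → ℝ} (hx1 : 0 ≤ x 1) (hx2 : 0 ≤ x 2) (hy1 : 0 ≤ y 1) (hy2 : 0 ≤ y 2)
    (hxA : K₁.chi ![1 / 2 + x 0 / 4, x 1 / 4, x 2 / 4] ∈ A)
    (hyB : K₂.chi ![1 / 2 + y 0 / 4, y 1 / 4, y 2 / 4] ∈ B) :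
    cA * c ^ 2 * (K₁.diam * (|x 0 - y 0| + x 1 + x 2 + y 1 + y 2))
      ≤ (cA * c + 4 + 2 * c + 2) * ‖K₁.chi x - K₂.chi y‖ := by
  -- Separation is assumed only inside the elements, so it is applied to copies of `x` and `y`
  -- contracted by `1/4` towards the edge midpoint. The shift runs along the common edge and cancels
  -- in the difference, which is just divided by four.
  obtain ⟨z, hz, hle⟩ := hsep _ hxA _ hyB
  have e0 : K₂.edge 0 = K₁.edge 0 := by simp [Tet.edge, h0, h1]
  obtain ⟨t, ht⟩ : ∃ t : ℝ, z = K₁.chi ![t, 0, 0] := by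
    have := hint hz
    rw [convexHull_pair, segment_eq_image'] at this
    obtain ⟨t, _, rfl⟩ := this
    refine ⟨t, ?_⟩
    simp [Tet.chi, Fin.sum_univ_three, Tet.edge, add_comm]
  have ht2 : z = K₂.chi ![t, 0, 0] := by
    rw [ht]; simp [Tet.chi, Fin.sum_univ_three, e0, h0]
  have hdiff : K₁.chi ![1 / 2 + x 0 / 4, x 1 / 4, x 2 / 4]
      - K₂.chi ![1 / 2 + y 0 / 4, y 1 / 4, y 2 / 4] = (1 / 4 : ℝ) • (K₁.chi x - K₂.chi y) := by
    simp only [Tet.chi, Fin.sum_univ_three, e0, h0, Matrix.cons_val_zero,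
        Matrix.cons_val_one, Matrix.cons_val]
    module
  rw [hdiff, norm_smul, norm_sub_rev z] at hle
  set d := ‖K₁.chi x - K₂.chi y‖ with hd
  have hq : ‖(1 / 4 : ℝ)‖ = 1 / 4 := by norm_num
  rw [hq] at hle
  have hX : ∀ l : Fin 3, l ≠ 0 → 0 ≤ x l → cA * (c * K₁.diam * x l) ≤ d := by
    intro l hl hxl
    have h := hc₁.le_norm_chi_sub ![1 / 2 + x 0 / 4, x 1 / 4, x 2 / 4] ![t, 0, 0] l
    rw [← ht] at h
    have hl' : |(![1 / 2 + x 0 / 4, x 1 / 4, x 2 / 4] : Fin 3 → ℝ) l - (![t, 0, 0] : Fin 3 → ℝ) l|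
        = x l / 4 := by
      rw [← abs_of_nonneg (by positivity : 0 ≤ x l / 4)]
      fin_cases l <;> simp at hl ⊢
    rw [hl'] at h
    have h' := mul_le_mul_of_nonneg_left h hcA.le
    have := mul_nonneg hcA.le (norm_nonneg (K₂.chi ![1 / 2 + y 0 / 4, y 1 / 4, y 2 / 4] - z))
    linarith
  have hY : ∀ l : Fin 3, l ≠ 0 → 0 ≤ y l → cA * (c * K₂.diam * y l) ≤ d := by
    intro l hl hyl
    have h := hc₂.le_norm_chi_sub ![1 / 2 + y 0 / 4, y 1 / 4, y 2 / 4] ![t, 0, 0] l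
    rw [← ht2] at h
    have hl' : |(![1 / 2 + y 0 / 4, y 1 / 4, y 2 / 4] : Fin 3 → ℝ) l - (![t, 0, 0] : Fin 3 → ℝ) l|
        = y l / 4 := by
      rw [← abs_of_nonneg (by positivity : 0 ≤ y l / 4)]
      fin_cases l <;> simp at hl ⊢
    rw [hl'] at h
    have h' := mul_le_mul_of_nonneg_left h hcA.le
    have := mul_nonneg hcA.le (norm_nonneg (K₁.chi ![1 / 2 + x 0 / 4, x 1 / 4, x 2 / 4] - z))
    linarith
  have hX1 := hX 1 (by decide) hx1
  have hX2 := hX 2 (by decide) hx2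
  have hY1 := hY 1 (by decide) hy1
  have hY2 := hY 2 (by decide) hy2
  have h3 := hc₁.diam_le h0 h1
  have hdec : c * K₁.diam * |x 0 - y 0|
      ≤ d + (x 1 * K₁.diam + x 2 * K₁.diam) + (y 1 * K₂.diam + y 2 * K₂.diam) := by
    have e : K₁.chi ![x 0, 0, 0] - K₁.chi ![y 0, 0, 0] = (K₁.chi x - K₂.chi y)
        - (x 1 • K₁.edge 1 + x 2 • K₁.edge 2) + (y 1 • K₂.edge 1 + y 2 • K₂.edge 2) := by
      simp only [Tet.chi, Fin.sum_univ_three, e0, h0, Matrix.cons_val_zero,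
        Matrix.cons_val_one, Matrix.cons_val]
      module
    have h := hc₁.le_norm_chi_sub ![x 0, 0, 0] ![y 0, 0, 0] 0
    rw [e] at h
    have hs : ∀ {K : Tet} {a b : ℝ}, 0 ≤ a → 0 ≤ b →
        ‖a • K.edge 1 + b • K.edge 2‖ ≤ a * K.diam + b * K.diam := by
      intro K a b ha hb
      refine (norm_add_le _ _).trans (add_le_add ?_ ?_)
      · rw [norm_smul, Real.norm_eq_abs, abs_of_nonneg ha]
        exact mul_le_mul_of_nonneg_left (K.norm_edge_le 1) ha
      · rw [norm_smul, Real.norm_eq_abs, abs_of_nonneg hb]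
        exact mul_le_mul_of_nonneg_left (K.norm_edge_le 2) hb
    exact h.trans ((norm_add_le _ _).trans (add_le_add ((norm_sub_le _ _).trans
      (add_le_add le_rfl (hs hx1 hx2))) (hs hy1 hy2)))
  have hac : 0 ≤ cA * c := by positivity
  -- The constant collects `cA * c + 4` from the component along the edge, `2 * c` from `x 1`, `x
  -- 2`, and `2` from `y 1`, `y 2`.
  have g0 := mul_le_mul_of_nonneg_left hdec hac
  have g1 := mul_le_mul_of_nonneg_left hX1 hc0.le
  have g2 := mul_le_mul_of_nonneg_left hX2 hc0.le
  have g3 := mul_le_mul_of_nonneg_left (mul_le_mul_of_nonneg_right h3 hy1) hac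
  have g4 := mul_le_mul_of_nonneg_left (mul_le_mul_of_nonneg_right h3 hy2) hac
  nlinarith

/-- Lower bound for two elements with the common vertex `a`; the sets `A`, `B` are the two
elements or their faces. -/
theorem vertex_lower (hc₁ : K₁.CoerciveWith c) (hc₂ : K₂.CoerciveWith c)
    (h0 : K₁.v 0 = K₂.v 0) {A B : Set E3} {cA : ℝ} (hcA : 0 < cA)
    (hsep : Separated cA A B) (hint : A ∩ B ⊆ convexHull ℝ {K₁.v 0})
    {x y : Fin 3 → ℝ} (hxA : K₁.chi x ∈ A) (hyB : K₂.chi y ∈ B) :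
    cA * (c * K₁.diam * |x 0| + c * K₂.diam * |y 0|) ≤ ‖K₁.chi x - K₂.chi y‖ := by
  obtain ⟨z, hz, hle⟩ := hsep _ hxA _ hyB
  have hz0 : z = K₁.v 0 := by simpa using hint hz
  have hzero : ∀ K : Tet, K.chi 0 = K.v 0 := fun K => by simp [Tet.chi]
  have h1 := hc₁.le_norm_chi_sub x 0 0
  have h2 := hc₂.le_norm_chi_sub y 0 0
  rw [hzero] at h1 h2
  rw [norm_sub_rev z, hz0] at hle
  rw [← h0] at h2
  simp only [Pi.zero_apply, sub_zero] at h1 h2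
  exact (mul_le_mul_of_nonneg_left (add_le_add h1 h2) hcA.le).trans hle

theorem setDist_le {A B : Set E3} {x y : E3} (hx : x ∈ A) (hy : y ∈ B) :
    setDist A B ≤ ‖x - y‖ :=
  csInf_le ⟨0, by rintro _ ⟨a, _, b, _, rfl⟩; exact norm_nonneg _⟩ ⟨x, hx, y, hy, rfl⟩

end


/-! ### Polynomial structure of the transformations -/

theorem entireExt_duffyT (m : Fin 9) (l : Fin 3) : EntireExt (fun η => (duffyT η m).1 l) ∧
    EntireExt (fun η => (duffyT η m).2 l) ∧ EntireExt (fun η => jacT η m) := by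
  refine ⟨?_, ?_, ?_⟩ <;> fin_cases m <;> fin_cases l <;> dsimp [duffyT, jacT] <;>
  repeat first
    | exact EntireExt.const _ | exact EntireExt.coord _ | apply EntireExt.mul
    | apply EntireExt.sub | apply EntireExt.neg | apply EntireExt.pow

theorem entireExt_duffyF₀ (m : Fin 7) (l : Fin 3) : EntireExt (fun η => (duffyF₀ η m).1 l) ∧
    EntireExt (fun η => (duffyF₀ η m).2 l) := by
  refine ⟨?_, ?_⟩ <;> fin_cases m <;> fin_cases l <;> dsimp [duffyF₀] <;>
  repeat first
    | exact EntireExt.const _ | exact EntireExt.coord _ | apply EntireExt.mul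
    | apply EntireExt.sub | apply EntireExt.neg | apply EntireExt.pow

theorem entireExt_duffyF₁ (m : Fin 3) (l : Fin 3) : EntireExt (fun η => (duffyF₁ η m).1 l) ∧
    EntireExt (fun η => (duffyF₁ η m).2 l) ∧ EntireExt (fun η => jacF₁ η m) := by
  refine ⟨?_, ?_, ?_⟩ <;> fin_cases m <;> fin_cases l <;> dsimp [duffyF₁, jacF₁] <;>
  repeat first
    | exact EntireExt.const _ | exact EntireExt.coord _ | apply EntireExt.mul
    | apply EntireExt.sub | apply EntireExt.neg | apply EntireExt.pow

theorem entireExt_duffyE (m : Fin 2) (l : Fin 3) : EntireExt (fun η => (duffyE η m).1 l) ∧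
    EntireExt (fun η => (duffyE η m).2 l) ∧ EntireExt (fun η => jacE η m) := by
  refine ⟨?_, ?_, ?_⟩ <;> fin_cases m <;> fin_cases l <;> dsimp [duffyE, jacE] <;>
  repeat first
    | exact EntireExt.const _ | exact EntireExt.coord _ | apply EntireExt.mul
    | apply EntireExt.sub | apply EntireExt.neg | apply EntireExt.pow

theorem entireExt_duffyV (l : Fin 3) : EntireExt (fun η => (duffyV η).1 l) ∧
    EntireExt (fun η => (duffyV η).2 l) := by
  refine ⟨?_, ?_⟩ <;> fin_cases l <;> dsimp [duffyV] <;>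
  repeat first
    | exact EntireExt.const _ | exact EntireExt.coord _ | apply EntireExt.mul
    | apply EntireExt.sub | apply EntireExt.neg | apply EntireExt.pow

theorem entireExt_refTet {k : ℕ} (i j r : Fin k) (l : Fin 3) :
    EntireExt (fun η : Fin k → ℝ => refTet (η i) (η j) (η r) l) := by
  fin_cases l <;> dsimp [refTet] <;>
  repeat first
    | exact EntireExt.const _ | exact EntireExt.coord _ | apply EntireExt.mul
    | apply EntireExt.sub | apply EntireExt.neg | apply EntireExt.pow

theorem entireExt_duffyPF (m : Fin 9) : (∀ l, EntireExt (fun η => (duffyPF η m).1 l)) ∧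
    (∀ l, EntireExt (fun η => (duffyPF η m).2 l)) ∧ EntireExt (fun η => jacPF η m) := by
  refine ⟨fun l => ?_, fun l => ?_, ?_⟩
  rotate_left 2
  all_goals
    fin_cases m <;> try fin_cases l
  all_goals
    dsimp [duffyPF, jacPF]
    repeat first
      | exact EntireExt.const _ | exact EntireExt.coord _ | apply EntireExt.mul
      | apply EntireExt.sub | apply EntireExt.neg | apply EntireExt.pow

theorem entireExt_duffyPE (m : Fin 4) : (∀ l, EntireExt (fun η => (duffyPE η m).1 l)) ∧
    (∀ l, EntireExt (fun η => (duffyPE η m).2 l)) ∧ EntireExt (fun η => jacPE η m) := by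
  refine ⟨fun l => ?_, fun l => ?_, ?_⟩
  rotate_left 2
  all_goals
    fin_cases m <;> try fin_cases l
  all_goals
    dsimp [duffyPE, jacPE]
    repeat first
      | exact EntireExt.const _ | exact EntireExt.coord _ | apply EntireExt.mul
      | apply EntireExt.sub | apply EntireExt.neg | apply EntireExt.pow

theorem entireExt_duffyPV (m : Fin 2) : (∀ l, EntireExt (fun η => (duffyPV η m).1 l)) ∧
    (∀ l, EntireExt (fun η => (duffyPV η m).2 l)) ∧ EntireExt (fun η => jacPV η m) := by
  refine ⟨fun l => ?_, fun l => ?_, ?_⟩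
  rotate_left 2
  all_goals
    fin_cases m <;> try fin_cases l
  all_goals
    dsimp [duffyPV, jacPV]
    repeat first
      | exact EntireExt.const _ | exact EntireExt.coord _ | apply EntireExt.mul
      | apply EntireExt.sub | apply EntireExt.neg | apply EntireExt.pow

/-! ### The transformations avoid the singularity -/

theorem mul_mem_Icc_of_mem {a b : ℝ} (ha : 0 ≤ a) (hb : b ∈ Icc (0 : ℝ) 1) :
    0 ≤ a * b ∧ a * b ≤ a :=
  ⟨mul_nonneg ha hb.1, mul_le_of_le_one_right ha hb.2⟩

/-- For identical elements only differences of coordinates enter the distance, and choosing the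
right sign in each absolute value makes their sum at least `1` on every sub-domain. -/
theorem duffyT_lower {η : Fin 2 → ℝ} (hη : ∀ j, η j ∈ Icc (0 : ℝ) 1) (m : Fin 9) :
    1 ≤ |(duffyT η m).1 0 - (duffyT η m).2 0| + |(duffyT η m).1 1 - (duffyT η m).2 1| +
      |(duffyT η m).1 2 - (duffyT η m).2 2| := by
  have e0 := hη 0
  have e1 := hη 1
  have e01 := mul_mem_Icc_of_mem e0.1 e1
  -- These supply `±u ≤ |u|`, so that `linarith` finds the signs by itself.
  have a0 := abs_le.1 (le_refl |(duffyT η m).1 0 - (duffyT η m).2 0|)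
  have a1 := abs_le.1 (le_refl |(duffyT η m).1 1 - (duffyT η m).2 1|)
  have a2 := abs_le.1 (le_refl |(duffyT η m).1 2 - (duffyT η m).2 2|)
  obtain ⟨h0, h0'⟩ := e0
  obtain ⟨h1, h1'⟩ := e1
  fin_cases m <;> dsimp [duffyT] at a0 a1 a2 ⊢ <;> linarith

theorem duffyF₀_lower {η : Fin 3 → ℝ} (hη : ∀ j, η j ∈ Icc (0 : ℝ) 1) (m : Fin 7) :
    0 ≤ (duffyF₀ η m).1 2 ∧ 0 ≤ (duffyF₀ η m).2 2 ∧
    1 ≤ |(duffyF₀ η m).1 0 - (duffyF₀ η m).2 0| + |(duffyF₀ η m).1 1 - (duffyF₀ η m).2 1| +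
      (duffyF₀ η m).1 2 + (duffyF₀ η m).2 2 := by
  obtain ⟨h0, h0'⟩ := hη 0
  have e01 := mul_mem_Icc_of_mem h0 (hη 1)
  have e012 := mul_mem_Icc_of_mem e01.1 (hη 2)
  have a0 := abs_le.1 (le_refl |(duffyF₀ η m).1 0 - (duffyF₀ η m).2 0|)
  have a1 := abs_le.1 (le_refl |(duffyF₀ η m).1 1 - (duffyF₀ η m).2 1|)
  fin_cases m <;> dsimp [duffyF₀] at a0 a1 ⊢ <;> refine ⟨?_, ?_, ?_⟩ <;> linarith

theorem duffyF₁_lower {η : Fin 3 → ℝ} (hη : ∀ j, η j ∈ Icc (0 : ℝ) 1) (m : Fin 3) :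
    0 ≤ (duffyF₁ η m).1 2 ∧ 0 ≤ (duffyF₁ η m).2 2 ∧
    1 ≤ |(duffyF₁ η m).1 0 - (duffyF₁ η m).2 0| + |(duffyF₁ η m).1 1 - (duffyF₁ η m).2 1| +
      (duffyF₁ η m).1 2 + (duffyF₁ η m).2 2 := by
  obtain ⟨h0, h0'⟩ := hη 0
  obtain ⟨h2, h2'⟩ := hη 2
  have e01 := mul_mem_Icc_of_mem h0 (hη 1)
  have e02 := mul_mem_Icc_of_mem h0 (hη 2)
  have a0 := abs_le.1 (le_refl |(duffyF₁ η m).1 0 - (duffyF₁ η m).2 0|)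
  have a1 := abs_le.1 (le_refl |(duffyF₁ η m).1 1 - (duffyF₁ η m).2 1|)
  fin_cases m <;> dsimp [duffyF₁] at a0 a1 ⊢ <;> refine ⟨?_, ?_, ?_⟩ <;> linarith

/-- `1/4` times the point `x`, shifted to the midpoint of the edge `a b`, lies in the reference
tetrahedron. -/
def EdgeAdmissible (x : Fin 3 → ℝ) : Prop :=
  0 ≤ x 1 ∧ 0 ≤ x 2 ∧ x 0 ≤ 2 ∧ x 1 + x 2 ≤ 2 + x 0

theorem duffyE_lower {η : Fin 4 → ℝ} (hη : ∀ j, η j ∈ Icc (0 : ℝ) 1) (m : Fin 2) :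
    EdgeAdmissible (duffyE η m).1 ∧ EdgeAdmissible (duffyE η m).2 ∧
    1 ≤ |(duffyE η m).1 0 - (duffyE η m).2 0| + (duffyE η m).1 1 + (duffyE η m).1 2 +
      (duffyE η m).2 1 + (duffyE η m).2 2 := by
  obtain ⟨h0, h0'⟩ := hη 0
  obtain ⟨h1, h1'⟩ := hη 1
  obtain ⟨h2, h2'⟩ := hη 2
  have e01 := mul_mem_Icc_of_mem h0 (hη 1)
  have e12 := mul_mem_Icc_of_mem h1 (hη 2)
  have e123 := mul_mem_Icc_of_mem e12.1 (hη 3)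
  have e23 := mul_mem_Icc_of_mem h2 (hη 3)
  have a0 := abs_le.1 (le_refl |(duffyE η m).1 0 - (duffyE η m).2 0|)
  fin_cases m <;> dsimp [duffyE, EdgeAdmissible] at a0 ⊢ <;>
    refine ⟨⟨?_, ?_, ?_, ?_⟩, ⟨?_, ?_, ?_, ?_⟩, ?_⟩ <;> linarith

/-- Membership in the reference tetrahedron. -/
def InRef (x : Fin 3 → ℝ) : Prop :=
  x 0 ≤ 1 ∧ x 1 + x 2 ≤ x 0 ∧ 0 ≤ x 1 ∧ 0 ≤ x 2

theorem inRef_refTet {u v w : ℝ} (hu : u ∈ Icc (0 : ℝ) 1) (hv : v ∈ Icc (0 : ℝ) 1)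
    (hw : w ∈ Icc (0 : ℝ) 1) : InRef (refTet u v w) := by
  have e1 := mul_mem_Icc_of_mem hu.1 hv
  have e2 := mul_mem_Icc_of_mem e1.1 hw
  have := hu.2
  dsimp [InRef, refTet]
  refine ⟨?_, ?_, ?_, ?_⟩ <;> linarith

/-- Here, unlike in the edge case, the transformed points stay in the reference element, so
separation applies directly. -/
theorem duffyV_inRef {η : Fin 5 → ℝ} (hη : ∀ j, η j ∈ Icc (0 : ℝ) 1) :
    InRef (duffyV η).1 ∧ InRef (duffyV η).2 := by
  obtain ⟨h0, h0'⟩ := hη 0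
  obtain ⟨h2, h2'⟩ := hη 2
  have e01 := mul_mem_Icc_of_mem h0 (hη 1)
  have e23 := mul_mem_Icc_of_mem h2 (hη 3)
  have e234 := mul_mem_Icc_of_mem e23.1 (hη 4)
  dsimp [InRef, duffyV]
  refine ⟨⟨?_, ?_, ?_, ?_⟩, ⟨?_, ?_, ?_, ?_⟩⟩ <;> linarith

theorem duffyPF_lower {η : Fin 2 → ℝ} (hη : ∀ j, η j ∈ Icc (0 : ℝ) 1) (m : Fin 9) :
    1 ≤ |(duffyPF η m).1 0 - (duffyPF η m).2 0| + |(duffyPF η m).1 1 - (duffyPF η m).2 1| +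
      |(duffyPF η m).1 2 - 0| := by
  obtain ⟨h0, h0'⟩ := hη 0
  obtain ⟨h1, h1'⟩ := hη 1
  have e01 := mul_mem_Icc_of_mem h0 (hη 1)
  have a0 := abs_le.1 (le_refl |(duffyPF η m).1 0 - (duffyPF η m).2 0|)
  have a1 := abs_le.1 (le_refl |(duffyPF η m).1 1 - (duffyPF η m).2 1|)
  have a2 := abs_le.1 (le_refl |(duffyPF η m).1 2 - 0|)
  fin_cases m <;> dsimp [duffyPF] at a0 a1 a2 ⊢ <;> linarith

theorem duffyPE_lower {η : Fin 3 → ℝ} (hη : ∀ j, η j ∈ Icc (0 : ℝ) 1) (m : Fin 4) :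
    EdgeAdmissible (duffyPE η m).1 ∧
    EdgeAdmissible ![(duffyPE η m).2 0, (duffyPE η m).2 1, 0] ∧
    1 ≤ |(duffyPE η m).1 0 - (duffyPE η m).2 0| + (duffyPE η m).1 1 + (duffyPE η m).1 2 +
      (duffyPE η m).2 1 := by
  obtain ⟨h0, h0'⟩ := hη 0
  obtain ⟨h1, h1'⟩ := hη 1
  have e01 := mul_mem_Icc_of_mem h0 (hη 1)
  have e12 := mul_mem_Icc_of_mem h1 (hη 2)
  have e012 := mul_mem_Icc_of_mem e01.1 (hη 2)
  have a0 := abs_le.1 (le_refl |(duffyPE η m).1 0 - (duffyPE η m).2 0|)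
  fin_cases m <;> dsimp [duffyPE, EdgeAdmissible] at a0 ⊢ <;>
    refine ⟨⟨?_, ?_, ?_, ?_⟩, ⟨?_, ?_, ?_, ?_⟩, ?_⟩ <;> linarith

theorem duffyPV_inRef {η : Fin 4 → ℝ} (hη : ∀ j, η j ∈ Icc (0 : ℝ) 1) (m : Fin 2) :
    InRef (duffyPV η m).1 ∧ InRef ![(duffyPV η m).2 0, (duffyPV η m).2 1, 0] ∧
    1 ≤ |(duffyPV η m).1 0| + |(duffyPV η m).2 0| := by
  obtain ⟨h0, h0'⟩ := hη 0
  obtain ⟨h1, h1'⟩ := hη 1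
  obtain ⟨h2, h2'⟩ := hη 2
  have e01 := mul_mem_Icc_of_mem h0 (hη 1)
  have e23 := mul_mem_Icc_of_mem h2 (hη 3)
  have e12 := mul_mem_Icc_of_mem h1 (hη 2)
  have e123 := mul_mem_Icc_of_mem e12.1 (hη 3)
  have a0 := abs_le.1 (le_refl |(duffyPV η m).1 0|)
  have a1 := abs_le.1 (le_refl |(duffyPV η m).2 0|)
  fin_cases m <;> dsimp [duffyPV, InRef] at a0 a1 ⊢ <;>
    refine ⟨⟨?_, ?_, ?_, ?_⟩, ⟨?_, ?_, ?_, ?_⟩, ?_⟩ <;> linarith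


/-! ### Sums over the sub-domains -/

section

variable {k : ℕ} {ι : Type*} [Fintype ι] {J : (Fin k → ℝ) → ι → ℝ} {c₀ C₀ : ℝ}

theorem eventually_extendsBounded_sum_ker₁ {D : (Fin k → ℝ) → ι → (Fin 3 → ℝ) × (Fin 3 → ℝ)}
    (hD₁ : ∀ m l, EntireExt fun η => (D η m).1 l) (hD₂ : ∀ m l, EntireExt fun η => (D η m).2 l)
    (hJ : ∀ m, EntireExt fun η => J η m) (hc₀ : 0 < c₀) (hC₀ : 0 ≤ C₀) :
    ∀ᶠ ρ in 𝓝[>] (1 / 2 : ℝ), ∀ s : ℝ, 0 < s → ∃ C : ℝ, 0 ≤ C ∧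
      ∀ (K₁ K₂ : Tet) (p q : E3) (H : ℝ), 0 < H →
        (∀ l, ‖K₁.edge l‖ ≤ C₀ * H) → (∀ l, ‖K₂.edge l‖ ≤ C₀ * H) →
        (∀ m, ∀ η : Fin k → ℝ, (∀ j, η j ∈ Icc (0 : ℝ) 1) →
          c₀ * H ≤ ‖K₁.chi (D η m).1 - K₂.chi (D η m).2‖) →
        ExtendsBounded (fun η => ∑ m, ker₁ K₁ K₂ s p q (D η m) * J η m) ρ
          (C * H ^ (3 - 2 * s)) := by
  filter_upwards [Filter.eventually_all.2 fun m => eventually_extendsBounded_ker₁ (hD₁ m) (hD₂ m)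
    (hJ m) hc₀ hC₀] with ρ hρ s hs
  choose C hC h using fun m => hρ m s hs
  refine ⟨∑ m, C m, Finset.sum_nonneg fun m _ => hC m, fun K₁ K₂ p q H hH h₁ h₂ hlow => ?_⟩
  rw [Finset.sum_mul]
  exact ExtendsBounded.sum _ fun m _ => h m K₁ K₂ p q H hH h₁ h₂ (hlow m)

theorem eventually_extendsBounded_sum_ker₂ {D : (Fin k → ℝ) → ι → (Fin 3 → ℝ) × (Fin 2 → ℝ)}
    (hD₁ : ∀ m l, EntireExt fun η => (D η m).1 l) (hD₂ : ∀ m l, EntireExt fun η => (D η m).2 l)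
    (hJ : ∀ m, EntireExt fun η => J η m) (hc₀ : 0 < c₀) (hC₀ : 0 ≤ C₀) :
    ∀ᶠ ρ in 𝓝[>] (1 / 2 : ℝ), ∀ s : ℝ, 0 < s → ∃ C : ℝ, 0 ≤ C ∧
      ∀ (K K' : Tet) (P : Panel) (n p q : E3) (H : ℝ), 0 < H → TetPanelFace K' P → ‖n‖ = 1 →
        (∀ l, ‖K.edge l‖ ≤ C₀ * H) → (∀ l, ‖K'.edge l‖ ≤ C₀ * H) →
        (∀ m, ∀ η : Fin k → ℝ, (∀ j, η j ∈ Icc (0 : ℝ) 1) →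
          c₀ * H ≤ ‖K.chi (D η m).1 - P.chi (D η m).2‖) →
        ExtendsBounded (fun η => ∑ m, ker₂ K P n s p q (D η m) * J η m) ρ
          (C * H ^ (3 - 2 * s)) := by
  filter_upwards [Filter.eventually_all.2 fun m => eventually_extendsBounded_ker₂ (hD₁ m) (hD₂ m)
    (hJ m) hc₀ hC₀] with ρ hρ s hs
  choose C hC h using fun m => hρ m s hs
  refine ⟨∑ m, C m, Finset.sum_nonneg fun m _ => hC m, fun K K' P n p q H hH hP hn h₁ h₂ hlow => ?_⟩
  rw [Finset.sum_mul]
  exact ExtendsBounded.sum _ fun m _ => h m K K' P n p q H hH hP hn h₁ h₂ (hlow m)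

end

/-! ### The integrands on single pairs of elements -/

theorem norm_edge_le_of_mul_diam_le {K : Tet} {c₁ H : ℝ} (hc₁ : 0 < c₁) (hK : c₁ * K.diam ≤ H)
    (l : Fin 3) : ‖K.edge l‖ ≤ 1 / c₁ * H := by
  rw [one_div, inv_mul_eq_div, le_div_iff₀ hc₁, mul_comm]
  exact (mul_le_mul_of_nonneg_left (K.norm_edge_le l) hc₁.le).trans hK

/-- A shared edge makes the diameters comparable by the angle condition alone. The face and edge
cases can thus use `K₁.diam` as the length scale, and their `ρ` does not involve the
quasi-uniformity constants. -/
theorem norm_edge_le_of_common_edge {K₁ K₂ : Tet} {c : ℝ} (hc0 : 0 < c) (hc : K₂.CoerciveWith c)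
    (h0 : K₁.v 0 = K₂.v 0) (h1 : K₁.v 1 = K₂.v 1) (l : Fin 3) :
    ‖K₂.edge l‖ ≤ 1 / c * K₁.diam :=
  norm_edge_le_of_mul_diam_le hc0 (hc.diam_le h0.symm h1.symm) l

theorem norm_edge_le_one_div_mul {K : Tet} {c : ℝ} (hc0 : 0 < c) (hc1 : c ≤ 1) (l : Fin 3) :
    ‖K.edge l‖ ≤ 1 / c * K.diam :=
  norm_edge_le_of_mul_diam_le hc0 (mul_le_of_le_one_left K.diam_pos.le hc1) l

section

variable {c : ℝ}

theorem identical_lower {K : Tet} (hc0 : 0 < c) (hK : K.CoerciveWith c) {x y : Fin 3 → ℝ}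
    (h : 1 ≤ |x 0 - y 0| + |x 1 - y 1| + |x 2 - y 2|) :
    c / 3 * K.diam ≤ ‖K.chi x - K.chi y‖ := by
  have h0 := hK.le_norm_chi_sub x y 0
  have h1 := hK.le_norm_chi_sub x y 1
  have h2 := hK.le_norm_chi_sub x y 2
  have := mul_le_mul_of_nonneg_left h (mul_nonneg hc0.le K.diam_pos.le)
  linarith

theorem eventually_k1T (hc0 : 0 < c) (hc1 : c ≤ 1) :
    ∀ᶠ ρ in 𝓝[>] (1 / 2 : ℝ), ∀ s : ℝ, 0 < s → ∃ C : ℝ, 0 ≤ C ∧ ∀ (K : Tet) (p q : E3),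
      K.CoerciveWith c → ExtendsBounded (k1T K s p q) ρ (C * K.diam ^ (3 - 2 * s)) := by
  filter_upwards [eventually_extendsBounded_sum_ker₁ (D := duffyT) (J := jacT) (C₀ := 1 / c)
    (fun m l => (entireExt_duffyT m l).1) (fun m l => (entireExt_duffyT m l).2.1)
    (fun m => (entireExt_duffyT m 0).2.2) (show 0 < c / 3 by positivity) (by positivity)]
    with ρ hρ s hs
  obtain ⟨C, hC, h⟩ := hρ s hs
  exact ⟨C, hC, fun K p q hK => h K K p q K.diam K.diam_pos (norm_edge_le_one_div_mul hc0 hc1)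
    (norm_edge_le_one_div_mul hc0 hc1) fun m η hη => identical_lower hc0 hK (duffyT_lower hη m)⟩

theorem eventually_k2F (hc0 : 0 < c) (hc1 : c ≤ 1) :
    ∀ᶠ ρ in 𝓝[>] (1 / 2 : ℝ), ∀ s : ℝ, 0 < s → ∃ C : ℝ, 0 ≤ C ∧
      ∀ (K : Tet) (P : Panel) (n p q : E3), K.CoerciveWith c → TetPanelFace K P → ‖n‖ = 1 →
        ExtendsBounded (k2F K P n s p q) ρ (C * K.diam ^ (3 - 2 * s)) := by
  filter_upwards [eventually_extendsBounded_sum_ker₂ (D := duffyPF) (J := jacPF) (C₀ := 1 / c)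
    (fun m l => (entireExt_duffyPF m).1 l) (fun m l => (entireExt_duffyPF m).2.1 l)
    (fun m => (entireExt_duffyPF m).2.2) (show 0 < c / 3 by positivity) (by positivity)]
    with ρ hρ s hs
  obtain ⟨C, hC, h⟩ := hρ s hs
  refine ⟨C, hC, fun K P n p q hK hP hn => h K K P n p q K.diam K.diam_pos hP hn
    (norm_edge_le_one_div_mul hc0 hc1) (norm_edge_le_one_div_mul hc0 hc1) fun m η hη => ?_⟩
  rw [hP.chi_eq]
  exact identical_lower hc0 hK (duffyPF_lower hη m)

theorem eventually_k1F (hc0 : 0 < c) (hc1 : c ≤ 1) :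
    ∀ᶠ ρ in 𝓝[>] (1 / 2 : ℝ), ∀ s : ℝ, 0 < s → ∃ C : ℝ, 0 ≤ C ∧ ∀ (K₁ K₂ : Tet) (p q : E3),
      K₁.CoerciveWith c → K₂.CoerciveWith c →
      (K₁.v 0 = K₂.v 0 ∧ K₁.v 1 = K₂.v 1 ∧ K₁.v 2 = K₂.v 2) →
      K₁.body ∩ K₂.body ⊆ convexHull ℝ {K₁.v 0, K₁.v 1, K₁.v 2} →
      ExtendsBounded (k1F K₁ K₂ s p q) ρ (C * K₁.diam ^ (3 - 2 * s)) := by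
  have hpos : 0 < c ^ 2 / 8 := by positivity
  have hJ : EntireExt fun η : Fin 3 → ℝ => η 0 ^ 2 * η 1 :=
    ((EntireExt.coord 0).pow 2).mul (EntireExt.coord 1)
  filter_upwards [eventually_extendsBounded_sum_ker₁ (D := duffyF₀) (C₀ := 1 / c)
      (J := fun η _ => η 0 ^ 2 * η 1) (fun m l => (entireExt_duffyF₀ m l).1)
      (fun m l => (entireExt_duffyF₀ m l).2) (fun _ => hJ) hpos (by positivity),
    eventually_extendsBounded_sum_ker₁ (D := fun η m => (duffyF₀ η m).swap) (C₀ := 1 / c)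
      (J := fun η _ => η 0 ^ 2 * η 1) (fun m l => (entireExt_duffyF₀ m l).2)
      (fun m l => (entireExt_duffyF₀ m l).1) (fun _ => hJ) hpos (by positivity),
    eventually_extendsBounded_sum_ker₁ (D := duffyF₁) (J := jacF₁) (C₀ := 1 / c)
      (fun m l => (entireExt_duffyF₁ m l).1) (fun m l => (entireExt_duffyF₁ m l).2.1)
      (fun m => (entireExt_duffyF₁ m 0).2.2) hpos (by positivity)] with ρ h₁ h₂ h₃ s hs
  obtain ⟨C₁, hC₁, h₁⟩ := h₁ s hs
  obtain ⟨C₂, hC₂, h₂⟩ := h₂ s hs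
  obtain ⟨C₃, hC₃, h₃⟩ := h₃ s hs
  refine ⟨C₁ + C₂ + C₃, by positivity, fun K₁ K₂ p q hK₁ hK₂ hf hint => ?_⟩
  have e₁ := norm_edge_le_one_div_mul (K := K₁) hc0 hc1
  have e₂ := norm_edge_le_of_common_edge hc0 hK₂ hf.1 hf.2.1
  have key : ∀ {x y : Fin 3 → ℝ}, 0 ≤ x 2 → 0 ≤ y 2 →
      1 ≤ |x 0 - y 0| + |x 1 - y 1| + x 2 + y 2 →
      c ^ 2 / 8 * K₁.diam ≤ ‖K₁.chi x - K₂.chi y‖ := by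
    intro x y hx hy h
    have g := face_lower hK₁ hK₂ hc0 hc1 hf hint hx hy
    have := mul_le_mul_of_nonneg_left (mul_le_mul_of_nonneg_left h K₁.diam_pos.le) (sq_nonneg c)
    linarith
  rw [add_mul, add_mul]
  refine ExtendsBounded.add (ExtendsBounded.add (h₁ K₁ K₂ p q _ K₁.diam_pos e₁ e₂ ?_)
    (h₂ K₁ K₂ p q _ K₁.diam_pos e₁ e₂ ?_)) (h₃ K₁ K₂ p q _ K₁.diam_pos e₁ e₂ ?_)
  · intro m η hη
    obtain ⟨a, b, h⟩ := duffyF₀_lower hη m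
    exact key a b h
  · intro m η hη
    -- The lower bound is symmetric in `x` and `y`, so it also covers the mirror images.
    obtain ⟨a, b, h⟩ := duffyF₀_lower hη m
    refine key (x := (duffyF₀ η m).2) (y := (duffyF₀ η m).1) b a ?_
    rw [abs_sub_comm, abs_sub_comm ((duffyF₀ η m).2 1)]
    linarith
  · intro m η hη
    obtain ⟨a, b, h⟩ := duffyF₁_lower hη m
    exact key a b h

theorem EdgeAdmissible.chi_mem_body {x : Fin 3 → ℝ} (h : EdgeAdmissible x) (K : Tet) :
    K.chi ![1 / 2 + x 0 / 4, x 1 / 4, x 2 / 4] ∈ K.body := by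
  obtain ⟨h1, h2, h3, h4⟩ := h
  refine K.chi_mem_body ?_ ?_ ?_ ?_ <;> dsimp <;> linarith

theorem EdgeAdmissible.chi_mem_panel {x : Fin 2 → ℝ} (h : EdgeAdmissible ![x 0, x 1, 0]) {K : Tet}
    {P : Panel} (hP : TetPanelFace K P) :
    K.chi ![1 / 2 + (![x 0, x 1, 0] : Fin 3 → ℝ) 0 / 4, (![x 0, x 1, 0] : Fin 3 → ℝ) 1 / 4,
      (![x 0, x 1, 0] : Fin 3 → ℝ) 2 / 4] ∈ P.body := by
  obtain ⟨h1, h2, h3, h4⟩ := h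
  dsimp at h1 h2 h3 h4
  have e : K.chi ![1 / 2 + (![x 0, x 1, 0] : Fin 3 → ℝ) 0 / 4,
      (![x 0, x 1, 0] : Fin 3 → ℝ) 1 / 4, (![x 0, x 1, 0] : Fin 3 → ℝ) 2 / 4]
      = P.chi ![1 / 2 + x 0 / 4, x 1 / 4] := by
    rw [hP.chi_eq]; simp
  rw [e]
  refine P.chi_mem_body ?_ ?_ ?_ <;> dsimp <;> linarith

theorem edge_lower_of_one_le {K₁ K₂ : Tet} (hc₁ : K₁.CoerciveWith c) (hc₂ : K₂.CoerciveWith c)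
    (hc0 : 0 < c) (h0 : K₁.v 0 = K₂.v 0) (h1 : K₁.v 1 = K₂.v 1) {A B : Set E3} {cA : ℝ}
    (hcA : 0 < cA) (hsep : Separated cA A B) (hint : A ∩ B ⊆ convexHull ℝ {K₁.v 0, K₁.v 1})
    {x y : Fin 3 → ℝ} (hx : EdgeAdmissible x) (hy : EdgeAdmissible y)
    (hxA : K₁.chi ![1 / 2 + x 0 / 4, x 1 / 4, x 2 / 4] ∈ A)
    (hyB : K₂.chi ![1 / 2 + y 0 / 4, y 1 / 4, y 2 / 4] ∈ B)
    (hxy : 1 ≤ |x 0 - y 0| + x 1 + x 2 + y 1 + y 2) :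
    cA * c ^ 2 / (cA * c + 4 + 2 * c + 2) * K₁.diam ≤ ‖K₁.chi x - K₂.chi y‖ := by
  have g := edge_lower hc₁ hc₂ hc0 h0 h1 hcA hsep hint hx.1 hx.2.1 hy.1 hy.2.1 hxA hyB
  have := mul_le_mul_of_nonneg_left (mul_le_mul_of_nonneg_left hxy K₁.diam_pos.le)
    (show 0 ≤ cA * c ^ 2 by positivity)
  rw [div_mul_eq_mul_div, div_le_iff₀ (by positivity)]
  linarith

theorem eventually_k1E (hc0 : 0 < c) (hc1 : c ≤ 1) {cA : ℝ} (hcA : 0 < cA) :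
    ∀ᶠ ρ in 𝓝[>] (1 / 2 : ℝ), ∀ s : ℝ, 0 < s → ∃ C : ℝ, 0 ≤ C ∧ ∀ (K₁ K₂ : Tet) (p q : E3),
      K₁.CoerciveWith c → K₂.CoerciveWith c → K₁.v 0 = K₂.v 0 → K₁.v 1 = K₂.v 1 →
      K₁.body ∩ K₂.body ⊆ convexHull ℝ {K₁.v 0, K₁.v 1} → Separated cA K₁.body K₂.body →
      ExtendsBounded (k1E K₁ K₂ s p q) ρ (C * K₁.diam ^ (3 - 2 * s)) := by
  have hpos : 0 < cA * c ^ 2 / (cA * c + 4 + 2 * c + 2) := by positivity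
  filter_upwards [eventually_extendsBounded_sum_ker₁ (D := duffyE) (J := jacE) (C₀ := 1 / c)
      (fun m l => (entireExt_duffyE m l).1) (fun m l => (entireExt_duffyE m l).2.1)
      (fun m => (entireExt_duffyE m 0).2.2) hpos (by positivity),
    eventually_extendsBounded_sum_ker₁ (D := fun η m => (duffyE η m).swap) (J := jacE)
      (C₀ := 1 / c) (fun m l => (entireExt_duffyE m l).2.1) (fun m l => (entireExt_duffyE m l).1)
      (fun m => (entireExt_duffyE m 0).2.2) hpos (by positivity)] with ρ h₁ h₂ s hs
  obtain ⟨C₁, hC₁, h₁⟩ := h₁ s hs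
  obtain ⟨C₂, hC₂, h₂⟩ := h₂ s hs
  refine ⟨C₁ + C₂, by positivity, fun K₁ K₂ p q hK₁ hK₂ h0 h1 hint hsep => ?_⟩
  have e₁ := norm_edge_le_one_div_mul (K := K₁) hc0 hc1
  have e₂ := norm_edge_le_of_common_edge hc0 hK₂ h0 h1
  rw [add_mul]
  refine ExtendsBounded.add (h₁ K₁ K₂ p q _ K₁.diam_pos e₁ e₂ ?_)
    (h₂ K₁ K₂ p q _ K₁.diam_pos e₁ e₂ ?_)
  · intro m η hη
    obtain ⟨a, b, h⟩ := duffyE_lower hη m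
    exact edge_lower_of_one_le hK₁ hK₂ hc0 h0 h1 hcA hsep hint a b (a.chi_mem_body K₁)
      (b.chi_mem_body K₂) h
  · intro m η hη
    obtain ⟨a, b, h⟩ := duffyE_lower hη m
    refine edge_lower_of_one_le hK₁ hK₂ hc0 h0 h1 hcA hsep hint b a (b.chi_mem_body K₁)
      (a.chi_mem_body K₂) ?_
    rw [abs_sub_comm, Prod.fst_swap, Prod.snd_swap]
    linarith

theorem eventually_k2E (hc0 : 0 < c) (hc1 : c ≤ 1) {cA : ℝ} (hcA : 0 < cA) :
    ∀ᶠ ρ in 𝓝[>] (1 / 2 : ℝ), ∀ s : ℝ, 0 < s → ∃ C : ℝ, 0 ≤ C ∧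
      ∀ (K K' : Tet) (P : Panel) (n p q : E3), K.CoerciveWith c → K'.CoerciveWith c →
      TetPanelFace K' P → ‖n‖ = 1 → K.v 0 = P.v 0 → K.v 1 = P.v 1 →
      K.body ∩ P.body ⊆ convexHull ℝ {K.v 0, K.v 1} → Separated cA K.body P.body →
      ExtendsBounded (k2E K P n s p q) ρ (C * K.diam ^ (3 - 2 * s)) := by
  have hpos : 0 < cA * c ^ 2 / (cA * c + 4 + 2 * c + 2) := by positivity
  filter_upwards [eventually_extendsBounded_sum_ker₂ (D := duffyPE) (J := jacPE) (C₀ := 1 / c)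
    (fun m l => (entireExt_duffyPE m).1 l) (fun m l => (entireExt_duffyPE m).2.1 l)
    (fun m => (entireExt_duffyPE m).2.2) hpos (by positivity)] with ρ hρ s hs
  obtain ⟨C, hC, h⟩ := hρ s hs
  refine ⟨C, hC, fun K K' P n p q hK hK' hP hn h0 h1 hint hsep => ?_⟩
  have h0' := h0.trans hP.1.symm
  have h1' := h1.trans hP.2.1.symm
  refine h K K' P n p q _ K.diam_pos hP hn (norm_edge_le_one_div_mul hc0 hc1)
    (norm_edge_le_of_common_edge hc0 hK' h0' h1') fun m η hη => ?_
  obtain ⟨a, b, hab⟩ := duffyPE_lower hη m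
  rw [hP.chi_eq]
  exact edge_lower_of_one_le hK hK' hc0 h0' h1' hcA hsep hint a b (a.chi_mem_body K)
    (b.chi_mem_panel hP) (by dsimp; linarith)

theorem InRef.chi_mem_body {x : Fin 3 → ℝ} (h : InRef x) (K : Tet) : K.chi x ∈ K.body :=
  K.chi_mem_body h.1 h.2.1 h.2.2.1 h.2.2.2

theorem InRef.chi_mem_panel {x : Fin 2 → ℝ} (h : InRef ![x 0, x 1, 0]) (P : Panel) :
    P.chi x ∈ P.body := by
  obtain ⟨h1, h2, h3, -⟩ := h
  dsimp at h1 h2 h3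
  exact P.chi_mem_body h1 (by linarith) h3

/-- The length scale is a common `H` rather than the diameter of one element; comparing both
diameters with it is where `c₂` enters the lower bound, and hence `ρ`. -/
theorem vertex_lower_of_one_le {K₁ K₂ : Tet} (hc₁ : K₁.CoerciveWith c) (hc₂ : K₂.CoerciveWith c)
    (hc0 : 0 < c) (h0 : K₁.v 0 = K₂.v 0) {A B : Set E3} {cA : ℝ} (hcA : 0 < cA)
    (hsep : Separated cA A B) (hint : A ∩ B ⊆ convexHull ℝ {K₁.v 0}) {x y : Fin 3 → ℝ}
    (hxA : K₁.chi x ∈ A) (hyB : K₂.chi y ∈ B) (hxy : 1 ≤ |x 0| + |y 0|) {c₂ H : ℝ} (hcc₂ : 0 < c₂)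
    (hH : 0 ≤ H) (hd₁ : H ≤ c₂ * K₁.diam) (hd₂ : H ≤ c₂ * K₂.diam) :
    cA * c / c₂ * H ≤ ‖K₁.chi x - K₂.chi y‖ := by
  refine le_trans ?_ (vertex_lower hc₁ hc₂ h0 hcA hsep hint hxA hyB)
  have g₁ : H / c₂ ≤ K₁.diam := by rw [div_le_iff₀ hcc₂, mul_comm]; exact hd₁
  have g₂ : H / c₂ ≤ K₂.diam := by rw [div_le_iff₀ hcc₂, mul_comm]; exact hd₂
  have g₃ := mul_le_mul_of_nonneg_right g₁ (abs_nonneg (x 0))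
  have g₄ := mul_le_mul_of_nonneg_right g₂ (abs_nonneg (y 0))
  have g₅ := mul_le_mul_of_nonneg_left hxy (div_nonneg hH hcc₂.le)
  rw [mul_div_assoc, mul_assoc, mul_assoc]
  refine mul_le_mul_of_nonneg_left ?_ hcA.le
  calc c / c₂ * H = c * (H / c₂) := by ring
    _ ≤ c * (K₁.diam * |x 0| + K₂.diam * |y 0|) := mul_le_mul_of_nonneg_left (by linarith) hc0.le
    _ = _ := by ring

theorem eventually_k1V (hc0 : 0 < c) {cA c₁ c₂ : ℝ} (hcA : 0 < cA) (hc₁ : 0 < c₁) (hc₂ : 0 < c₂) :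
    ∀ᶠ ρ in 𝓝[>] (1 / 2 : ℝ), ∀ s : ℝ, 0 < s → ∃ C : ℝ, 0 ≤ C ∧
      ∀ (K₁ K₂ : Tet) (p q : E3) (H : ℝ), 0 < H →
      (c₁ * K₁.diam ≤ H ∧ H ≤ c₂ * K₁.diam) → (c₁ * K₂.diam ≤ H ∧ H ≤ c₂ * K₂.diam) →
      K₁.CoerciveWith c → K₂.CoerciveWith c → K₁.v 0 = K₂.v 0 →
      K₁.body ∩ K₂.body ⊆ convexHull ℝ {K₁.v 0} → Separated cA K₁.body K₂.body →
      ExtendsBounded (k1V K₁ K₂ s p q) ρ (C * H ^ (3 - 2 * s)) := by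
  have hpos : 0 < cA * c / c₂ := by positivity
  have hJ : EntireExt fun η : Fin 5 → ℝ => η 0 * η 2 ^ 2 * η 3 :=
    ((EntireExt.coord 0).mul ((EntireExt.coord 2).pow 2)).mul (EntireExt.coord 3)
  filter_upwards [eventually_extendsBounded_ker₁ (D := duffyV) (C₀ := 1 / c₁)
      (fun l => (entireExt_duffyV l).1) (fun l => (entireExt_duffyV l).2) hJ hpos (by positivity),
    eventually_extendsBounded_ker₁ (D := fun η => (duffyV η).swap) (C₀ := 1 / c₁)
      (fun l => (entireExt_duffyV l).2) (fun l => (entireExt_duffyV l).1) hJ hpos (by positivity)]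
    with ρ h₁ h₂ s hs
  obtain ⟨C₁, hC₁, h₁⟩ := h₁ s hs
  obtain ⟨C₂, hC₂, h₂⟩ := h₂ s hs
  refine ⟨C₁ + C₂, by positivity, fun K₁ K₂ p q H hH b₁ b₂ hK₁ hK₂ h0 hint hsep => ?_⟩
  rw [add_mul]
  refine (ExtendsBounded.add (h₁ K₁ K₂ p q H hH (norm_edge_le_of_mul_diam_le hc₁ b₁.1) (norm_edge_le_of_mul_diam_le hc₁ b₂.1) fun η hη => ?_)
    (h₂ K₁ K₂ p q H hH (norm_edge_le_of_mul_diam_le hc₁ b₁.1) (norm_edge_le_of_mul_diam_le hc₁ b₂.1) fun η hη => ?_)).congr fun η => (add_mul _ _ _).symm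
  · obtain ⟨a, b⟩ := duffyV_inRef hη
    exact vertex_lower_of_one_le hK₁ hK₂ hc0 h0 hcA hsep hint (a.chi_mem_body K₁)
      (b.chi_mem_body K₂) (by simp [duffyV]) hc₂ hH.le b₁.2 b₂.2
  · obtain ⟨a, b⟩ := duffyV_inRef hη
    exact vertex_lower_of_one_le hK₁ hK₂ hc0 h0 hcA hsep hint (b.chi_mem_body K₁)
      (a.chi_mem_body K₂) (by simp [duffyV]) hc₂ hH.le b₁.2 b₂.2

theorem eventually_k2V (hc0 : 0 < c) {cA c₁ c₂ : ℝ} (hcA : 0 < cA) (hc₁ : 0 < c₁) (hc₂ : 0 < c₂) :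
    ∀ᶠ ρ in 𝓝[>] (1 / 2 : ℝ), ∀ s : ℝ, 0 < s → ∃ C : ℝ, 0 ≤ C ∧
      ∀ (K K' : Tet) (P : Panel) (n p q : E3) (H : ℝ), 0 < H →
      (c₁ * K.diam ≤ H ∧ H ≤ c₂ * K.diam) → (c₁ * K'.diam ≤ H ∧ H ≤ c₂ * K'.diam) →
      K.CoerciveWith c → K'.CoerciveWith c → TetPanelFace K' P → ‖n‖ = 1 → K.v 0 = P.v 0 →
      K.body ∩ P.body ⊆ convexHull ℝ {K.v 0} → Separated cA K.body P.body →
      ExtendsBounded (k2V K P n s p q) ρ (C * H ^ (3 - 2 * s)) := by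
  have hpos : 0 < cA * c / c₂ := by positivity
  filter_upwards [eventually_extendsBounded_sum_ker₂ (D := duffyPV) (J := jacPV) (C₀ := 1 / c₁)
    (fun m l => (entireExt_duffyPV m).1 l) (fun m l => (entireExt_duffyPV m).2.1 l)
    (fun m => (entireExt_duffyPV m).2.2) hpos (by positivity)] with ρ hρ s hs
  obtain ⟨C, hC, h⟩ := hρ s hs
  refine ⟨C, hC, fun K K' P n p q H hH b₁ b₂ hK hK' hP hn h0 hint hsep => ?_⟩
  refine h K K' P n p q H hH hP hn (norm_edge_le_of_mul_diam_le hc₁ b₁.1) (norm_edge_le_of_mul_diam_le hc₁ b₂.1) fun m η hη => ?_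
  obtain ⟨a, b, hab⟩ := duffyPV_inRef hη m
  have hb := b.chi_mem_panel P
  rw [hP.chi_eq] at hb ⊢
  exact vertex_lower_of_one_le hK hK' hc0 (h0.trans hP.1.symm) hcA hsep hint (a.chi_mem_body K)
    hb hab hc₂ hH.le b₁.2 b₂.2

theorem eventually_k1D {δ c₁ : ℝ} (hδ : 0 < δ) (hc₁ : 0 < c₁) :
    ∀ᶠ ρ in 𝓝[>] (1 / 2 : ℝ), ∀ s : ℝ, 0 < s → ∃ C : ℝ, 0 ≤ C ∧
      ∀ (K₁ K₂ : Tet) (p q : E3) (H : ℝ), 0 < H → c₁ * K₁.diam ≤ H → c₁ * K₂.diam ≤ H →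
      δ * H ≤ setDist K₁.body K₂.body →
      ExtendsBounded (k1D K₁ K₂ s p q) ρ (C * H ^ (3 - 2 * s)) := by
  have hJ : EntireExt fun η : Fin 6 → ℝ => η 0 ^ 2 * η 1 * η 3 ^ 2 * η 4 :=
    ((((EntireExt.coord 0).pow 2).mul (EntireExt.coord 1)).mul ((EntireExt.coord 3).pow 2)).mul
      (EntireExt.coord 4)
  filter_upwards [eventually_extendsBounded_beta (C₀ := 1 / c₁)
    (D := fun η : Fin 6 → ℝ => (refTet (η 0) (η 1) (η 2), refTet (η 3) (η 4) (η 5)))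
    (entireExt_refTet 0 1 2) (entireExt_refTet 3 4 5) hJ hδ (by positivity)] with ρ hρ s hs
  obtain ⟨C, hC, h⟩ := hρ s hs
  refine ⟨C, hC, fun K₁ K₂ p q H hH b₁ b₂ hd => ?_⟩
  exact h K₁ K₂ p q H hH (norm_edge_le_of_mul_diam_le hc₁ b₁) (norm_edge_le_of_mul_diam_le hc₁ b₂) fun η hη => hd.trans (setDist_le
    ((inRef_refTet (hη 0) (hη 1) (hη 2)).chi_mem_body K₁)
    ((inRef_refTet (hη 3) (hη 4) (hη 5)).chi_mem_body K₂))

theorem eventually_k2D {δ c₁ : ℝ} (hδ : 0 < δ) (hc₁ : 0 < c₁) :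
    ∀ᶠ ρ in 𝓝[>] (1 / 2 : ℝ), ∀ s : ℝ, 0 < s → ∃ C : ℝ, 0 ≤ C ∧
      ∀ (K K' : Tet) (P : Panel) (n p q : E3) (H : ℝ), 0 < H → c₁ * K.diam ≤ H →
      c₁ * K'.diam ≤ H → TetPanelFace K' P → ‖n‖ = 1 → δ * H ≤ setDist K.body P.body →
      ExtendsBounded (k2D K P n s p q) ρ (C * H ^ (3 - 2 * s)) := by
  have hJ : EntireExt fun η : Fin 5 → ℝ => η 0 ^ 2 * η 1 * η 3 :=
    (((EntireExt.coord 0).pow 2).mul (EntireExt.coord 1)).mul (EntireExt.coord 3)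
  have hD₂ : ∀ l, EntireExt fun η : Fin 5 → ℝ => (![η 3, η 3 * η 4] : Fin 2 → ℝ) l := by
    intro l
    fin_cases l
    exacts [EntireExt.coord 3, (EntireExt.coord 3).mul (EntireExt.coord 4)]
  filter_upwards [eventually_extendsBounded_ker₂ (C₀ := 1 / c₁)
    (D := fun η : Fin 5 → ℝ => (refTet (η 0) (η 1) (η 2), ![η 3, η 3 * η 4]))
    (entireExt_refTet 0 1 2) hD₂ hJ hδ (by positivity)] with ρ hρ s hs
  obtain ⟨C, hC, h⟩ := hρ s hs
  refine ⟨C, hC, fun K K' P n p q H hH b₁ b₂ hP hn hd => ?_⟩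
  refine h K K' P n p q H hH hP hn (norm_edge_le_of_mul_diam_le hc₁ b₁) (norm_edge_le_of_mul_diam_le hc₁ b₂) fun η hη => hd.trans (setDist_le
    ((inRef_refTet (hη 0) (hη 1) (hη 2)).chi_mem_body K) (P.chi_mem_body ?_ ?_ ?_))
  · exact (hη 3).2
  · exact (mul_mem_Icc_of_mem (hη 3).1 (hη 4)).2
  · exact (mul_mem_Icc_of_mem (hη 3).1 (hη 4)).1

end

/-! ### Passage to the mesh size and assembly -/

/-- Replaces the diameter of one element by the mesh size in the bound without touching `ρ`.
Monotonicity of the power requires `e ≥ 0`, which for `e = 3 - 2s` is guaranteed by `s < 1`. -/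
theorem ExtendsBounded.rescale {k : ℕ} {f : (Fin k → ℝ) → ℝ} {ρ C C' d h c₁ e : ℝ} (hC : 0 ≤ C)
    (hCC' : C ≤ C') (hd : 0 < d) (hc₁ : 0 < c₁) (hdh : c₁ * d ≤ h) (he : 0 ≤ e)
    (hf : ExtendsBounded f ρ (C * d ^ e)) : ExtendsBounded f ρ (C' / c₁ ^ e * h ^ e) := by
  refine hf.mono ?_
  have h1 : d ^ e ≤ h ^ e / c₁ ^ e := by
    rw [le_div_iff₀ (by positivity), mul_comm, ← Real.mul_rpow hc₁.le hd.le]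
    exact Real.rpow_le_rpow (by positivity) hdh he
  calc C * d ^ e ≤ C' * (h ^ e / c₁ ^ e) := mul_le_mul hCC' h1 (by positivity) (hC.trans hCC')
    _ = _ := by ring

end FracDuffy

end

open FracDuffy in
theorem lemma4p8 :
    -- identical tetrahedra, common face, panel that is a face
    (∀ θ : ℝ, 0 < θ → ∃ ρ : ℝ, 1 / 2 < ρ ∧
      ∀ s : ℝ, 0 < s → s < 1 → ∀ c₁ c₂ : ℝ, 0 < c₁ → 0 < c₂ → ∃ C : ℝ,
        ∀ T : Mesh, T.ShapeRegular θ → T.QuasiUniform c₁ c₂ → ∀ p ∈ T.nodes, ∀ q ∈ T.nodes,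
          (∀ K, T.HasTet K → ExtendsBounded (k1T K s p q) ρ (C * T.h ^ (3 - 2 * s))) ∧
          (∀ K₁ K₂, T.HasTet K₁ → T.HasTet K₂ → TetTetFace K₁ K₂ →
            ExtendsBounded (k1F K₁ K₂ s p q) ρ (C * T.h ^ (3 - 2 * s))) ∧
          (∀ K P n, T.HasTet K → T.HasPanel P → P.IsUnitNormal n → TetPanelFace K P →
            ExtendsBounded (k2F K P n s p q) ρ (C * T.h ^ (3 - 2 * s)))) ∧
    -- common edge
    (∀ θ cA : ℝ, 0 < θ → 0 < cA → ∃ ρ : ℝ, 1 / 2 < ρ ∧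
      ∀ s : ℝ, 0 < s → s < 1 → ∀ c₁ c₂ : ℝ, 0 < c₁ → 0 < c₂ → ∃ C : ℝ,
        ∀ T : Mesh, T.ShapeRegular θ → T.QuasiUniform c₁ c₂ → ∀ p ∈ T.nodes, ∀ q ∈ T.nodes,
          (∀ K₁ K₂, T.HasTet K₁ → T.HasTet K₂ → TetTetEdge K₁ K₂ →
            Separated cA K₁.body K₂.body →
            ExtendsBounded (k1E K₁ K₂ s p q) ρ (C * T.h ^ (3 - 2 * s))) ∧
          (∀ K P n, T.HasTet K → T.HasPanel P → P.IsUnitNormal n → TetPanelEdge K P →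
            Separated cA K.body P.body →
            ExtendsBounded (k2E K P n s p q) ρ (C * T.h ^ (3 - 2 * s)))) ∧
    -- common vertex
    (∀ θ cA c₁ c₂ : ℝ, 0 < θ → 0 < cA → 0 < c₁ → 0 < c₂ → ∃ ρ : ℝ, 1 / 2 < ρ ∧
      ∀ s : ℝ, 0 < s → s < 1 → ∃ C : ℝ,
        ∀ T : Mesh, T.ShapeRegular θ → T.QuasiUniform c₁ c₂ → ∀ p ∈ T.nodes, ∀ q ∈ T.nodes,
          (∀ K₁ K₂, T.HasTet K₁ → T.HasTet K₂ → TetTetVertex K₁ K₂ →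
            Separated cA K₁.body K₂.body →
            ExtendsBounded (k1V K₁ K₂ s p q) ρ (C * T.h ^ (3 - 2 * s))) ∧
          (∀ K P n, T.HasTet K → T.HasPanel P → P.IsUnitNormal n → TetPanelVertex K P →
            Separated cA K.body P.body →
            ExtendsBounded (k2V K P n s p q) ρ (C * T.h ^ (3 - 2 * s)))) ∧
    -- positive distance, bounded below by a multiple of the mesh size
    (∀ θ δ c₁ c₂ : ℝ, 0 < θ → 0 < δ → 0 < c₁ → 0 < c₂ → ∃ ρ : ℝ, 1 / 2 < ρ ∧
      ∀ s : ℝ, 0 < s → s < 1 → ∃ C : ℝ,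
        ∀ T : Mesh, T.ShapeRegular θ → T.QuasiUniform c₁ c₂ → ∀ p ∈ T.nodes, ∀ q ∈ T.nodes,
          (∀ K₁ K₂, T.HasTet K₁ → T.HasTet K₂ → δ * T.h ≤ setDist K₁.body K₂.body →
            ExtendsBounded (k1D K₁ K₂ s p q) ρ (C * T.h ^ (3 - 2 * s))) ∧
          (∀ K P n, T.HasTet K → T.HasPanel P → P.IsUnitNormal n →
            δ * T.h ≤ setDist K.body P.body →
            ExtendsBounded (k2D K P n s p q) ρ (C * T.h ^ (3 - 2 * s)))) := by
  refine ⟨fun θ hθ => ?_, fun θ cA hθ hcA => ?_, fun θ cA c₁ c₂ hθ hcA hc₁ hc₂ => ?_,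
    fun θ δ c₁ c₂ hθ hδ hc₁ hc₂ => ?_⟩
  · obtain ⟨c, hc0, hc1, hc⟩ := exists_coerciveWith hθ
    -- One `ρ` is picked from the intersection of the three eventual conditions, before `s`, `c₁`,
    -- `c₂` and the mesh are introduced.
    obtain ⟨ρ, ⟨hT, hF, hP⟩, hρ⟩ := (((eventually_k1T hc0 hc1).and ((eventually_k1F hc0 hc1).and
      (eventually_k2F hc0 hc1))).and self_mem_nhdsWithin).exists
    refine ⟨ρ, hρ, fun s hs hs1 c₁ c₂ hc₁ _ => ?_⟩
    obtain ⟨CT, hCT, hT⟩ := hT s hs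
    obtain ⟨CF, hCF, hF⟩ := hF s hs
    obtain ⟨CP, hCP, hP⟩ := hP s hs
    refine ⟨(CT + CF + CP) / c₁ ^ (3 - 2 * s), fun T hreg hq p _ q _ => ⟨?_, ?_, ?_⟩⟩
    · intro K hK
      exact (hT K p q (hc K (hreg K hK))).rescale hCT (by linarith) K.diam_pos hc₁
        (Mesh.h_bounds hq hK).1 (by linarith)
    · intro K₁ K₂ h₁ h₂ hf
      have hint := Mesh.body_inter_body_subset h₁ h₂
      rw [hf.2.2.2] at hint
      exact (hF K₁ K₂ p q (hc K₁ (hreg K₁ h₁)) (hc K₂ (hreg K₂ h₂))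
        ⟨hf.1, hf.2.1, hf.2.2.1⟩ hint).rescale hCF (by linarith) K₁.diam_pos hc₁
        (Mesh.h_bounds hq h₁).1 (by linarith)
    · intro K P n hK _ hn hf
      exact (hP K P n p q (hc K (hreg K hK)) hf hn.1).rescale hCP (by linarith) K.diam_pos hc₁
        (Mesh.h_bounds hq hK).1 (by linarith)
  · obtain ⟨c, hc0, hc1, hc⟩ := exists_coerciveWith hθ
    obtain ⟨ρ, ⟨hE, hP⟩, hρ⟩ := (((eventually_k1E hc0 hc1 hcA).and
      (eventually_k2E hc0 hc1 hcA)).and self_mem_nhdsWithin).exists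
    refine ⟨ρ, hρ, fun s hs hs1 c₁ c₂ hc₁ _ => ?_⟩
    obtain ⟨CE, hCE, hE⟩ := hE s hs
    obtain ⟨CP, hCP, hP⟩ := hP s hs
    refine ⟨(CE + CP) / c₁ ^ (3 - 2 * s), fun T hreg hq p _ q _ => ⟨?_, ?_⟩⟩
    · intro K₁ K₂ h₁ h₂ he hsep
      have hint := Mesh.body_inter_body_subset h₁ h₂
      rw [he.2.2] at hint
      exact (hE K₁ K₂ p q (hc K₁ (hreg K₁ h₁)) (hc K₂ (hreg K₂ h₂)) he.1 he.2.1 hint hsep).rescale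
        hCE (by linarith) K₁.diam_pos hc₁ (Mesh.h_bounds hq h₁).1 (by linarith)
    · intro K P n hK hPm hn he hsep
      -- The panel inherits shape regularity from a mesh tetrahedron `K'` having it as a face;
      -- separation still refers to the panel itself.
      obtain ⟨K', hK', hf⟩ := hPm.exists_tet
      have hint := Mesh.body_inter_panel_subset hK hPm
      rw [he.2.2] at hint
      exact (hP K K' P n p q (hc K (hreg K hK)) (hc K' (hreg K' hK')) hf hn.1 he.1 he.2.1 hint
        hsep).rescale hCP (by linarith) K.diam_pos hc₁ (Mesh.h_bounds hq hK).1 (by linarith)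
  · obtain ⟨c, hc0, hc1, hc⟩ := exists_coerciveWith hθ
    obtain ⟨ρ, ⟨hV, hP⟩, hρ⟩ := (((eventually_k1V hc0 hcA hc₁ hc₂).and
      (eventually_k2V hc0 hcA hc₁ hc₂)).and self_mem_nhdsWithin).exists
    refine ⟨ρ, hρ, fun s hs _ => ?_⟩
    obtain ⟨CV, hCV, hV⟩ := hV s hs
    obtain ⟨CP, hCP, hP⟩ := hP s hs
    refine ⟨CV + CP, fun T hreg hq p _ q _ => ⟨?_, ?_⟩⟩
    · intro K₁ K₂ h₁ h₂ hv hsep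
      have hint := Mesh.body_inter_body_subset h₁ h₂
      rw [hv.2] at hint
      have hh := Mesh.h_pos hc₁ hq h₁
      exact (hV K₁ K₂ p q T.h hh (Mesh.h_bounds hq h₁) (Mesh.h_bounds hq h₂)
        (hc K₁ (hreg K₁ h₁)) (hc K₂ (hreg K₂ h₂)) hv.1 hint hsep).mono
        (mul_le_mul_of_nonneg_right (by linarith) (Real.rpow_nonneg hh.le _))
    · intro K P n hK hPm hn hv hsep
      obtain ⟨K', hK', hf⟩ := hPm.exists_tet
      have hint := Mesh.body_inter_panel_subset hK hPm
      rw [hv.2] at hint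
      have hh := Mesh.h_pos hc₁ hq hK
      exact (hP K K' P n p q T.h hh (Mesh.h_bounds hq hK) (Mesh.h_bounds hq hK')
        (hc K (hreg K hK)) (hc K' (hreg K' hK')) hf hn.1 hv.1 hint hsep).mono
        (mul_le_mul_of_nonneg_right (by linarith) (Real.rpow_nonneg hh.le _))
  · obtain ⟨ρ, ⟨hD, hP⟩, hρ⟩ := (((eventually_k1D hδ hc₁).and
      (eventually_k2D hδ hc₁)).and self_mem_nhdsWithin).exists
    refine ⟨ρ, hρ, fun s hs _ => ?_⟩
    obtain ⟨CD, hCD, hD⟩ := hD s hs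
    obtain ⟨CP, hCP, hP⟩ := hP s hs
    refine ⟨CD + CP, fun T _ hq p _ q _ => ⟨?_, ?_⟩⟩
    · intro K₁ K₂ h₁ h₂ hd
      have hh := Mesh.h_pos hc₁ hq h₁
      exact (hD K₁ K₂ p q T.h hh (Mesh.h_bounds hq h₁).1 (Mesh.h_bounds hq h₂).1 hd).mono
        (mul_le_mul_of_nonneg_right (by linarith) (Real.rpow_nonneg hh.le _))
    · intro K P n hK hPm hn hd
      obtain ⟨K', hK', hf⟩ := hPm.exists_tet
      have hh := Mesh.h_pos hc₁ hq hK
      exact (hP K K' P n p q T.h hh (Mesh.h_bounds hq hK).1 (Mesh.h_bounds hq hK').1 hf hn.1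
        hd).mono (mul_le_mul_of_nonneg_right (by linarith) (Real.rpow_nonneg hh.le _))
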